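/- **Medium.** Let $\zeta=(\zeta_r)_{r\in\mathbb Z}$ be real random variables with law $\mathbb P$ on $\mathbb R^{\mathbb Z}$ such that: (i) $\zeta_r\ge 0$ $\mathbb P$-a.s. for every $r$, and $\zeta_1$ is not $\mathbb P$-a.s. equal to $0$; (ii) $\mathbb P$ is invariant and ergodic under the shift of $\mathbb Z$; (iii) $\mathbb E[e^{q\zeta_1}]<\infty$ for some $q\ge 2$; (iv) (entanglement) there are $C,g>0$ such that for all finite $\Delta,A\subseteq\mathbb Z$ and all $V\subseteq\mathbb Z$ with $\Delta\subseteq V$ and $A\subseteq V^c$, writing $\mathbb P((\zeta_r)_{r\in\Delta}\in\cdot\mid\eta)$ for a regular conditional law of $(\zeta_r)_{r\in\Delta}$ given $(\zeta_r)_{r\in V^c}=(\eta_r)_{r\in V^c}$, there is a set of full $\mathbb P$-measure such that $$\frac{d\mathbb P((\zeta_r)_{r\in\Delta}\in\cdot\mid\eta)}{d\mathbb P((\zeta_r)_{r\in\Delta}\in\cdot\mid\eta')}\le\exp\Big(C\sum_{r\in\Delta,\,u\in A}e^{-g|r-u|}\Big)$$ for all $\eta,\eta'$ in this set that agree on $V^c\setminus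 A$. The scatterers are the points $(\omega_r)_{r\in\mathbb Z}$ with $\omega_0=0$ and $\omega_r-\omega_{r-1}=\zeta_r$ for all $r\in\mathbb Z$. **Walk.** Let $0\le p<3/4$ and let $V^{(p)}_1,V^{(p)}_2,\dots$, with law $P^{(p)}_0$, be the steps of the step-reinforced (elephant) random walk: $V^{(p)}_1=\pm1$ with probability $\frac12$ each, and for every $n\ge1$, given $V^{(p)}_1,\dots,V^{(p)}_n$, an index $k$ is chosen uniformly in $\{1,\dots,n\}$ and $V^{(p)}_{n+1}$ equals $V^{(p)}_k$ with probability $p$ and $-V^{(p)}_k$ with probability $1-p$. Put $S^{(p)}_n=\sum_{k=1}^nV^{(p)}_k$. **Gas.** For a fixed medium put $X^{(p)}_n=\omega_{S^{(p)}_n}$, $T^{(p)}_n=\sum_{k=1}^n|X^{(p)}_k-X^{(p)}_{k-1}|$, and $$\widetilde X^{(p)}_t=\omega_{S^{(p)}_{n-1}}+V^{(p)}_n\,(t-T^{(p)}_{n-1})\qquad\text{when }T^{(p)}_{n-1}\le t<T^{(p)}_n,\ n\ge1.$$ **Theorem.** There is a deterministic $\ell>0$ with $\lim_{n\to\infty}n^{-1}\omega_n=\ell$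 $\mathbb P$-a.s., and for $\mathbb P$-almost every medium the following holds under $P^{(p)}_0$: $T^{(p)}_n\to\infty$ almost surely (so that $\widetilde X^{(p)}_t$ is almost surely well defined for all $t\ge0$), and in distribution $$\frac{X^{(p)}_n}{\sqrt n}\xrightarrow[n\to\infty]{}\mathcal N\Big(0,\frac{\ell^2}{3-4p}\Big),\qquad \frac{\widetilde X^{(p)}_t}{\sqrt t}\xrightarrow[t\to\infty]{}\mathcal N\Big(0,\frac{\ell}{3-4p}\Big),$$ where $\mathcal N(0,\sigma^2)$ is the centered Gaussian law with variance $\sigma^2$. -/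

import Mathlib

open MeasureTheory ProbabilityTheory Filter Topology

noncomputable section

namespace LevyLorentz

/-! ### The random medium

A configuration of the medium is the two-sided sequence `ζ : ℤ → ℝ` of the distances between
neighbouring scatterers; the law of the medium is a probability measure on `ℤ → ℝ`. -/

/-- The shift of a configuration by one site. -/
def shift (ζ : ℤ → ℝ) : ℤ → ℝ := fun r => ζ (r + 1)

/-- The position `ω_r` of the scatterer with label `r`, normalized by `ω_0 = 0` and
`ω_r - ω_{r-1} = ζ_r` for all `r ∈ ℤ`. -/
def scatterer (ζ : ℤ → ℝ) (r : ℤ) : ℝ :=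
  ∑ i ∈ Finset.Ioc 0 r, ζ i - ∑ i ∈ Finset.Ioc r 0, ζ i

/-- A regular version of the conditional law, under `μ`, of `(ζ_r)_{r ∈ Δ}` given that
`(ζ_r)_{r ∉ V}` coincides with `(η_r)_{r ∉ V}`. -/
def condLaw (μ : Measure (ℤ → ℝ)) [IsProbabilityMeasure μ] (Δ : Finset ℤ) (V : Set ℤ)
    (η : ℤ → ℝ) : Measure (Δ → ℝ) :=
  condDistrib (fun ζ : ℤ → ℝ => fun r : Δ => ζ r)
    (fun ζ : ℤ → ℝ => fun r : (Vᶜ : Set ℤ) => ζ r) μ (fun r : (Vᶜ : Set ℤ) => η r)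

/-- The entanglement condition: with constants `C, g > 0`, for all finite `Δ, A ⊆ ℤ` and all `V`
with `Δ ⊆ V` and `A ⊆ Vᶜ` (so that `Δ` and `Vᶜ` are at distance at least `1`), the
Radon-Nikodym derivative of the conditional law of `(ζ_r)_{r ∈ Δ}` given `η` with respect to the
one given `η'` is at most `exp (C ∑_{r ∈ Δ, u ∈ A} e^{-g|r-u|})`, simultaneously for all pairs
`η, η'` in a set of full measure which agree on `Vᶜ \ A`.
That `dκ/dκ₀ ≤ c` is written as the inequality `κ ≤ c • κ₀` of measures. -/
def Entangled (μ : Measure (ℤ → ℝ)) [IsProbabilityMeasure μ] : Prop :=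
  ∃ C > (0 : ℝ), ∃ g > (0 : ℝ), ∀ (Δ A : Finset ℤ) (V : Set ℤ),
    (Δ : Set ℤ) ⊆ V → (A : Set ℤ) ⊆ Vᶜ →
    ∃ G : Set (ℤ → ℝ), (∀ᵐ η ∂μ, η ∈ G) ∧
      ∀ η ∈ G, ∀ η' ∈ G, (∀ u ∈ Vᶜ \ (A : Set ℤ), η u = η' u) →
        condLaw μ Δ V η ≤
          ENNReal.ofReal
            (Real.exp (C * ∑ r ∈ Δ, ∑ u ∈ A, Real.exp (-g * |((r - u : ℤ) : ℝ)|))) •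
          condLaw μ Δ V η'

/-- The standing assumptions on the law of the distances `(ζ_r)_{r ∈ ℤ}`: the scatterers are in
ascending order and do not all coincide, the law is shift-invariant and ergodic, it satisfies the
entanglement condition, and it has a finite exponential moment of some order `q ≥ 2`. -/
structure IsEntangledMedium (μ : Measure (ℤ → ℝ)) [IsProbabilityMeasure μ] : Prop where
  nonneg : ∀ r : ℤ, ∀ᵐ ζ ∂μ, 0 ≤ ζ r
  nondegenerate : ¬ ∀ᵐ ζ ∂μ, ζ 1 = 0
  ergodic : Ergodic shift μ
  entangled : Entangled μ
  exp_moment : ∃ q : ℝ, 2 ≤ q ∧ Integrable (fun ζ : ℤ → ℝ => Real.exp (q * ζ 1)) μ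

/-! ### The step-reinforced random walk -/

/-- The probability that the next step equals `e` when the previous steps are `v 0, …, v (n - 1)`:
an index `k` is chosen uniformly, and the step is `v k` with probability `p` and `-v k` with
probability `1 - p`. -/
def nextStepProb (p : ℝ) {n : ℕ} (v : Fin n → ℤ) (e : ℤ) : ℝ :=
  ∑ k : Fin n, (1 / (n : ℝ)) *
    (p * (if e = v k then 1 else 0) + (1 - p) * (if e = -v k then 1 else 0))

/-- `V 0, V 1, V 2, …` are the successive steps of a step-reinforced random walk with memory
parameter `p` (`V i` is the step number `i + 1`). -/
structure IsStepReinforced {Ω : Type*} [MeasurableSpace Ω] (p : ℝ) (V : ℕ → Ω → ℤ)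
    (P : Measure Ω) : Prop where
  measurable : ∀ n, Measurable (V n)
  first_pos : P.real {x | V 0 x = 1} = 1 / 2
  first_neg : P.real {x | V 0 x = -1} = 1 / 2
  step : ∀ n : ℕ, 1 ≤ n → ∀ (v : Fin n → ℤ) (e : ℤ),
    P.real {x | (∀ k : Fin n, V k x = v k) ∧ V n x = e} =
      P.real {x | ∀ k : Fin n, V k x = v k} * nextStepProb p v e

/-- The position `S_n` after `n` steps of a walk with steps `v 0, v 1, …`. -/
def walk (v : ℕ → ℤ) (n : ℕ) : ℤ := ∑ i ∈ Finset.range n, v i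

/-! ### The gas driven by a walk with steps `v` in the medium with distances `ζ` -/

/-- The discrete-time gas `X_n = ω_{S_n}`. -/
def gas (ζ : ℤ → ℝ) (v : ℕ → ℤ) (n : ℕ) : ℝ := scatterer ζ (walk v n)

/-- The collision times `T_n = ∑_{k=1}^n |X_k - X_{k-1}|`. -/
def collisionTime (ζ : ℤ → ℝ) (v : ℕ → ℤ) (n : ℕ) : ℝ :=
  ∑ k ∈ Finset.range n, |gas ζ v (k + 1) - gas ζ v k|

open Classical in
/-- The continuous-time gas: `ω_{S_n} + v_n (t - T_n)` for the (unique) `n` with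
`T_n ≤ t < T_{n+1}`, where `v_n` is the step from `S_n` to `S_{n+1}`. The value `0` is only used
when there is no such `n`, which for `t ≥ 0` means that the collision times do not exceed `t`. -/
def continuousGas (ζ : ℤ → ℝ) (v : ℕ → ℤ) (t : ℝ) : ℝ :=
  if h : ∃ n, collisionTime ζ v n ≤ t ∧ t < collisionTime ζ v (n + 1) then
    gas ζ v (Nat.find h) + (v (Nat.find h) : ℝ) * (t - collisionTime ζ v (Nat.find h))
  else 0

end LevyLorentz

end

set_option linter.unusedSectionVars false

noncomputable section

namespace LevyLorentz

/-! ### Random variables with finitely many values -/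

section FinitelyManyValues

variable {Ω : Type*} [MeasurableSpace Ω] {P : Measure Ω} [IsProbabilityMeasure P]
  {β : Type*} [MeasurableSpace β] [MeasurableSingletonClass β]
  {E : Type*} [NormedAddCommGroup E]

/-! On the scale `√n` the medium looks deterministic. Decay of correlations gives `ω_r = ℓ r +
o(|r|)` on both half-lines, with `ℓ = E ζ_1`, so `X_n` is `ℓ S_n` up to `o(√n)`. What remains
concerns the walk and the clock.

Walk. Given the past, a step is `±1` with mean `α S_n / n`, where `α = 2p - 1`
(`nextStepProb_of_signs`). Hence `E exp(iθ S_{n+1})` is nearly `exp(-θ²/2) E exp(iθ(1 + α/n) S_n)`.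
Iterating backwards from `θ = t/√n` collects squared weights whose sum tends to `t²/(1 - 2α) = t²/(3
- 4p)`, finite because `p < 3/4` (`norm_charFun_sub_le`, `tendsto_weightedGrowth_one`).

Clock. `T_n` adds up the gaps crossed by the walk. For a frozen walk its variance in the medium is
at most a constant times `∑_{j,k<n} e^{-g|S_k - S_j|}` (`exists_variance_le`). The walk seldom
revisits: over short late blocks it is nearly a simple random walk, whose local limit bound makes
the mean of this sum `O(n²/N²)` along `n = N^16` (`exists_sum_integral_comp_pos_sub_le`).
Summability in `N`, monotonicity of `T_n` and Fubini give `T_n / n → ℓ` in almost every medium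
(`ae_tendsto_collisionTime`).

Time change. Time `t` therefore falls in a flight with number close to `t/ℓ`. By Doob's inequality
the walk moves little on the scale `√t` over a window of length `δt` (`measureReal_oscillation_le`).
So the continuous gas is `ℓ S_{⌊t/ℓ⌋} + o(√t)`, with asymptotic variance `ℓ² (t/ℓ) / (3 - 4p)`. -/

lemma ae_eq_sum_indicator {Y : Ω → β} {B : Finset β}
    (hB : ∀ᵐ x ∂P, Y x ∈ B) (H : β → E) :
    (fun x => H (Y x)) =ᵐ[P] fun x => ∑ b ∈ B, (Y ⁻¹' {b}).indicator (fun _ => H b) x := by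
  classical
  filter_upwards [hB] with x hx
  rw [Finset.sum_eq_single (Y x)]
  · simp
  · intro b _ hb
    simp [hb.symm]
  · exact fun h => absurd hx h

/-- Expectations over finitely many steps are finite sums, so `H` needs neither measurability nor
bounds. -/
lemma integrable_of_mem_finset {Y : Ω → β} (hY : Measurable Y) {B : Finset β}
    (hB : ∀ᵐ x ∂P, Y x ∈ B) (H : β → E) : Integrable (fun x => H (Y x)) P := by
  refine Integrable.congr ?_ (ae_eq_sum_indicator hB H).symm
  exact integrable_finsetSum _ fun b _ =>
    (integrable_const (H b)).indicator (hY (measurableSet_singleton b))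

lemma integral_of_mem_finset [NormedSpace ℝ E] [CompleteSpace E] {Y : Ω → β} (hY : Measurable Y)
    {B : Finset β}
    (hB : ∀ᵐ x ∂P, Y x ∈ B) (H : β → E) :
    ∫ x, H (Y x) ∂P = ∑ b ∈ B, P.real (Y ⁻¹' {b}) • H b := by
  rw [integral_congr_ae (ae_eq_sum_indicator hB H), integral_finsetSum]
  · refine Finset.sum_congr rfl fun b _ => ?_
    rw [integral_indicator_const _ (hY (measurableSet_singleton b))]
  · exact fun b _ => (integrable_const (H b)).indicator (hY (measurableSet_singleton b))

/-- The law of the walk is given only through the probabilities of atoms; that the steps are signs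
is recovered from atoms of total mass one. -/
lemma ae_mem_of_sum_eq_one {Y : Ω → β} (hY : Measurable Y) {B : Finset β}
    (h : ∑ b ∈ B, P.real (Y ⁻¹' {b}) = 1) : ∀ᵐ x ∂P, Y x ∈ B := by
  have h1 : P (Y ⁻¹' (B : Set β)) = 1 := by
    rw [← sum_measure_preimage_singleton B fun b _ => hY (measurableSet_singleton b)]
    have : ∑ b ∈ B, P (Y ⁻¹' {b}) = ENNReal.ofReal (∑ b ∈ B, P.real (Y ⁻¹' {b})) := by
      rw [ENNReal.ofReal_sum_of_nonneg fun _ _ => measureReal_nonneg]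
      simp [Measure.real]
    rw [this, h, ENNReal.ofReal_one]
  have h2 : MeasurableSet (Y ⁻¹' (B : Set β)) := hY B.measurableSet
  have := (prob_compl_eq_zero_iff h2).2 h1
  exact this

end FinitelyManyValues

/-! ### The one-step transition of the step-reinforced walk -/

section Walk

variable {Ω : Type*} [MeasurableSpace Ω] {P : Measure Ω} [IsProbabilityMeasure P] {p : ℝ}
  {V : ℕ → Ω → ℤ}

/-- The first `n` steps. -/
def past (V : ℕ → Ω → ℤ) (n : ℕ) (x : Ω) : Fin n → ℤ := fun k => V k x

/-- The vectors of `n` signs. -/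
def signs (n : ℕ) : Finset (Fin n → ℤ) := Fintype.piFinset fun _ => {1, -1}

/-- The position of the walk after `n` steps. -/
def pos (V : ℕ → Ω → ℤ) (n : ℕ) (x : Ω) : ℤ := walk (fun i => V i x) n

/-- The conditional mean of step number `n + 1` given the first `n` steps. -/
def drift (p : ℝ) (V : ℕ → Ω → ℤ) (n : ℕ) (x : Ω) : ℝ := (2 * p - 1) * pos V n x / n

lemma pos_succ (n : ℕ) (x : Ω) : pos V (n + 1) x = pos V n x + V n x := by
  simp [pos, walk, Finset.sum_range_succ]

lemma pos_zero (x : Ω) : pos V 0 x = 0 := by simp [pos, walk]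

lemma pos_eq_sum_past {j n : ℕ} (h : j ≤ n) (x : Ω) :
    pos V j x = ∑ k : Fin j, past V n x (Fin.castLE h k) := by
  simp only [pos, walk, past, Fin.val_castLE]
  rw [Fin.sum_univ_eq_sum_range (fun i => V i x)]

/-- For signs, `1_{e = v} = (1 + e v) / 2`, so each index contributes `(1 + (2p - 1) e v_k) / 2`.
The transition sees the past only through `S_n / n`. -/
lemma nextStepProb_of_signs {n : ℕ} (hn : 1 ≤ n) {v : Fin n → ℤ} (hv : v ∈ signs n) {e : ℤ}
    (he : e = 1 ∨ e = -1) :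
    nextStepProb p v e = (1 + e * ((2 * p - 1) * (∑ k, v k : ℤ) / n)) / 2 := by
  have hn' : (n : ℝ) ≠ 0 := by positivity
  have h : ∀ k, (1 / (n : ℝ)) *
      (p * (if e = v k then 1 else 0) + (1 - p) * (if e = -v k then 1 else 0)) =
      1 / n * (1 / 2) + e * (2 * p - 1) / (2 * n) * v k := by
    intro k
    have hk : v k = 1 ∨ v k = -1 := by
      simpa using Fintype.mem_piFinset.1 hv k
    rcases he with rfl | rfl <;> rcases hk with hk | hk <;> simp [hk] <;> field_simp <;> ring
  simp only [nextStepProb]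
  rw [Finset.sum_congr rfl fun k _ => h k, Finset.sum_add_distrib, ← Finset.mul_sum,
    ← Finset.mul_sum]
  push_cast
  simp only [Finset.sum_const, Finset.card_univ, Fintype.card_fin, nsmul_eq_mul]
  field_simp

namespace IsStepReinforced

lemma measurable_past (hV : IsStepReinforced p V P) (n : ℕ) : Measurable (past V n) :=
  measurable_pi_lambda _ fun k => hV.measurable k

lemma measurable_pos (hV : IsStepReinforced p V P) (n : ℕ) : Measurable (pos V n) :=
  Finset.measurable_fun_sum (Finset.range n) fun i _ => hV.measurable i

lemma measureReal_past_step (hV : IsStepReinforced p V P) {n : ℕ} (hn : 1 ≤ n)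
    {v : Fin n → ℤ} (hv : v ∈ signs n) {e : ℤ} (he : e = 1 ∨ e = -1) :
    P.real ((fun x => (past V n x, V n x)) ⁻¹' {(v, e)}) =
      P.real (past V n ⁻¹' {v}) * ((1 + e * ((2 * p - 1) * (∑ k, v k : ℤ) / n)) / 2) := by
  rw [← nextStepProb_of_signs hn hv he]
  convert hV.step n hn v e using 3
  · ext x
    simp [past, funext_iff]
  · ext x
    simp [past, funext_iff]

/-- Induction: the two continuations `±1` of a past made of signs carry all of its mass, since their
conditional probabilities add up to one. -/
lemma ae_past_mem (hV : IsStepReinforced p V P) (n : ℕ) : ∀ᵐ x ∂P, past V n x ∈ signs n := by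
  induction n with
  | zero => exact ae_of_all _ fun x => Fintype.mem_piFinset.2 fun i => i.elim0
  | succ n ih =>
    have key : ∀ᵐ x ∂P, V n x = 1 ∨ V n x = -1 := by
      rcases Nat.eq_zero_or_pos n with rfl | hn
      · have h := ae_mem_of_sum_eq_one (P := P) (hV.measurable 0) (B := {1, -1}) (by
          rw [Finset.sum_pair (by norm_num)]
          have h1 := hV.first_pos
          have h2 := hV.first_neg
          simp only [Set.preimage, Set.mem_singleton_iff]
          rw [h1, h2]; norm_num)
        filter_upwards [h] with x hx
        simpa using hx
      · have hm : Measurable fun x => (past V n x, V n x) :=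
          (hV.measurable_past n).prodMk (hV.measurable n)
        have h := ae_mem_of_sum_eq_one (P := P) hm (B := signs n ×ˢ {1, -1}) (by
          rw [Finset.sum_product]
          have : ∀ v ∈ signs n, ∑ e ∈ ({1, -1} : Finset ℤ),
              P.real ((fun x => (past V n x, V n x)) ⁻¹' {(v, e)}) =
              P.real (past V n ⁻¹' {v}) • (1 : ℝ) := by
            intro v hv
            rw [Finset.sum_pair (by norm_num), hV.measureReal_past_step hn hv (Or.inl rfl),
              hV.measureReal_past_step hn hv (Or.inr rfl)]
            push_cast
            rw [smul_eq_mul]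
            ring
          rw [Finset.sum_congr rfl this,
            ← integral_of_mem_finset (hV.measurable_past n) ih fun _ => (1 : ℝ)]
          simp)
        filter_upwards [h] with x hx
        simpa using (Finset.mem_product.1 hx).2
    filter_upwards [ih, key] with x hx hk
    refine Fintype.mem_piFinset.2 fun i => ?_
    refine Fin.lastCases ?_ (fun i => ?_) i
    · simpa [past] using hk
    · exact Fintype.mem_piFinset.1 hx i

lemma ae_step (hV : IsStepReinforced p V P) : ∀ᵐ x ∂P, ∀ n, V n x = 1 ∨ V n x = -1 := by
  rw [ae_all_iff]
  intro n
  filter_upwards [hV.ae_past_mem (n + 1)] with x hx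
  simpa [past] using Fintype.mem_piFinset.1 hx (Fin.last n)

variable {E : Type*} [NormedAddCommGroup E]

lemma integrable_past (hV : IsStepReinforced p V P) (n : ℕ) (H : (Fin n → ℤ) → E) :
    Integrable (fun x => H (past V n x)) P :=
  integrable_of_mem_finset (hV.measurable_past n) (hV.ae_past_mem n) H

lemma integrable_pos (hV : IsStepReinforced p V P) (j n : ℕ) (f : ℤ → ℤ → E) :
    Integrable (fun x => f (pos V j x) (pos V n x)) P := by
  have h := hV.integrable_past (max j n) fun v => f (∑ k : Fin j, v (Fin.castLE (by omega) k))
    (∑ k : Fin n, v (Fin.castLE (by omega) k))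
  refine h.congr (ae_of_all _ fun x => ?_)
  simp only
  rw [pos_eq_sum_past (le_max_left j n), pos_eq_sum_past (le_max_right j n)]

variable [NormedSpace ℝ E] [CompleteSpace E]

/-- The transition of the walk: averaging over the next step given the past. -/
lemma integral_past_step (hV : IsStepReinforced p V P) {n : ℕ} (hn : 1 ≤ n)
    (G : (Fin n → ℤ) → ℤ → E) :
    ∫ x, G (past V n x) (V n x) ∂P =
      ∫ x, (((1 + drift p V n x) / 2) • G (past V n x) 1 +
        ((1 - drift p V n x) / 2) • G (past V n x) (-1)) ∂P := by
  have hm : Measurable fun x => (past V n x, V n x) :=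
    (hV.measurable_past n).prodMk (hV.measurable n)
  have hB : ∀ᵐ x ∂P, (past V n x, V n x) ∈ signs n ×ˢ ({1, -1} : Finset ℤ) := by
    filter_upwards [hV.ae_past_mem n, hV.ae_step] with x hx hs
    refine Finset.mem_product.2 ⟨hx, ?_⟩
    simpa using hs n
  rw [integral_of_mem_finset hm hB fun y => G y.1 y.2, Finset.sum_product]
  have h : ∀ v ∈ signs n, ∑ e ∈ ({1, -1} : Finset ℤ),
      P.real ((fun x => (past V n x, V n x)) ⁻¹' {(v, e)}) • G v e =
      P.real (past V n ⁻¹' {v}) • (((1 + (2 * p - 1) * (∑ k, v k : ℤ) / n) / 2) • G v 1 +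
        ((1 - (2 * p - 1) * (∑ k, v k : ℤ) / n) / 2) • G v (-1)) := by
    intro v hv
    rw [Finset.sum_pair (by norm_num), hV.measureReal_past_step hn hv (Or.inl rfl),
      hV.measureReal_past_step hn hv (Or.inr rfl), smul_add, smul_smul, smul_smul]
    push_cast
    simp only [one_mul, neg_one_mul, ← sub_eq_add_neg]
  rw [Finset.sum_congr rfl h, ← integral_of_mem_finset (hV.measurable_past n) (hV.ae_past_mem n)
    fun v => (((1 + (2 * p - 1) * (∑ k, v k : ℤ) / n) / 2) • G v 1 +
        ((1 - (2 * p - 1) * (∑ k, v k : ℤ) / n) / 2) • G v (-1))]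
  refine integral_congr_ae (ae_of_all _ fun x => ?_)
  simp only [drift, pos_eq_sum_past le_rfl, Fin.castLE_rfl, id]

/-- The earlier position `S_j` stays frozen, as needed for the increments `S_k - S_j` in the count
of returns; `j = 0` gives functions of `S_n` alone. -/
lemma integral_pos_step (hV : IsStepReinforced p V P) {j n : ℕ} (hn : 1 ≤ n) (hj : j ≤ n)
    (f : ℤ → ℤ → E) :
    ∫ x, f (pos V j x) (pos V (n + 1) x) ∂P =
      ∫ x, (((1 + drift p V n x) / 2) • f (pos V j x) (pos V n x + 1) +
        ((1 - drift p V n x) / 2) • f (pos V j x) (pos V n x - 1)) ∂P := by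
  have h := hV.integral_past_step hn fun v e => f (∑ k : Fin j, v (Fin.castLE hj k))
    (∑ k : Fin n, v (Fin.castLE le_rfl k) + e)
  simp only [← pos_eq_sum_past] at h
  simp only [pos_succ]
  rw [h]
  rfl

/-! ### The second moment of the walk -/

lemma integral_pos_sq_succ (hV : IsStepReinforced p V P) {n : ℕ} (hn : 1 ≤ n) :
    ∫ x, (pos V (n + 1) x : ℝ) ^ 2 ∂P =
      (1 + 2 * (2 * p - 1) / n) * ∫ x, (pos V n x : ℝ) ^ 2 ∂P + 1 := by
  rw [hV.integral_pos_step (j := 0) hn (Nat.zero_le _) fun _ s => (s : ℝ) ^ 2]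
  have h : ∀ x, (((1 + drift p V n x) / 2) • ((pos V n x + 1 : ℤ) : ℝ) ^ 2 +
        ((1 - drift p V n x) / 2) • ((pos V n x - 1 : ℤ) : ℝ) ^ 2) =
        (1 + 2 * (2 * p - 1) / n) * (pos V n x : ℝ) ^ 2 + 1 := by
    intro x
    simp only [drift, smul_eq_mul]
    push_cast
    ring
  simp only [h]
  rw [integral_add, integral_const_mul]
  · simp
  · exact (hV.integrable_pos 0 n fun _ s => (s : ℝ) ^ 2).const_mul _
  · exact integrable_const _

end IsStepReinforced

end Walk

end LevyLorentz

end

noncomputable section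

namespace LevyLorentz

/-! ### Sublinear growth of solutions of linear recursions -/

/-- The exponent `b = (1 + β) / 2` lies strictly between `β` and `1`: `n ^ b` grows by a factor of
about `1 + b / n`, which beats `1 + β / n`, yet it is `o(n)`. -/
lemma exists_rpow_supersolution {β : ℝ} (h0 : 0 ≤ β) (h1 : β < 1) :
    ∃ b < (1 : ℝ), ∀ᶠ n : ℕ in atTop,
      (1 + β / n) * (n : ℝ) ^ b ≤ ((n + 1 : ℕ) : ℝ) ^ b := by
  refine ⟨(1 + β) / 2, by linarith, ?_⟩
  set b := (1 + β) / 2 with hb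
  -- This threshold is what `β / n ≤ b / (n + 1)` requires.
  obtain ⟨n₀, hn₀⟩ := exists_nat_ge (2 * β / (1 - β))
  filter_upwards [eventually_ge_atTop (max n₀ 1)] with n hn
  have hn1 : 1 ≤ n := le_trans (le_max_right _ _) hn
  have hnpos : (0 : ℝ) < n := by exact_mod_cast hn1
  have hn0 : 2 * β / (1 - β) ≤ n := hn₀.trans (by exact_mod_cast le_trans (le_max_left _ _) hn)
  rw [div_le_iff₀ (by linarith)] at hn0
  have hsplit : ((n + 1 : ℕ) : ℝ) = (1 + 1 / n) * n := by
    push_cast; field_simp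
  rw [hsplit, Real.mul_rpow (by positivity) hnpos.le]
  refine mul_le_mul_of_nonneg_right ?_ (by positivity)
  have hpos : (0 : ℝ) < 1 + 1 / n := by positivity
  have hlog : 1 / ((n : ℝ) + 1) ≤ Real.log (1 + 1 / n) := by
    have := Real.one_sub_inv_le_log_of_pos hpos
    refine le_trans (le_of_eq ?_) this
    field_simp
    ring
  rw [Real.rpow_def_of_pos hpos]
  refine le_trans ?_ (Real.add_one_le_exp _)
  have hbpos : 0 ≤ b := by rw [hb]; linarith
  have h2 : β / n ≤ b * (1 / ((n : ℝ) + 1)) := by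
    rw [mul_one_div, div_le_div_iff₀ hnpos (by positivity), hb]
    nlinarith
  nlinarith [mul_le_mul_of_nonneg_right hlog hbpos]

/-- If `|x (n + 1)| ≤ (1 + β / n) |x n| + ε n` with `β < 1` and `ε n → 0`, then `x n = o(n)`. -/
lemma tendsto_div_of_recursion {x ε : ℕ → ℝ} {β : ℝ} (h0 : 0 ≤ β) (h1 : β < 1)
    (hε : Tendsto ε atTop (𝓝 0))
    (hx : ∀ᶠ n : ℕ in atTop, |x (n + 1)| ≤ (1 + β / n) * |x n| + ε n) :
    Tendsto (fun n : ℕ => x n / n) atTop (𝓝 0) := by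
  obtain ⟨b, hb, hsup⟩ := exists_rpow_supersolution h0 h1
  rw [Metric.tendsto_nhds]
  intro δ hδ
  -- The majorant will be `δ / 2 * n + K * n ^ b`. One step of the recursion sends its linear part
  -- to `δ / 2 * (n + β)`, which leaves room `δ / 2 * (1 - β)` for `ε n`.
  have hε' : ∀ᶠ n in atTop, ε n ≤ δ / 2 * (1 - β) := by
    have : (0 : ℝ) < δ / 2 * (1 - β) := mul_pos (by linarith) (by linarith)
    filter_upwards [hε.eventually_lt_const this] with n hn using hn.le
  obtain ⟨N, hN⟩ := eventually_atTop.1 (hsup.and (hx.and (hε'.and (eventually_ge_atTop 1))))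
  have hN1 : 1 ≤ N := (hN N le_rfl).2.2.2
  have hNpos : (0 : ℝ) < (N : ℝ) ^ b := Real.rpow_pos_of_pos (by exact_mod_cast hN1) _
  set K : ℝ := |x N| / (N : ℝ) ^ b with hK
  have hKnonneg : 0 ≤ K := by positivity
  have key : ∀ n ≥ N, |x n| ≤ δ / 2 * n + K * (n : ℝ) ^ b := by
    intro n hn
    induction n, hn using Nat.le_induction with
    | base =>
      have : K * (N : ℝ) ^ b = |x N| := by rw [hK]; field_simp
      have h2 : 0 ≤ δ / 2 * N := by positivity
      linarith
    | succ n hn ih =>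
      obtain ⟨h2, h3, h4, h5⟩ := hN n hn
      have hnpos : (0 : ℝ) < n := by exact_mod_cast h5
      have hc : 0 ≤ 1 + β / n := by positivity
      calc |x (n + 1)| ≤ (1 + β / n) * |x n| + ε n := h3
        _ ≤ (1 + β / n) * (δ / 2 * n + K * (n : ℝ) ^ b) + δ / 2 * (1 - β) := by gcongr
        _ = δ / 2 * (n + 1) + K * ((1 + β / n) * (n : ℝ) ^ b) := by field_simp; ring
        _ ≤ δ / 2 * ((n + 1 : ℕ) : ℝ) + K * ((n + 1 : ℕ) : ℝ) ^ b := by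
          push_cast at h2 ⊢
          gcongr
  have hlim : Tendsto (fun n : ℕ => K * (n : ℝ) ^ (b - 1)) atTop (𝓝 0) := by
    have := (tendsto_rpow_neg_atTop (y := 1 - b) (by linarith)).comp tendsto_natCast_atTop_atTop
    simpa using (this.const_mul K)
  filter_upwards [eventually_ge_atTop N, hlim.eventually_lt_const (half_pos hδ)] with n hn hl
  have hnpos : (0 : ℝ) < n := by exact_mod_cast hN1.trans hn
  rw [Real.dist_eq, sub_zero, abs_div, abs_of_pos hnpos, div_lt_iff₀ hnpos]
  have h2 : (n : ℝ) ^ b = (n : ℝ) ^ (b - 1) * n := by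
    rw [Real.rpow_sub_one hnpos.ne']; field_simp
  have := key n hn
  rw [h2] at this
  nlinarith

/-! ### The weights of the martingale attached to the walk -/

/-- The factor by which the conditional mean of the walk grows between the times `k` and `n`. -/
def growth (α : ℝ) (k n : ℕ) : ℝ := ∏ j ∈ Finset.Ico k n, (1 + α / j)

lemma growth_self (α : ℝ) (n : ℕ) : growth α n n = 1 := by simp [growth]

lemma growth_succ (α : ℝ) {k n : ℕ} (h : k ≤ n) :
    growth α k (n + 1) = growth α k n * (1 + α / n) := by
  simp [growth, Finset.prod_Ico_succ_top h]

lemma growth_eq_mul (α : ℝ) {k n : ℕ} (h : k < n) :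
    growth α k n = growth α (k + 1) n * (1 + α / k) := by
  rw [growth, Finset.prod_eq_prod_Ico_succ_bot h, mul_comm]; rfl

lemma abs_one_add_div_le {α : ℝ} (h : -1 ≤ α) {j : ℕ} (hj : 1 ≤ j) :
    |1 + α / j| ≤ 1 + max α 0 / j := by
  have hj' : (1 : ℝ) ≤ j := by exact_mod_cast hj
  have h0 : 0 ≤ 1 + α / j := by
    have : -1 ≤ α / j := by rw [le_div_iff₀ (by linarith)]; linarith
    linarith
  rw [abs_of_nonneg h0]
  gcongr
  exact le_max_left _ _

lemma abs_growth_le {α : ℝ} (h : -1 ≤ α) {k n : ℕ} (hk : 1 ≤ k) :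
    |growth α k n| ≤ growth (max α 0) 1 n := by
  have h1 : ∀ j : ℕ, (1 : ℝ) ≤ 1 + max α 0 / j := fun j => by
    have : 0 ≤ max α 0 / (j : ℝ) := div_nonneg (le_max_right _ _) (Nat.cast_nonneg _)
    linarith
  rw [growth, Finset.abs_prod]
  calc ∏ j ∈ Finset.Ico k n, |1 + α / j| ≤ ∏ j ∈ Finset.Ico k n, (1 + max α 0 / j) := by
        refine Finset.prod_le_prod (fun _ _ => abs_nonneg _) fun j hj => ?_
        exact abs_one_add_div_le h (hk.trans (Finset.mem_Ico.1 hj).1)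
    _ ≤ ∏ j ∈ Finset.Ico 1 n, (1 + max α 0 / (j : ℝ)) := by
        refine Finset.prod_le_prod_of_subset_of_one_le (Finset.Ico_subset_Ico_left hk)
          (fun j _ => by linarith [h1 j]) fun j _ _ => h1 j

/-- The left side is `1 + 2α/n + O(n⁻²)`; the rate `(1 + 2α)/2` lies above `2α` and, since `α <
1/2`, below `1`. The maximum with `0` meets the sign condition of `tendsto_div_of_recursion`. -/
lemma eventually_sq_one_add_div_le {α : ℝ} (h : α < 1 / 2) :
    ∀ᶠ n : ℕ in atTop, (1 + α / n) ^ 2 ≤ 1 + max ((1 + 2 * α) / 2) 0 / n := by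
  obtain ⟨N, hN⟩ := exists_nat_ge (2 * α ^ 2 / (1 - 2 * α))
  filter_upwards [eventually_ge_atTop (max N 1)] with n hn
  have hn1 : (1 : ℝ) ≤ n := by exact_mod_cast (le_max_right N 1).trans hn
  have hnN : 2 * α ^ 2 / (1 - 2 * α) ≤ n := hN.trans (by exact_mod_cast (le_max_left N 1).trans hn)
  rw [div_le_iff₀ (by linarith)] at hnN
  have h2 : (1 + 2 * α) / 2 / (n : ℝ) ≤ max ((1 + 2 * α) / 2) 0 / n := by
    gcongr; exact le_max_left _ _
  refine le_trans ?_ (add_le_add_right h2 1)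
  have h3 : 1 + (1 + 2 * α) / 2 / (n : ℝ) - (1 + α / n) ^ 2 =
      (n * (1 - 2 * α) - 2 * α ^ 2) / (2 * n ^ 2) := by
    field_simp; ring
  have h4 : 0 ≤ (n * (1 - 2 * α) - 2 * α ^ 2) / (2 * (n : ℝ) ^ 2) :=
    div_nonneg (by linarith) (by positivity)
  linarith

/-- Negligibility of single steps: after division by `√n` even the largest weight vanishes, by
`abs_growth_le`. -/
lemma tendsto_growth_sq_div {α : ℝ} (h : α < 1 / 2) :
    Tendsto (fun n : ℕ => growth (max α 0) 1 n ^ 2 / n) atTop (𝓝 0) := by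
  have hm : max α 0 < 1 / 2 := max_lt h (by norm_num)
  refine tendsto_div_of_recursion (ε := 0) (le_max_right ((1 + 2 * max α 0) / 2) 0)
    (max_lt (by linarith) (by norm_num)) tendsto_const_nhds ?_
  filter_upwards [eventually_sq_one_add_div_le hm, eventually_ge_atTop 1] with n hn hn1
  rw [growth_succ _ hn1, mul_pow, abs_mul, abs_of_nonneg (sq_nonneg (1 + max α 0 / (n : ℝ)))]
  simp only [Pi.zero_apply, add_zero]
  rw [mul_comm]
  gcongr

/-- A sum of squared growth factors with coefficients `c`. -/
def weightedGrowth (α : ℝ) (c : ℕ → ℝ) (n : ℕ) : ℝ :=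
  ∑ k ∈ Finset.Ico 1 n, growth α (k + 1) n ^ 2 * c k

lemma weightedGrowth_succ (α : ℝ) (c : ℕ → ℝ) {n : ℕ} (hn : 1 ≤ n) :
    weightedGrowth α c (n + 1) = (1 + α / n) ^ 2 * weightedGrowth α c n + c n := by
  rw [weightedGrowth, Finset.sum_Ico_succ_top hn, growth_self, weightedGrowth, Finset.mul_sum]
  congr 1
  · refine Finset.sum_congr rfl fun k hk => ?_
    rw [growth_succ _ (Finset.mem_Ico.1 hk).2]; ring
  · ring

lemma tendsto_weightedGrowth_zero {α : ℝ} (h : α < 1 / 2) {c : ℕ → ℝ}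
    (hc : Tendsto c atTop (𝓝 0)) :
    Tendsto (fun n : ℕ => weightedGrowth α c n / n) atTop (𝓝 0) := by
  refine tendsto_div_of_recursion (ε := fun n => |c n|) (le_max_right ((1 + 2 * α) / 2) 0)
    (max_lt (by linarith) (by norm_num)) (by simpa using hc.abs) ?_
  filter_upwards [eventually_sq_one_add_div_le h, eventually_ge_atTop 1] with n hn hn1
  rw [weightedGrowth_succ _ _ hn1]
  refine (abs_add_le _ _).trans ?_
  rw [abs_mul, abs_of_nonneg (sq_nonneg (1 + α / (n : ℝ)))]
  gcongr

/-- The linear function `n / (1 - 2α)` solves the recursion `w (n + 1) = (1 + α/n)² w n + 1` up to a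
defect `α² / ((1 - 2α) n)`, so the difference is `o(n)`. -/
lemma tendsto_weightedGrowth_one {α : ℝ} (h : α < 1 / 2) :
    Tendsto (fun n : ℕ => weightedGrowth α 1 n / n) atTop (𝓝 (1 / (1 - 2 * α))) := by
  have hα : (1 - 2 * α) ≠ 0 := by linarith
  have key : Tendsto (fun n : ℕ => (weightedGrowth α 1 n - n * (1 / (1 - 2 * α))) / n) atTop
      (𝓝 0) := by
    refine tendsto_div_of_recursion (ε := fun n => α ^ 2 / |1 - 2 * α| * (1 / n))
      (le_max_right ((1 + 2 * α) / 2) 0) (max_lt (by linarith) (by norm_num))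
      (by simpa using tendsto_one_div_atTop_nhds_zero_nat.const_mul (α ^ 2 / |1 - 2 * α|)) ?_
    filter_upwards [eventually_sq_one_add_div_le h, eventually_ge_atTop 1] with n hn hn1
    have hnpos : (0 : ℝ) < n := by exact_mod_cast hn1
    have e : weightedGrowth α 1 (n + 1) - ((n + 1 : ℕ) : ℝ) * (1 / (1 - 2 * α)) =
        (1 + α / n) ^ 2 * (weightedGrowth α 1 n - n * (1 / (1 - 2 * α))) +
          α ^ 2 / (1 - 2 * α) * (1 / n) := by
      rw [weightedGrowth_succ _ _ hn1]
      push_cast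
      simp only [Pi.one_apply]
      have h2 : (1 + α / (n : ℝ)) ^ 2 * n = n + 2 * α + α ^ 2 * (1 / n) := by field_simp; ring
      have h3 : (1 - 2 * α) * (1 / (1 - 2 * α)) = 1 := mul_one_div_cancel hα
      linear_combination (1 / (1 - 2 * α)) * h2 - h3
    rw [e]
    refine (abs_add_le _ _).trans ?_
    rw [abs_mul, abs_of_nonneg (sq_nonneg (1 + α / (n : ℝ))), abs_mul, abs_div,
      abs_of_nonneg (sq_nonneg α), abs_of_nonneg (by positivity : (0 : ℝ) ≤ 1 / n)]
    gcongr
  have := key.add_const (1 / (1 - 2 * α))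
  rw [zero_add] at this
  refine this.congr' ?_
  filter_upwards [eventually_ge_atTop 1] with n hn1
  have hnpos : (n : ℝ) ≠ 0 := by positivity
  field_simp
  ring

/-! ### Second moment bounds -/

section Walk

variable {Ω : Type*} [MeasurableSpace Ω] {P : Measure Ω} [IsProbabilityMeasure P] {p : ℝ}
  {V : ℕ → Ω → ℤ}

namespace IsStepReinforced

/-- The recursion for `E S_n²` has the exact linear solution `n / (3 - 4p)`; the difference
satisfies the homogeneous recursion, whose rate `2(2p - 1)` is below `1`. -/
lemma tendsto_integral_pos_sq (hV : IsStepReinforced p V P) (hp0 : 0 ≤ p) (hp : p < 3 / 4) :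
    Tendsto (fun n : ℕ => (∫ x, (pos V n x : ℝ) ^ 2 ∂P) / n) atTop (𝓝 (1 / (3 - 4 * p))) := by
  have hne : 3 - 4 * p ≠ 0 := by linarith
  have key : Tendsto (fun n : ℕ => (∫ x, (pos V n x : ℝ) ^ 2 ∂P - n * (1 / (3 - 4 * p))) / n)
      atTop (𝓝 0) := by
    refine tendsto_div_of_recursion (ε := 0) (le_max_right (2 * (2 * p - 1)) 0)
      (max_lt (by linarith) (by norm_num)) tendsto_const_nhds ?_
    -- From `n = 2` on, the factor `1 + 2(2p - 1)/n` is nonnegative for every `p ≥ 0`.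
    filter_upwards [eventually_ge_atTop 2] with n hn
    have hn2 : (2 : ℝ) ≤ n := by exact_mod_cast hn
    have e : ∫ x, (pos V (n + 1) x : ℝ) ^ 2 ∂P - ((n + 1 : ℕ) : ℝ) * (1 / (3 - 4 * p)) =
        (1 + 2 * (2 * p - 1) / n) * (∫ x, (pos V n x : ℝ) ^ 2 ∂P - n * (1 / (3 - 4 * p))) := by
      rw [hV.integral_pos_sq_succ (by omega)]
      push_cast
      have h2 : (1 + 2 * (2 * p - 1) / (n : ℝ)) * n = n + 2 * (2 * p - 1) := by field_simp
      have h3 : (3 - 4 * p) * (1 / (3 - 4 * p)) = 1 := mul_one_div_cancel hne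
      linear_combination (1 / (3 - 4 * p)) * h2 - h3
    rw [e, abs_mul]
    simp only [Pi.zero_apply, add_zero]
    gcongr
    have h0 : 0 ≤ 1 + 2 * (2 * p - 1) / (n : ℝ) := by
      have : -1 ≤ 2 * (2 * p - 1) / (n : ℝ) := by rw [le_div_iff₀ (by linarith)]; linarith
      linarith
    rw [abs_of_nonneg h0]
    gcongr
    exact le_max_left _ _
  have := key.add_const (1 / (3 - 4 * p))
  rw [zero_add] at this
  refine this.congr' ?_
  filter_upwards [eventually_ge_atTop 1] with n hn1
  have hnpos : (n : ℝ) ≠ 0 := by positivity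
  field_simp
  ring

/-- This diffusive bound, valid at all times, is the input `hM` of the later estimates; it makes the
drift of order `n^{-1/2}`. -/
lemma exists_integral_pos_sq_le (hV : IsStepReinforced p V P) (hp0 : 0 ≤ p) (hp : p < 3 / 4) :
    ∃ M : ℝ, 0 < M ∧ ∀ n : ℕ, ∫ x, (pos V n x : ℝ) ^ 2 ∂P ≤ M * n := by
  obtain ⟨M, hM⟩ := (hV.tendsto_integral_pos_sq hp0 hp).bddAbove_range
  refine ⟨max M 1, by positivity, fun n => ?_⟩
  rcases Nat.eq_zero_or_pos n with rfl | hn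
  · simp [pos_zero]
  · have h := hM (Set.mem_range_self n)
    have hnpos : (0 : ℝ) < n := by exact_mod_cast hn
    rw [div_le_iff₀ hnpos] at h
    exact h.trans (by gcongr; exact le_max_left _ _)

end IsStepReinforced

end Walk

end LevyLorentz

end

noncomputable section

namespace LevyLorentz

/-! ### The central limit theorem for the step-reinforced walk -/

/-- `cos θ + i u sin θ` is the characteristic function of a `±1` step with mean `u`. To second order
it is a Gaussian factor times the phase `e^{iθu}` of the mean. -/
lemma norm_cos_add_sub_exp_le {θ u : ℝ} (hθ : |θ| ≤ 1) (hu : |u| ≤ 1) :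
    ‖((Real.cos θ : ℂ) + Complex.I * u * Real.sin θ) -
      Real.exp (-θ ^ 2 / 2) * Complex.exp (Complex.I * (θ * u : ℝ))‖ ≤
      3 * |θ| ^ 3 + θ ^ 2 * u ^ 2 := by
  set e : ℝ := Real.exp (-θ ^ 2 / 2) with he
  have hsq : θ ^ 2 = |θ| ^ 2 := (sq_abs θ).symm
  have ha : 0 ≤ |θ| := abs_nonneg θ
  have h43 : |θ| ^ 4 ≤ |θ| ^ 3 := pow_le_pow_of_le_one ha hθ (by norm_num)
  have h53 : |θ| ^ 5 ≤ |θ| ^ 3 := pow_le_pow_of_le_one ha hθ (by norm_num)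
  have h30 : 0 ≤ |θ| ^ 3 := pow_nonneg ha 3
  have hθ2 : θ ^ 2 ≤ 1 := by rw [hsq]; exact pow_le_one₀ ha hθ
  have he1 : e ≤ 1 := by rw [he]; exact Real.exp_le_one_iff.2 (by nlinarith)
  have he0 : 0 < e := Real.exp_pos _
  have he2 : 1 - θ ^ 2 / 2 ≤ e := by
    have := Real.add_one_le_exp (-θ ^ 2 / 2)
    rw [← he] at this; linarith
  have h1 : |Real.cos θ - e| ≤ |θ| ^ 3 := by
    have hc := Real.cos_bound hθ
    have hx : |(-θ ^ 2 / 2 : ℝ)| ≤ 1 := by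
      rw [abs_le]; constructor <;> nlinarith [sq_nonneg θ]
    have hexp := Real.abs_exp_sub_one_sub_id_le hx
    rw [← he] at hexp
    have h4 : (-θ ^ 2 / 2) ^ 2 = |θ| ^ 4 / 4 := by
      rw [show |θ| ^ 4 = (|θ| ^ 2) ^ 2 by ring, sq_abs]; ring
    rw [h4] at hexp
    have : Real.cos θ - e = (Real.cos θ - (1 - θ ^ 2 / 2)) - (e - 1 - -θ ^ 2 / 2) := by ring
    rw [this]
    refine (abs_sub _ _).trans ?_
    linarith
  have h2 : |Real.sin θ - θ| ≤ |θ| ^ 3 := by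
    have hs := Real.sin_bound hθ
    have : Real.sin θ - θ = (Real.sin θ - (θ - θ ^ 3 / 6)) - θ ^ 3 / 6 := by ring
    rw [this]
    refine (abs_sub _ _).trans ?_
    rw [abs_div, abs_pow, abs_of_pos (by norm_num : (0 : ℝ) < 6)]
    linarith
  have h3 : |θ * (1 - e)| ≤ |θ| ^ 3 := by
    rw [abs_mul, abs_of_nonneg (by linarith : 0 ≤ 1 - e), show |θ| ^ 3 = |θ| * θ ^ 2 by
      rw [hsq]; ring]
    gcongr
    nlinarith [sq_nonneg θ]
  have h4 : ‖Complex.exp (Complex.I * (θ * u : ℝ)) - 1 - Complex.I * (θ * u : ℝ)‖ ≤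
      θ ^ 2 * u ^ 2 := by
    have hn : ‖Complex.I * ((θ * u : ℝ) : ℂ)‖ = |θ * u| := by simp
    have hle : ‖Complex.I * ((θ * u : ℝ) : ℂ)‖ ≤ 1 := by
      rw [hn, abs_mul]; exact mul_le_one₀ hθ (abs_nonneg _) hu
    have := Complex.norm_exp_sub_one_sub_id_le hle
    rwa [hn, sq_abs, mul_pow] at this
  -- Four errors: Gaussian factor, linearized sine, dropping the factor `e` from `θ`, and linearized
  -- phase. The first three are cubic in `θ`, the last quadratic in `θ u`.
  have hsplit : ((Real.cos θ : ℂ) + Complex.I * u * Real.sin θ) -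
      e * Complex.exp (Complex.I * (θ * u : ℝ)) =
      ((Real.cos θ - e : ℝ) : ℂ) + Complex.I * u * ((Real.sin θ - θ : ℝ) : ℂ) +
        Complex.I * u * ((θ * (1 - e) : ℝ) : ℂ) -
        e * (Complex.exp (Complex.I * (θ * u : ℝ)) - 1 - Complex.I * (θ * u : ℝ)) := by
    push_cast; ring
  rw [hsplit]
  refine (norm_sub_le _ _).trans ?_
  refine (add_le_add_left
    ((norm_add_le _ _).trans (add_le_add_left (norm_add_le _ _) _)) _).trans ?_
  simp only [norm_mul, Complex.norm_I, Complex.norm_real, Real.norm_eq_abs, one_mul,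
    abs_of_pos he0]
  have h5 : |u| * |Real.sin θ - θ| ≤ |θ| ^ 3 :=
    (mul_le_of_le_one_left (abs_nonneg _) hu).trans h2
  have h6 : |u| * |θ * (1 - e)| ≤ |θ| ^ 3 := (mul_le_of_le_one_left (abs_nonneg _) hu).trans h3
  rw [abs_mul θ] at h6
  have h7 := (mul_le_of_le_one_left (norm_nonneg
    (Complex.exp (Complex.I * (θ * u : ℝ)) - 1 - Complex.I * (θ * u : ℝ))) he1).trans h4
  linarith

section Walk

variable {Ω : Type*} [MeasurableSpace Ω] {P : Measure Ω} [IsProbabilityMeasure P] {p : ℝ}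
  {V : ℕ → Ω → ℤ}

namespace IsStepReinforced

lemma ae_abs_pos_le (hV : IsStepReinforced p V P) :
    ∀ᵐ x ∂P, ∀ n, |(pos V n x : ℝ)| ≤ n := by
  filter_upwards [hV.ae_step] with x hx n
  induction n with
  | zero => simp [pos_zero]
  | succ n ih =>
    rw [pos_succ]
    push_cast
    refine (abs_add_le _ _).trans (add_le_add ih ?_)
    rcases hx n with h | h <;> simp [h]

lemma ae_abs_drift_le (hV : IsStepReinforced p V P) (hp0 : 0 ≤ p) (hp : p < 3 / 4) :
    ∀ᵐ x ∂P, ∀ n, |drift p V n x| ≤ 1 := by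
  filter_upwards [hV.ae_abs_pos_le] with x hx n
  rw [drift, abs_div, abs_mul, Nat.abs_cast]
  refine div_le_one_of_le₀ ?_ (Nat.cast_nonneg _)
  refine (mul_le_of_le_one_left (abs_nonneg _) ?_).trans (hx n)
  rw [abs_le]; constructor <;> linarith

lemma integrable_drift (hV : IsStepReinforced p V P) (n : ℕ) (f : ℝ → ℝ) :
    Integrable (fun x => f (drift p V n x)) P :=
  hV.integrable_pos 0 n fun _ s => f ((2 * p - 1) * s / n)

lemma integral_drift_sq_le (hp0 : 0 ≤ p) (hp : p < 3 / 4) {M : ℝ}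
    (hM : ∀ n : ℕ, ∫ x, (pos V n x : ℝ) ^ 2 ∂P ≤ M * n) (n : ℕ) :
    ∫ x, drift p V n x ^ 2 ∂P ≤ M / n := by
  rcases Nat.eq_zero_or_pos n with rfl | hn
  · simp [drift]
  have hn' : (0 : ℝ) < n := by exact_mod_cast hn
  have h : ∀ x, drift p V n x ^ 2 = (2 * p - 1) ^ 2 / n ^ 2 * (pos V n x : ℝ) ^ 2 := by
    intro x; rw [drift]; ring
  simp only [h]
  rw [integral_const_mul]
  have h1 : (2 * p - 1) ^ 2 ≤ 1 := by nlinarith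
  calc (2 * p - 1) ^ 2 / (n : ℝ) ^ 2 * ∫ x, (pos V n x : ℝ) ^ 2 ∂P
      ≤ 1 / (n : ℝ) ^ 2 * (M * n) := by
        refine mul_le_mul (by gcongr) (hM n) (integral_nonneg fun _ => sq_nonneg _) (by positivity)
    _ = M / n := by field_simp

/-- One step of the comparison of the characteristic function with a Gaussian one. -/
lemma norm_charFun_step_le (hV : IsStepReinforced p V P) (hp0 : 0 ≤ p) (hp : p < 3 / 4) {M : ℝ}
    (hM : ∀ n : ℕ, ∫ x, (pos V n x : ℝ) ^ 2 ∂P ≤ M * n) {n : ℕ} (hn : 1 ≤ n) {θ : ℝ}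
    (hθ : |θ| ≤ 1) :
    ‖(∫ x, Complex.exp (Complex.I * (θ * pos V (n + 1) x : ℝ)) ∂P) - Real.exp (-θ ^ 2 / 2) *
      ∫ x, Complex.exp (Complex.I * (θ * (1 + (2 * p - 1) / n) * pos V n x : ℝ)) ∂P‖ ≤
      3 * |θ| ^ 3 + θ ^ 2 * (M / n) := by
  rw [hV.integral_pos_step (j := 0) hn (Nat.zero_le _)
    fun _ s => Complex.exp (Complex.I * (θ * s : ℝ)), ← integral_const_mul, ← integral_sub]
  rotate_left
  · exact hV.integrable_pos 0 n fun _ s =>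
      ((1 + (2 * p - 1) * s / n) / 2) • Complex.exp (Complex.I * (θ * (s + 1 : ℤ) : ℝ)) +
      ((1 - (2 * p - 1) * s / n) / 2) • Complex.exp (Complex.I * (θ * (s - 1 : ℤ) : ℝ))
  · exact (hV.integrable_pos 0 n fun _ s =>
      Complex.exp (Complex.I * (θ * (1 + (2 * p - 1) / n) * s : ℝ))).const_mul _
  refine (norm_integral_le_integral_norm _).trans ?_
  have hle : ∫ x, (3 * |θ| ^ 3 + θ ^ 2 * drift p V n x ^ 2) ∂P ≤
      3 * |θ| ^ 3 + θ ^ 2 * (M / n) := by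
    rw [integral_add (integrable_const _) ((hV.integrable_drift n fun u => u ^ 2).const_mul _)]
    simp only [integral_const, probReal_univ, one_smul]
    rw [integral_const_mul]
    gcongr
    exact integral_drift_sq_le hp0 hp hM n
  refine le_trans (integral_mono_of_nonneg (ae_of_all _ fun _ => norm_nonneg _)
    ((integrable_const _).add ((hV.integrable_drift n fun u => u ^ 2).const_mul _)) ?_) hle
  filter_upwards [hV.ae_abs_drift_le hp0 hp] with x hx
  have hb := norm_cos_add_sub_exp_le hθ (hx n)
  set u := drift p V n x with hu
  -- Changing the frequency from `θ` to `θ(1 + α/n)` is exactly what absorbs the conditional mean of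
  -- the step.
  have hS : θ * (1 + (2 * p - 1) / n) * (pos V n x : ℝ) = θ * pos V n x + θ * u := by
    rw [hu, drift]; ring
  have e1 : Complex.exp (Complex.I * (θ * (pos V n x + 1 : ℤ) : ℝ)) =
      Complex.exp (Complex.I * (θ * pos V n x : ℝ)) *
        (Real.cos θ + Complex.I * Real.sin θ) := by
    rw [show Complex.I * ((θ * (pos V n x + 1 : ℤ) : ℝ) : ℂ) =
      Complex.I * (θ * pos V n x : ℝ) + θ * Complex.I by push_cast; ring, Complex.exp_add,
      Complex.exp_mul_I]
    push_cast
    ring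
  have e2 : Complex.exp (Complex.I * (θ * (pos V n x - 1 : ℤ) : ℝ)) =
      Complex.exp (Complex.I * (θ * pos V n x : ℝ)) *
        (Real.cos θ - Complex.I * Real.sin θ) := by
    rw [show Complex.I * ((θ * (pos V n x - 1 : ℤ) : ℝ) : ℂ) =
      Complex.I * (θ * pos V n x : ℝ) + (-θ : ℂ) * Complex.I by push_cast; ring, Complex.exp_add,
      Complex.exp_mul_I, Complex.cos_neg, Complex.sin_neg]
    push_cast
    ring
  have e3 : Complex.exp (Complex.I * (θ * (1 + (2 * p - 1) / n) * pos V n x : ℝ)) =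
      Complex.exp (Complex.I * (θ * pos V n x : ℝ)) * Complex.exp (Complex.I * (θ * u : ℝ)) := by
    rw [hS, ← Complex.exp_add]
    push_cast
    congr 1
    ring
  have e4 : ((1 + u) / 2) • Complex.exp (Complex.I * (θ * (pos V n x + 1 : ℤ) : ℝ)) +
      ((1 - u) / 2) • Complex.exp (Complex.I * (θ * (pos V n x - 1 : ℤ) : ℝ)) -
      Real.exp (-θ ^ 2 / 2) *
        Complex.exp (Complex.I * (θ * (1 + (2 * p - 1) / n) * pos V n x : ℝ)) =
      Complex.exp (Complex.I * (θ * pos V n x : ℝ)) *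
        (((Real.cos θ : ℂ) + Complex.I * u * Real.sin θ) -
      Real.exp (-θ ^ 2 / 2) * Complex.exp (Complex.I * (θ * u : ℝ))) := by
    rw [e1, e2, e3]
    simp only [Complex.real_smul]
    push_cast
    ring
  rw [e4, norm_mul, mul_comm Complex.I, Complex.norm_exp_ofReal_mul_I, one_mul]
  exact hb

/-- The characteristic function of the walk along a backward solution `θ` of the recursion
satisfied by the conditional means. -/
lemma norm_charFun_sub_le (hV : IsStepReinforced p V P) (hp0 : 0 ≤ p) (hp : p < 3 / 4) {M : ℝ}
    (hM : ∀ n : ℕ, ∫ x, (pos V n x : ℝ) ^ 2 ∂P ≤ M * n) {N : ℕ} {θ : ℕ → ℝ}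
    (hθ : ∀ k, 1 ≤ k → k ≤ N → |θ k| ≤ 1)
    (hrec : ∀ k, 1 ≤ k → k < N → θ k = θ (k + 1) * (1 + (2 * p - 1) / k)) {n : ℕ} (hn : 1 ≤ n)
    (hnN : n ≤ N) :
    ‖(∫ x, Complex.exp (Complex.I * (θ n * pos V n x : ℝ)) ∂P) -
      Real.exp (-(∑ k ∈ Finset.Ico 1 n, θ (k + 1) ^ 2) / 2) *
        ∫ x, Complex.exp (Complex.I * (θ 1 * pos V 1 x : ℝ)) ∂P‖ ≤
      ∑ k ∈ Finset.Ico 1 n, (3 * |θ (k + 1)| ^ 3 + θ (k + 1) ^ 2 * (M / k)) := by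
  induction n, hn using Nat.le_induction with
  | base => simp
  | succ n hn ih =>
    have ih := ih (by omega)
    have hs := hV.norm_charFun_step_le hp0 hp hM hn (hθ (n + 1) (by omega) hnN)
    rw [← hrec n hn (by omega)] at hs
    rw [Finset.sum_Ico_succ_top hn, Finset.sum_Ico_succ_top hn]
    set A := ∫ x, Complex.exp (Complex.I * (θ (n + 1) * pos V (n + 1) x : ℝ)) ∂P
    set B := ∫ x, Complex.exp (Complex.I * (θ n * pos V n x : ℝ)) ∂P
    set D := ∫ x, Complex.exp (Complex.I * (θ 1 * pos V 1 x : ℝ)) ∂P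
    set s := ∑ k ∈ Finset.Ico 1 n, θ (k + 1) ^ 2
    have he : Real.exp (-(s + θ (n + 1) ^ 2) / 2) =
        Real.exp (-θ (n + 1) ^ 2 / 2) * Real.exp (-s / 2) := by
      rw [← Real.exp_add]; congr 1; ring
    -- Telescoping: the Gaussian factors are at most `1`, so the one-step errors simply add up.
    have hsplit : A - (Real.exp (-(s + θ (n + 1) ^ 2) / 2) : ℝ) * D =
        (A - Real.exp (-θ (n + 1) ^ 2 / 2) * B) +
          Real.exp (-θ (n + 1) ^ 2 / 2) * (B - Real.exp (-s / 2) * D) := by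
      rw [he]; push_cast; ring
    rw [hsplit, add_comm (∑ _ ∈ _, _)]
    refine (norm_add_le _ _).trans (add_le_add hs ?_)
    rw [norm_mul]
    refine (mul_le_of_le_one_left (norm_nonneg _) ?_).trans ih
    rw [Complex.norm_real, Real.norm_eq_abs, abs_of_pos (Real.exp_pos _)]
    exact Real.exp_le_one_iff.2 (by nlinarith [sq_nonneg (θ (n + 1))])

/-- Apply `norm_charFun_sub_le` with `θ_k = (t/√n) ∏_{k ≤ j < n} (1 + α/j)`. The squares sum to the
limiting variance, the cubes are at most `max |θ|` times that sum, the terms with `M / k` are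
negligible by `tendsto_weightedGrowth_zero`, and the factor of `S_1` tends to `1` because `θ_1 → 0`.
-/
lemma tendsto_charFun (hV : IsStepReinforced p V P) (hp0 : 0 ≤ p) (hp : p < 3 / 4) (t : ℝ) :
    Tendsto (fun n : ℕ => ∫ x, Complex.exp (Complex.I * (t / √n * pos V n x : ℝ)) ∂P) atTop
      (𝓝 (Real.exp (-(t ^ 2 * (1 / (3 - 4 * p))) / 2))) := by
  obtain ⟨M, _, hM⟩ := hV.exists_integral_pos_sq_le hp0 hp
  set α : ℝ := 2 * p - 1 with hα
  have hα1 : -1 ≤ α := by rw [hα]; linarith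
  have hα2 : α < 1 / 2 := by rw [hα]; linarith
  set θ : ℕ → ℕ → ℝ := fun n k => t / √n * growth α k n with hθ
  -- A bound on `|θ n k|` uniform in `k ≥ 1`, tending to `0`.
  set m : ℕ → ℝ := fun n => |t| * √(growth (max α 0) 1 n ^ 2 / n) with hm
  have hm0 : ∀ n, 0 ≤ m n := fun n => by positivity
  have hmlim : Tendsto m atTop (𝓝 0) := by
    have := ((tendsto_growth_sq_div hα2).sqrt).const_mul |t|
    rwa [Real.sqrt_zero, mul_zero] at this
  have hθm : ∀ n k, 1 ≤ k → |θ n k| ≤ m n := by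
    intro n k hk
    have hg := abs_growth_le hα1 hk (n := n)
    rw [hθ, hm]
    simp only [abs_mul, abs_div, abs_of_nonneg (Real.sqrt_nonneg _)]
    rw [Real.sqrt_div (sq_nonneg _), Real.sqrt_sq ((abs_nonneg _).trans hg), div_mul_eq_mul_div,
      mul_div_assoc]
    gcongr
  have hsq : ∀ n, ∀ c : ℕ → ℝ, ∑ k ∈ Finset.Ico 1 n, θ n (k + 1) ^ 2 * c k =
      t ^ 2 * (weightedGrowth α c n / n) := by
    intro n c
    rw [weightedGrowth, Finset.sum_div, Finset.mul_sum]
    refine Finset.sum_congr rfl fun k _ => ?_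
    simp only [hθ]
    rw [mul_pow, div_pow, Real.sq_sqrt (Nat.cast_nonneg _)]
    ring
  have hsq1 : ∀ n, ∑ k ∈ Finset.Ico 1 n, θ n (k + 1) ^ 2 = t ^ 2 * (weightedGrowth α 1 n / n) := by
    intro n; rw [← hsq]; simp
  have hσ : 1 / (1 - 2 * α) = 1 / (3 - 4 * p) := by rw [hα]; congr 1; ring
  have hS : Tendsto (fun n => ∑ k ∈ Finset.Ico 1 n, θ n (k + 1) ^ 2) atTop
      (𝓝 (t ^ 2 * (1 / (3 - 4 * p)))) := by
    simp only [hsq1]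
    rw [← hσ]
    exact (tendsto_weightedGrowth_one hα2).const_mul _
  have herr : Tendsto (fun n => ∑ k ∈ Finset.Ico 1 n,
      (3 * |θ n (k + 1)| ^ 3 + θ n (k + 1) ^ 2 * (M / k))) atTop (𝓝 0) := by
    have h1 : Tendsto (fun n => 3 * m n * ∑ k ∈ Finset.Ico 1 n, θ n (k + 1) ^ 2) atTop (𝓝 0) := by
      simpa using (hmlim.const_mul 3).mul hS
    have h2 : Tendsto (fun n => ∑ k ∈ Finset.Ico 1 n, θ n (k + 1) ^ 2 * (M / k)) atTop (𝓝 0) := by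
      simp only [hsq]
      have hc : Tendsto (fun k : ℕ => M / k) atTop (𝓝 0) := tendsto_const_div_atTop_nhds_zero_nat M
      simpa using (tendsto_weightedGrowth_zero hα2 hc).const_mul (t ^ 2)
    refine squeeze_zero (fun n => Finset.sum_nonneg fun k _ => by positivity) (fun n => ?_)
      (by simpa using h1.add h2)
    rw [Finset.sum_add_distrib, Finset.mul_sum]
    refine add_le_add_left (Finset.sum_le_sum fun k _ => ?_) _
    have := mul_le_mul_of_nonneg_right (hθm n (k + 1) (by omega)) (sq_nonneg |θ n (k + 1)|)
    rw [← sq_abs (θ n (k + 1)), pow_succ |θ n (k + 1)| 2]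
    linarith
  have hstart : Tendsto (fun n => ∫ x, Complex.exp (Complex.I * (θ n 1 * pos V 1 x : ℝ)) ∂P) atTop
      (𝓝 1) := by
    have hθ1 : Tendsto (fun n => θ n 1) atTop (𝓝 0) :=
      squeeze_zero_norm (fun n => hθm n 1 le_rfl) hmlim
    have := tendsto_integral_filter_of_dominated_convergence (μ := P) (l := atTop)
      (F := fun n x => Complex.exp (Complex.I * (θ n 1 * pos V 1 x : ℝ))) (f := fun _ => 1)
      (fun _ => (1 : ℝ)) (Eventually.of_forall fun n =>
        (hV.integrable_pos 0 1 fun _ s =>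
          Complex.exp (Complex.I * (θ n 1 * s : ℝ))).aestronglyMeasurable)
      (Eventually.of_forall fun n => ae_of_all _ fun x => by
        rw [mul_comm Complex.I, Complex.norm_exp_ofReal_mul_I])
      (integrable_const _) (ae_of_all _ fun x => ?_)
    · simpa using this
    · have h1 : Tendsto (fun n => Complex.I * ((θ n 1 * pos V 1 x : ℝ) : ℂ)) atTop (𝓝 0) := by
        have := (Complex.continuous_ofReal.tendsto _).comp (hθ1.mul_const (pos V 1 x : ℝ))
        simpa using this.const_mul Complex.I
      have := (Complex.continuous_exp.tendsto _).comp h1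
      rwa [Complex.exp_zero] at this
  have hmain : Tendsto (fun n => (Real.exp (-(∑ k ∈ Finset.Ico 1 n, θ n (k + 1) ^ 2) / 2) : ℂ) *
      ∫ x, Complex.exp (Complex.I * (θ n 1 * pos V 1 x : ℝ)) ∂P) atTop
      (𝓝 (Real.exp (-(t ^ 2 * (1 / (3 - 4 * p))) / 2))) := by
    have h1 : Tendsto (fun n => Real.exp (-(∑ k ∈ Finset.Ico 1 n, θ n (k + 1) ^ 2) / 2)) atTop
        (𝓝 (Real.exp (-(t ^ 2 * (1 / (3 - 4 * p))) / 2))) :=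
      (Real.continuous_exp.tendsto _).comp (hS.neg.div_const 2)
    have h2 := ((Complex.continuous_ofReal.tendsto _).comp h1).mul hstart
    simpa using h2
  have hdiff : Tendsto (fun n : ℕ => (∫ x, Complex.exp (Complex.I * (t / √n * pos V n x : ℝ)) ∂P) -
      (Real.exp (-(∑ k ∈ Finset.Ico 1 n, θ n (k + 1) ^ 2) / 2) : ℂ) *
      ∫ x, Complex.exp (Complex.I * (θ n 1 * pos V 1 x : ℝ)) ∂P) atTop (𝓝 0) := by
    refine squeeze_zero_norm' ?_ herr
    filter_upwards [hmlim.eventually_le_const (zero_lt_one), eventually_ge_atTop 1] with n hn hn1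
    have h := hV.norm_charFun_sub_le hp0 hp hM (θ := θ n) (N := n)
      (fun k hk _ => (hθm n k hk).trans hn) (fun k _ hk => by
        simp only [hθ]; rw [growth_eq_mul _ hk]; ring) hn1 le_rfl
    have hnn : θ n n = t / √n := by simp [hθ, growth_self]
    rw [hnn] at h
    exact h
  simpa using hdiff.add hmain

/-- The central limit theorem for the step-reinforced walk. -/
theorem tendstoInDistribution_pos (hV : IsStepReinforced p V P) (hp0 : 0 ≤ p) (hp : p < 3 / 4) :
    TendstoInDistribution (fun (n : ℕ) (x : Ω) => 1 / √(n : ℝ) * (pos V n x : ℝ)) atTop id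
      (fun _ => P) (gaussianReal 0 (1 / (3 - 4 * p)).toNNReal) := by
  have hmeas : ∀ n : ℕ, Measurable fun x => 1 / √(n : ℝ) * (pos V n x : ℝ) := fun n =>
    (measurable_of_countable fun z : ℤ => 1 / √(n : ℝ) * (z : ℝ)).comp (hV.measurable_pos n)
  refine ⟨fun n => (hmeas n).aemeasurable, aemeasurable_id, ?_⟩
  refine ProbabilityMeasure.tendsto_iff_tendsto_charFun.2 fun t => ?_
  have hlim : charFun (Measure.map id (gaussianReal 0 (1 / (3 - 4 * p)).toNNReal)) t =
      Real.exp (-(t ^ 2 * (1 / (3 - 4 * p))) / 2) := by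
    rw [Measure.map_id, charFun_gaussianReal]
    have h0 : 0 ≤ 1 / (3 - 4 * p) := by
      have : 0 < 3 - 4 * p := by linarith
      positivity
    rw [Real.coe_toNNReal _ h0]
    push_cast
    congr 1
    simp
    ring
  refine Tendsto.congr (fun n => ?_) (by
    simpa only [ProbabilityMeasure.coe_mk, hlim] using hV.tendsto_charFun hp0 hp t)
  simp only [ProbabilityMeasure.coe_mk]
  rw [charFun_apply_real, integral_map (hmeas n).aemeasurable (by fun_prop)]
  refine integral_congr_ae (ae_of_all _ fun x => ?_)
  simp only
  congr 1
  push_cast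
  ring

end IsStepReinforced

end Walk

end LevyLorentz

end

noncomputable section

namespace LevyLorentz

/-! ### Smoothing by the steps of the walk -/

/-- The transition operator of the simple symmetric walk. -/
def stepAvg (f : ℤ → ℝ) (s : ℤ) : ℝ := (f (s + 1) + f (s - 1)) / 2

lemma stepAvg_iterate (f : ℤ → ℝ) (m : ℕ) (s : ℤ) :
    stepAvg^[m] f s =
      (∑ i ∈ Finset.range (m + 1), (m.choose i : ℝ) * f (s + 2 * i - m)) / 2 ^ m := by
  induction m generalizing s with
  | zero => simp
  | succ m ih =>
    rw [Function.iterate_succ_apply', stepAvg, ih, ih, Finset.sum_range_succ' _ (m + 1)]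
    have h1 : ∀ i ∈ Finset.range (m + 1), ((m + 1).choose (i + 1) : ℝ) *
        f (s + 2 * ((i + 1 : ℕ) : ℤ) - ((m + 1 : ℕ) : ℤ)) =
        (m.choose i : ℝ) * f (s + 1 + 2 * i - m) +
          (m.choose (i + 1) : ℝ) * f (s - 1 + 2 * ((i + 1 : ℕ) : ℤ) - m) := by
      intro i _
      rw [Nat.choose_succ_succ]
      push_cast
      rw [show s + 2 * ((i : ℤ) + 1) - (m + 1) = s + 1 + 2 * i - m by ring,
        show s - 1 + 2 * ((i : ℤ) + 1) - m = s + 1 + 2 * i - m by ring]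
      ring
    rw [Finset.sum_congr rfl h1, Finset.sum_add_distrib]
    have h2 : ∑ i ∈ Finset.range (m + 1), (m.choose i : ℝ) * f (s - 1 + 2 * i - m) =
        ∑ i ∈ Finset.range (m + 1), (m.choose (i + 1) : ℝ) *
          f (s - 1 + 2 * ((i + 1 : ℕ) : ℤ) - m) + f (s - 1 - m) := by
      have := Finset.sum_range_succ' (fun i : ℕ => (m.choose i : ℝ) * f (s - 1 + 2 * i - m)) (m + 1)
      rw [Finset.sum_range_succ] at this
      simpa using this
    rw [h2]
    simp only [Nat.choose_zero_right, Nat.cast_one, one_mul, Nat.cast_zero, mul_zero, add_zero]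
    rw [show s - ((m + 1 : ℕ) : ℤ) = s - 1 - m by push_cast; ring, pow_succ]
    field_simp
    ring

/-- Equivalently, the largest atom of `2l` symmetric steps is at most `1/√(2l + 1)`. The induction
closes because `(2l + 1)(2l + 3) ≤ 4(l + 1)²`. -/
lemma centralBinom_sq_le (l : ℕ) : l.centralBinom ^ 2 * (2 * l + 1) ≤ 16 ^ l := by
  induction l with
  | zero => simp
  | succ l ih =>
    have h := Nat.succ_mul_centralBinom_succ l
    have h2 : (l + 1) ^ 2 * ((l + 1).centralBinom ^ 2 * (2 * (l + 1) + 1)) ≤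
        (l + 1) ^ 2 * 16 ^ (l + 1) := by
      calc (l + 1) ^ 2 * ((l + 1).centralBinom ^ 2 * (2 * (l + 1) + 1))
          = ((l + 1) * (l + 1).centralBinom) ^ 2 * (2 * (l + 1) + 1) := by ring
        _ = (l.centralBinom ^ 2 * (2 * l + 1)) * (4 * (2 * l + 1) * (2 * l + 3)) := by
            rw [h]; ring
        _ ≤ 16 ^ l * (16 * (l + 1) ^ 2) := by
            refine Nat.mul_le_mul ih ?_
            nlinarith
        _ = (l + 1) ^ 2 * 16 ^ (l + 1) := by ring
    exact Nat.le_of_mul_le_mul_left h2 (by positivity)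

/-- Every binomial weight is at most the central one, and the points `s + 2i - 2l` are distinct, so
the unweighted sum is at most `∑ f`. -/
lemma stepAvg_iterate_le {f : ℤ → ℝ} (hf0 : ∀ s, 0 ≤ f s) (hf : Summable f) (l : ℕ) (s : ℤ) :
    stepAvg^[2 * l] f s ≤ (∑' r, f r) / √(2 * l + 1) := by
  have hT : 0 ≤ ∑' r, f r := tsum_nonneg hf0
  have hc : (l.centralBinom : ℝ) / 2 ^ (2 * l) ≤ 1 / √(2 * l + 1) := by
    have h := centralBinom_sq_le l
    have h' : (l.centralBinom : ℝ) ^ 2 * (2 * l + 1) ≤ 16 ^ l := by exact_mod_cast h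
    rw [div_le_div_iff₀ (by positivity) (by positivity), one_mul]
    refine le_of_sq_le_sq ?_ (by positivity)
    rw [mul_pow, Real.sq_sqrt (by positivity), ← pow_mul,
      show (2 : ℝ) ^ (2 * l * 2) = 16 ^ l by rw [show 2 * l * 2 = 4 * l by ring, pow_mul]; norm_num]
    exact h'
  rw [stepAvg_iterate]
  have hsum : ∑ i ∈ Finset.range (2 * l + 1), f (s + 2 * i - (2 * l : ℕ)) ≤ ∑' r, f r := by
    have hinj : Function.Injective fun i : ℕ => s + 2 * (i : ℤ) - (2 * l : ℕ) := by
      intro a b h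
      simp only at h
      omega
    calc ∑ i ∈ Finset.range (2 * l + 1), f (s + 2 * i - (2 * l : ℕ))
        = ∑ r ∈ (Finset.range (2 * l + 1)).map ⟨_, hinj⟩, f r := by
          rw [Finset.sum_map]; rfl
      _ ≤ ∑' r, f r := hf.sum_le_tsum _ fun r _ => hf0 r
  calc (∑ i ∈ Finset.range (2 * l + 1), ((2 * l).choose i : ℝ) * f (s + 2 * i - (2 * l : ℕ))) /
        2 ^ (2 * l)
      ≤ (∑ i ∈ Finset.range (2 * l + 1), (l.centralBinom : ℝ) * f (s + 2 * i - (2 * l : ℕ))) /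
        2 ^ (2 * l) := by
        gcongr with i hi
        · exact hf0 _
        · exact Nat.choose_le_centralBinom i l
    _ = (l.centralBinom : ℝ) / 2 ^ (2 * l) *
        ∑ i ∈ Finset.range (2 * l + 1), f (s + 2 * i - (2 * l : ℕ)) := by
        rw [← Finset.mul_sum]; ring
    _ ≤ 1 / √(2 * l + 1) * ∑' r, f r := by
        gcongr
        exact Finset.sum_nonneg fun i _ => hf0 _
    _ = (∑' r, f r) / √(2 * l + 1) := by ring

section Walk

variable {Ω : Type*} [MeasurableSpace Ω] {P : Measure Ω} [IsProbabilityMeasure P] {p : ℝ}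
  {V : ℕ → Ω → ℤ}

namespace IsStepReinforced

/-- From the second moment through `|u| ≤ √n u² + 1/√n`. -/
lemma integral_abs_drift_le (hV : IsStepReinforced p V P) (hp0 : 0 ≤ p) (hp : p < 3 / 4) {M : ℝ}
    (hM : ∀ n : ℕ, ∫ x, (pos V n x : ℝ) ^ 2 ∂P ≤ M * n) (n : ℕ) :
    ∫ x, |drift p V n x| ∂P ≤ (M + 1) / √n := by
  rcases Nat.eq_zero_or_pos n with rfl | hn
  · simp [drift]
  have hn' : (0 : ℝ) < √n := Real.sqrt_pos.2 (by exact_mod_cast hn)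
  have hsq : (√n : ℝ) ^ 2 = n := Real.sq_sqrt (Nat.cast_nonneg _)
  have h1 : ∀ x, |drift p V n x| ≤ √n * drift p V n x ^ 2 + 1 / √n := by
    intro x
    rw [← sq_abs (drift p V n x), ← sub_nonneg]
    have : √n * |drift p V n x| ^ 2 + 1 / √n - |drift p V n x| =
        ((√n * |drift p V n x| - 1 / 2) ^ 2 + 3 / 4) / √n := by field_simp; ring
    rw [this]
    positivity
  calc ∫ x, |drift p V n x| ∂P ≤ ∫ x, (√n * drift p V n x ^ 2 + 1 / √n) ∂P :=
        integral_mono (hV.integrable_drift n fun u => |u|)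
          (((hV.integrable_drift n fun u => u ^ 2).const_mul _).add (integrable_const _)) h1
    _ = √n * (∫ x, drift p V n x ^ 2 ∂P) + 1 / √n := by
        rw [integral_add ((hV.integrable_drift n fun u => u ^ 2).const_mul _) (integrable_const _),
          integral_const_mul]
        simp
    _ ≤ √n * (M / n) + 1 / √n := by
        gcongr
        exact integral_drift_sq_le hp0 hp hM n
    _ = (M + 1) / √n := by
        rw [add_div, mul_div_assoc', add_left_inj,
          div_eq_div_iff (by positivity) hn'.ne']
        linear_combination M * hsq

/-- The last `m` steps are exchanged one at a time for symmetric ones. Since `f` takes values in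
`[0, 1]`, each exchange costs at most the mean absolute drift at that time. -/
lemma integral_comp_pos_sub_le (hV : IsStepReinforced p V P) {i j : ℕ} (hi : 1 ≤ i) (hj : j ≤ i)
    (m : ℕ) {f : ℤ → ℝ} (hf0 : ∀ s, 0 ≤ f s) (hf1 : ∀ s, f s ≤ 1) :
    ∫ x, f (pos V (i + m) x - pos V j x) ∂P ≤
      ∫ x, stepAvg^[m] f (pos V i x - pos V j x) ∂P +
        ∑ k ∈ Finset.range m, ∫ x, |drift p V (i + k) x| ∂P := by
  induction m generalizing f with
  | zero => simp
  | succ m ih =>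
    have hs := ih (f := stepAvg f)
      (fun s => by have := hf0 (s + 1); have := hf0 (s - 1); rw [stepAvg]; positivity)
      (fun s => by have := hf1 (s + 1); have := hf1 (s - 1); rw [stepAvg]; linarith)
    rw [Finset.sum_range_succ, Function.iterate_succ_apply]
    have h1 : ∫ x, f (pos V (i + (m + 1)) x - pos V j x) ∂P ≤
        ∫ x, (stepAvg f (pos V (i + m) x - pos V j x) + |drift p V (i + m) x|) ∂P := by
      rw [← add_assoc, hV.integral_pos_step (j := j) (n := i + m) (by omega) (by omega)
        fun a b => f (b - a)]
      refine integral_mono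
        (hV.integrable_pos j (i + m) fun a b =>
          ((1 + (2 * p - 1) * b / (i + m : ℕ)) / 2) • f (b + 1 - a) +
          ((1 - (2 * p - 1) * b / (i + m : ℕ)) / 2) • f (b - 1 - a))
        ((hV.integrable_pos j (i + m) fun a b => stepAvg f (b - a)).add
          (hV.integrable_drift (i + m) fun u => |u|)) fun x => ?_
      simp only [smul_eq_mul, stepAvg]
      rw [show pos V (i + m) x + 1 - pos V j x = pos V (i + m) x - pos V j x + 1 by ring,
        show pos V (i + m) x - 1 - pos V j x = pos V (i + m) x - pos V j x - 1 by ring]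
      set a := f (pos V (i + m) x - pos V j x + 1) with ha
      set b := f (pos V (i + m) x - pos V j x - 1) with hb
      set u := drift p V (i + m) x
      have hab : |a - b| ≤ 1 := by
        rw [abs_le]
        constructor <;> linarith [hf0 (pos V (i + m) x - pos V j x + 1),
          hf0 (pos V (i + m) x - pos V j x - 1), hf1 (pos V (i + m) x - pos V j x + 1),
          hf1 (pos V (i + m) x - pos V j x - 1)]
      have hu : u * (a - b) ≤ |u| := by
        refine (le_abs_self _).trans ?_
        rw [abs_mul]
        exact mul_le_of_le_one_right (abs_nonneg _) hab
      linarith [abs_nonneg u]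
    rw [integral_add (hV.integrable_pos j (i + m) fun a b => stepAvg f (b - a))
      (hV.integrable_drift (i + m) fun u => |u|)] at h1
    linarith

/-- The last `2N⁴` steps are made symmetric. The local limit bound then gives `(∑ f)/N²`. After time
`N^14` the mean absolute drift is at most `(M + 1)/N⁷`, so the exchange costs `2N⁴ (M + 1)/N⁷ ≤ 2(M
+ 1)/N²`. -/
lemma integral_comp_pos_sub_le_of_le (hV : IsStepReinforced p V P) (hp0 : 0 ≤ p) (hp : p < 3 / 4)
    {M : ℝ} (hM0 : 0 < M) (hM : ∀ n : ℕ, ∫ x, (pos V n x : ℝ) ^ 2 ∂P ≤ M * n) {f : ℤ → ℝ}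
    (hf0 : ∀ s, 0 ≤ f s) (hf1 : ∀ s, f s ≤ 1) (hf : Summable f) {j k N : ℕ} (hN : 1 ≤ N)
    (hjk : j + 2 * N ^ 4 ≤ k) (hk : N ^ 14 + 2 * N ^ 4 ≤ k) :
    ∫ x, f (pos V k x - pos V j x) ∂P ≤ (∑' r, f r + 2 * (M + 1)) / N ^ 2 := by
  obtain ⟨i, rfl⟩ : ∃ i, k = i + 2 * N ^ 4 := ⟨k - 2 * N ^ 4, by omega⟩
  have hi : N ^ 14 ≤ i := by omega
  have hN' : (1 : ℝ) ≤ N := by exact_mod_cast hN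
  have hNpos : (0 : ℝ) < N := by linarith
  have hi1 : 1 ≤ i := (Nat.one_le_pow _ _ hN).trans hi
  refine (hV.integral_comp_pos_sub_le hi1 (by omega) (2 * N ^ 4) hf0 hf1).trans ?_
  have h1 : ∫ x, stepAvg^[2 * N ^ 4] f (pos V i x - pos V j x) ∂P ≤ (∑' r, f r) / N ^ 2 := by
    have hle : ∀ s, stepAvg^[2 * N ^ 4] f s ≤ (∑' r, f r) / N ^ 2 := by
      intro s
      refine (stepAvg_iterate_le hf0 hf (N ^ 4) s).trans ?_
      have hT : 0 ≤ ∑' r, f r := tsum_nonneg hf0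
      gcongr
      refine Real.le_sqrt_of_sq_le ?_
      push_cast
      nlinarith [pow_nonneg hNpos.le 4]
    calc _ ≤ ∫ _, (∑' r, f r) / N ^ 2 ∂P := integral_mono
          (hV.integrable_pos j i fun a b => stepAvg^[2 * N ^ 4] f (b - a)) (integrable_const _)
            fun x => hle _
      _ = _ := by simp
  have h2 : ∑ k ∈ Finset.range (2 * N ^ 4), ∫ x, |drift p V (i + k) x| ∂P ≤
      2 * (M + 1) / N ^ 2 := by
    have hle : ∀ k ∈ Finset.range (2 * N ^ 4), ∫ x, |drift p V (i + k) x| ∂P ≤ (M + 1) / N ^ 7 := by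
      intro k _
      refine (hV.integral_abs_drift_le hp0 hp hM (i + k)).trans ?_
      gcongr
      refine Real.le_sqrt_of_sq_le ?_
      rw [← pow_mul]
      exact_mod_cast hi.trans (Nat.le_add_right i k)
    refine (Finset.sum_le_sum hle).trans ?_
    rw [Finset.sum_const, Finset.card_range, nsmul_eq_mul]
    push_cast
    rw [mul_div_assoc', div_le_div_iff₀ (by positivity) (by positivity)]
    have : (N : ℝ) ^ 6 ≤ N ^ 7 := pow_le_pow_right₀ hN' (by norm_num)
    calc 2 * (N : ℝ) ^ 4 * (M + 1) * N ^ 2 = 2 * (M + 1) * N ^ 6 := by ring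
      _ ≤ 2 * (M + 1) * N ^ 7 := by gcongr
  rw [add_div]
  exact add_le_add h1 h2

/-- The walk does not return often to places it has visited. -/
lemma exists_sum_integral_comp_pos_sub_le (hV : IsStepReinforced p V P) (hp0 : 0 ≤ p)
    (hp : p < 3 / 4) {f : ℤ → ℝ} (hf0 : ∀ s, 0 ≤ f s) (hf1 : ∀ s, f s ≤ 1) (hf : Summable f)
    (hsymm : ∀ s, f (-s) = f s) :
    ∃ K : ℝ, 0 < K ∧ ∀ N n : ℕ, 1 ≤ N → n = N ^ 16 →
      ∑ j ∈ Finset.range n, ∑ k ∈ Finset.range n,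
        ∫ x, f (pos V k x - pos V j x) ∂P ≤ K * n ^ 2 / N ^ 2 := by
  obtain ⟨M, hM0, hM⟩ := hV.exists_integral_pos_sq_le hp0 hp
  have hT : 0 ≤ ∑' r, f r := tsum_nonneg hf0
  set K₀ := ∑' r, f r + 2 * (M + 1) with hK₀
  refine ⟨K₀ + 7, by positivity, fun N n hN hn => ?_⟩
  subst hn
  have hN' : (1 : ℝ) ≤ N := by exact_mod_cast hN
  have hNpos : (0 : ℝ) < N := by linarith
  have hone : ∀ j k, ∫ x, f (pos V k x - pos V j x) ∂P ≤ 1 := by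
    intro j k
    calc _ ≤ ∫ _, (1 : ℝ) ∂P := integral_mono (hV.integrable_pos j k fun a b => f (b - a))
          (integrable_const _) fun x => hf1 _
      _ = 1 := by simp
  have hswap : ∀ j k, ∫ x, f (pos V k x - pos V j x) ∂P = ∫ x, f (pos V j x - pos V k x) ∂P := by
    intro j k
    refine integral_congr_ae (ae_of_all _ fun x => ?_)
    simp only
    rw [← hsymm, neg_sub]
  -- Pairs with `k` early or with `j, k` close are bounded by `1`. Only `k` has to be late: if `k ≤
  -- j` then `j` is late too, and the symmetry of `f` exchanges the roles. Each `j` has at most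
  -- `N^14 + 2N⁴ + 4N⁴ ≤ 7 N^14` exceptional `k`, whence the constant `7`.
  have hpair : ∀ j k, ∫ x, f (pos V k x - pos V j x) ∂P ≤ K₀ / N ^ 2 +
      (if k < N ^ 14 + 2 * N ^ 4 then 1 else 0) +
      (if k ∈ Finset.Ico (j - 2 * N ^ 4) (j + 2 * N ^ 4) then 1 else 0) := by
    intro j k
    have hK : 0 ≤ K₀ / N ^ 2 := by positivity
    by_cases h1 : k < N ^ 14 + 2 * N ^ 4
    · rw [if_pos h1]
      have := hone j k
      split_ifs <;> linarith
    by_cases h2 : k ∈ Finset.Ico (j - 2 * N ^ 4) (j + 2 * N ^ 4)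
    · rw [if_pos h2, if_neg h1]
      linarith [hone j k]
    rw [if_neg h1, if_neg h2, add_zero, add_zero]
    rw [Finset.mem_Ico] at h2
    rcases le_total j k with hjk | hjk
    · exact hV.integral_comp_pos_sub_le_of_le hp0 hp hM0 hM hf0 hf1 hf hN (by omega) (by omega)
    · rw [hswap]
      exact hV.integral_comp_pos_sub_le_of_le hp0 hp hM0 hM hf0 hf1 hf hN (by omega) (by omega)
  have hrow : ∀ j, ∑ k ∈ Finset.range (N ^ 16), ∫ x, f (pos V k x - pos V j x) ∂P ≤
      (K₀ + 7) * N ^ 16 / N ^ 2 := by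
    intro j
    refine (Finset.sum_le_sum fun k _ => hpair j k).trans ?_
    rw [Finset.sum_add_distrib, Finset.sum_add_distrib, Finset.sum_const, Finset.card_range,
      nsmul_eq_mul, Finset.sum_boole, Finset.sum_boole]
    have c1 : ((Finset.range (N ^ 16)).filter (· < N ^ 14 + 2 * N ^ 4)).card ≤
        N ^ 14 + 2 * N ^ 4 := by
      calc _ ≤ (Finset.range (N ^ 14 + 2 * N ^ 4)).card :=
            Finset.card_le_card fun k hk => by
              simp only [Finset.mem_filter] at hk
              exact Finset.mem_range.2 hk.2
        _ = _ := Finset.card_range _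
    have c2 : ((Finset.range (N ^ 16)).filter
        (· ∈ Finset.Ico (j - 2 * N ^ 4) (j + 2 * N ^ 4))).card ≤ 4 * N ^ 4 := by
      calc _ ≤ (Finset.Ico (j - 2 * N ^ 4) (j + 2 * N ^ 4)).card :=
            Finset.card_le_card fun k hk => (Finset.mem_filter.1 hk).2
        _ ≤ _ := by rw [Nat.card_Ico]; omega
    have c1' : (((Finset.range (N ^ 16)).filter (· < N ^ 14 + 2 * N ^ 4)).card : ℝ) ≤
        N ^ 14 + 2 * N ^ 4 := by exact_mod_cast c1
    have c2' : (((Finset.range (N ^ 16)).filter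
        (· ∈ Finset.Ico (j - 2 * N ^ 4) (j + 2 * N ^ 4))).card : ℝ) ≤ 4 * N ^ 4 := by
      exact_mod_cast c2
    have h4 : (N : ℝ) ^ 4 ≤ N ^ 14 := pow_le_pow_right₀ hN' (by norm_num)
    have e : (K₀ + 7) * (N : ℝ) ^ 16 / N ^ 2 = K₀ * N ^ 14 + 7 * N ^ 14 := by field_simp
    have e2 : ((N ^ 16 : ℕ) : ℝ) * (K₀ / N ^ 2) = K₀ * N ^ 14 := by push_cast; field_simp
    rw [e, e2]
    linarith
  refine (Finset.sum_le_sum fun j _ => hrow j).trans ?_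
  rw [Finset.sum_const, Finset.card_range, nsmul_eq_mul]
  push_cast
  refine le_of_eq ?_
  ring

end IsStepReinforced

end Walk

end LevyLorentz

end

noncomputable section

namespace LevyLorentz

/-! ### Correlations of the medium -/

/-- The profile of the decay of correlations. -/
def decay (g : ℝ) (s : ℤ) : ℝ := Real.exp (-g * |(s : ℝ)|)

lemma decay_pos (g : ℝ) (s : ℤ) : 0 < decay g s := Real.exp_pos _

lemma decay_neg (g : ℝ) (s : ℤ) : decay g (-s) = decay g s := by simp [decay]

lemma decay_le_one {g : ℝ} (hg : 0 < g) (s : ℤ) : decay g s ≤ 1 :=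
  Real.exp_le_one_iff.2 (by nlinarith [abs_nonneg (s : ℝ)])

lemma summable_decay {g : ℝ} (hg : 0 < g) : Summable (decay g) := by
  have h : Summable fun n : ℕ => Real.exp (n * -g) := Real.summable_exp_nat_mul_iff.2 (by linarith)
  refine Summable.of_nat_of_neg (h.congr fun n => ?_) (h.congr fun n => ?_)
  · simp [decay, mul_comm]
  · simp [decay, mul_comm]

/-- Differences of labels of crossed gaps and differences of positions of the walk differ by at most
one; this passes from the former to the latter at the price `e^g`. -/
lemma decay_le_of_abs_sub_le {g : ℝ} (hg : 0 < g) {r s : ℤ} (h : |r - s| ≤ 1) :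
    decay g r ≤ Real.exp g * decay g s := by
  rw [decay, decay, ← Real.exp_add, Real.exp_le_exp]
  have h1 : |((r - s : ℤ) : ℝ)| ≤ 1 := by exact_mod_cast h
  have h2 : |(s : ℝ)| ≤ |(r : ℝ)| + 1 := by
    have := abs_sub_abs_le_abs_sub (s : ℝ) r
    rw [abs_sub_comm] at this
    push_cast at h1
    linarith
  nlinarith

lemma sum_decay_le {g : ℝ} (hg : 0 < g) {e : ℕ → ℤ} (he : Function.Injective e) (s : ℤ) (n : ℕ) :
    ∑ k ∈ Finset.range n, decay g (e k - s) ≤ ∑' r, decay g r := by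
  have hinj : Function.Injective fun k => e k - s := fun a b h => he (by simpa using h)
  calc ∑ k ∈ Finset.range n, decay g (e k - s)
      = ∑ r ∈ (Finset.range n).map ⟨_, hinj⟩, decay g r := by rw [Finset.sum_map]; rfl
    _ ≤ ∑' r, decay g r := (summable_decay hg).sum_le_tsum _ fun r _ => (decay_pos g r).le

section Medium

variable {μ : Measure (ℤ → ℝ)} [IsProbabilityMeasure μ]

lemma measurable_restrict_set (A : Set ℤ) :
    Measurable fun ζ : ℤ → ℝ => fun r : A => ζ r :=
  measurable_pi_lambda _ fun r => measurable_pi_apply (r : ℤ)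

lemma measurable_restrict_finset (A : Finset ℤ) :
    Measurable fun ζ : ℤ → ℝ => fun r : A => ζ r :=
  measurable_pi_lambda _ fun r => measurable_pi_apply (r : ℤ)

/-- If the conditional laws given any two configurations are comparable, then each of them is
comparable to the unconditional law. -/
lemma condLaw_le_map {Δ : Finset ℤ} {V : Set ℤ} {c : ENNReal} {η : ℤ → ℝ}
    (h : ∀ᵐ η' ∂μ, condLaw μ Δ V η ≤ c • condLaw μ Δ V η') :
    condLaw μ Δ V η ≤ c • μ.map fun ζ : ℤ → ℝ => fun r : Δ => ζ r := by
  have hX := measurable_restrict_finset Δ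
  have hY := measurable_restrict_set Vᶜ
  refine Measure.le_iff.2 fun B hB => ?_
  -- The left side does not depend on `η'`; averaging the bound over `η'` turns its right side into
  -- the marginal law.
  have h1 : condLaw μ Δ V η B = ∫⁻ _, condLaw μ Δ V η B ∂μ := by simp
  rw [h1]
  calc ∫⁻ _, condLaw μ Δ V η B ∂μ ≤ ∫⁻ η', c * condLaw μ Δ V η' B ∂μ := by
        refine lintegral_mono_ae ?_
        filter_upwards [h] with η' hη'
        simpa using hη' B
    _ = c * ∫⁻ η', condLaw μ Δ V η' B ∂μ :=
        lintegral_const_mul _ ((Kernel.measurable_coe _ hB).comp hY)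
    _ = (c • μ.map fun ζ : ℤ → ℝ => fun r : Δ => ζ r) B := by
        rw [Measure.smul_apply, smul_eq_mul,
          ← condDistrib_comp_map (X := fun ζ : ℤ → ℝ => fun r : (Vᶜ : Set ℤ) => ζ r)
            hY.aemeasurable hX.aemeasurable, Measure.bind_apply hB (Kernel.aemeasurable _),
          lintegral_map (Kernel.measurable_coe _ hB) hY]
        rfl

/-- Entanglement with `Δ = {a}` and `A = Vᶜ = {b}`: the agreement condition on `Vᶜ \ A` is empty, so
the law of `ζ_a` given `ζ_b` is at most `exp(C e^{-g|a-b|})` times its marginal, and disintegration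
over `ζ_b` concludes. -/
lemma lintegral_enorm_mul_le {C g : ℝ} {a b : ℤ}
    (h : ∃ G : Set (ℤ → ℝ), (∀ᵐ η ∂μ, η ∈ G) ∧
      ∀ η ∈ G, ∀ η' ∈ G, (∀ u ∈ (({b} : Set ℤ)ᶜ)ᶜ \ (({b} : Finset ℤ) : Set ℤ), η u = η' u) →
        condLaw μ {a} ({b} : Set ℤ)ᶜ η ≤
          ENNReal.ofReal (Real.exp (C * ∑ r ∈ ({a} : Finset ℤ), ∑ u ∈ ({b} : Finset ℤ),
            Real.exp (-g * |((r - u : ℤ) : ℝ)|))) • condLaw μ {a} ({b} : Set ℤ)ᶜ η') :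
    ∫⁻ ζ, ‖ζ a‖ₑ * ‖ζ b‖ₑ ∂μ ≤ ENNReal.ofReal (Real.exp (C * decay g (a - b))) *
      ((∫⁻ ζ, ‖ζ a‖ₑ ∂μ) * ∫⁻ ζ, ‖ζ b‖ₑ ∂μ) := by
  obtain ⟨G, hG, hle⟩ := h
  set c := ENNReal.ofReal (Real.exp (C * decay g (a - b))) with hc
  simp only [Finset.sum_singleton] at hle
  change ∀ η ∈ G, ∀ η' ∈ G, _ → _ ≤ c • _ at hle
  set Δ : Finset ℤ := {a}
  set V : Set ℤ := ({b} : Set ℤ)ᶜ with hVdef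
  have hX := measurable_restrict_finset Δ
  have hY := measurable_restrict_set Vᶜ
  have hcomp : ∀ᵐ η ∂μ, condLaw μ Δ V η ≤ c • μ.map fun ζ : ℤ → ℝ => fun r : Δ => ζ r := by
    filter_upwards [hG] with η hη
    refine condLaw_le_map ?_
    filter_upwards [hG] with η' hη'
    refine hle η hη η' hη' fun u hu => ?_
    simp [hVdef] at hu
  have haΔ : a ∈ Δ := Finset.mem_singleton_self a
  have hbV : b ∈ Vᶜ := by simp [hVdef]
  have hf : Measurable fun z : ((Vᶜ : Set ℤ) → ℝ) × (Δ → ℝ) =>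
      ‖z.2 ⟨a, haΔ⟩‖ₑ * ‖z.1 ⟨b, hbV⟩‖ₑ := by
    fun_prop
  have e1 : ∫⁻ ζ, ‖ζ a‖ₑ * ‖ζ b‖ₑ ∂μ =
      ∫⁻ η, ∫⁻ x, ‖x ⟨a, haΔ⟩‖ₑ * ‖η b‖ₑ ∂(condLaw μ Δ V η) ∂μ := by
    have h1 : ∫⁻ ζ, ‖ζ a‖ₑ * ‖ζ b‖ₑ ∂μ = ∫⁻ z, ‖z.2 ⟨a, haΔ⟩‖ₑ * ‖z.1 ⟨b, hbV⟩‖ₑ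
        ∂(μ.map fun ζ : ℤ → ℝ => ((fun r : (Vᶜ : Set ℤ) => ζ r), (fun r : Δ => ζ r))) := by
      rw [lintegral_map hf (hY.prodMk hX)]
    rw [h1, ← compProd_map_condDistrib hX.aemeasurable, Measure.lintegral_compProd hf,
      lintegral_map (hf.lintegral_kernel_prod_right (κ := condDistrib _ _ μ)) hY]
    rfl
  rw [e1]
  have hEa : ∫⁻ x, ‖x ⟨a, haΔ⟩‖ₑ ∂(μ.map fun ζ : ℤ → ℝ => fun r : Δ => ζ r) =
      ∫⁻ ζ, ‖ζ a‖ₑ ∂μ := by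
    rw [lintegral_map (by fun_prop) hX]
  calc ∫⁻ η, ∫⁻ x, ‖x ⟨a, haΔ⟩‖ₑ * ‖η b‖ₑ ∂(condLaw μ Δ V η) ∂μ
      ≤ ∫⁻ η, (c * ∫⁻ ζ, ‖ζ a‖ₑ ∂μ) * ‖η b‖ₑ ∂μ := by
        refine lintegral_mono_ae ?_
        filter_upwards [hcomp] with η hη
        rw [lintegral_mul_const _ (by fun_prop)]
        gcongr
        refine (lintegral_mono' hη le_rfl).trans ?_
        rw [lintegral_smul_measure, hEa, smul_eq_mul]
    _ = c * ((∫⁻ ζ, ‖ζ a‖ₑ ∂μ) * ∫⁻ ζ, ‖ζ b‖ₑ ∂μ) := by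
        rw [lintegral_const_mul _ (by fun_prop), mul_assoc]

lemma measurable_shift : Measurable shift :=
  measurable_pi_lambda _ fun r => measurable_pi_apply (r + 1)

namespace IsEntangledMedium

lemma identDistrib (hμ : IsEntangledMedium μ) (r : ℤ) :
    IdentDistrib (fun ζ : ℤ → ℝ => ζ r) (fun ζ : ℤ → ℝ => ζ 1) μ μ := by
  refine ⟨(measurable_pi_apply r).aemeasurable, (measurable_pi_apply 1).aemeasurable, ?_⟩
  have hstep : ∀ s : ℤ, μ.map (fun ζ : ℤ → ℝ => ζ (s + 1)) = μ.map fun ζ : ℤ → ℝ => ζ s := by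
    intro s
    have h := hμ.ergodic.toMeasurePreserving.map_eq
    conv_rhs => rw [← h]
    rw [Measure.map_map (measurable_pi_apply s) measurable_shift]
    rfl
  refine Int.inductionOn' r 1 rfl (fun k _ ih => ?_) fun k _ ih => ?_
  · rw [hstep, ih]
  · rw [← ih, ← hstep (k - 1)]
    simp

lemma memLp_two (hμ : IsEntangledMedium μ) (r : ℤ) : MemLp (fun ζ : ℤ → ℝ => ζ r) 2 μ := by
  rw [(hμ.identDistrib r).memLp_iff, memLp_two_iff_integrable_sq
    (measurable_pi_apply 1).aestronglyMeasurable]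
  obtain ⟨q, hq, hintg⟩ := hμ.exp_moment
  refine (hintg.const_mul 2).mono' ((measurable_pi_apply 1).pow_const 2).aestronglyMeasurable ?_
  filter_upwards [hμ.nonneg 1] with ζ hζ
  rw [Real.norm_eq_abs, abs_of_nonneg (sq_nonneg _)]
  have h1 := Real.quadratic_le_exp_of_nonneg hζ
  have h2 : Real.exp (ζ 1) ≤ Real.exp (q * ζ 1) := Real.exp_le_exp.2 (by nlinarith)
  linarith

/-- Gaps are kept in absolute value so that their partial sums are monotone for every configuration;
almost surely this changes nothing. -/
lemma integral_abs_eq (hμ : IsEntangledMedium μ) (r : ℤ) :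
    ∫ ζ, |ζ r| ∂μ = ∫ ζ, ζ 1 ∂μ := by
  have h := ((hμ.identDistrib r).comp (u := fun x : ℝ => |x|) (by fun_prop)).integral_eq
  simp only [Function.comp_def] at h
  rw [h]
  refine integral_congr_ae ?_
  filter_upwards [hμ.nonneg 1] with ζ hζ using abs_of_nonneg hζ

lemma mean_pos (hμ : IsEntangledMedium μ) : 0 < ∫ ζ, ζ 1 ∂μ := by
  have hintg : Integrable (fun ζ : ℤ → ℝ => ζ 1) μ := (hμ.memLp_two 1).integrable one_le_two
  refine lt_of_le_of_ne (integral_nonneg_of_ae (hμ.nonneg 1)) fun h => hμ.nondegenerate ?_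
  exact (integral_eq_zero_iff_of_nonneg_ae (hμ.nonneg 1) hintg).1 h.symm

lemma memLp_abs_sub (hμ : IsEntangledMedium μ) (r : ℤ) (ℓ : ℝ) :
    MemLp (fun ζ : ℤ → ℝ => |ζ r| - ℓ) 2 μ :=
  (hμ.memLp_two r).abs.sub (memLp_const ℓ)

/-- Off the diagonal entanglement bounds the covariance by `(e^{Cd} - 1) ℓ²`, of order `d = decay g
(a - b)`; on the diagonal the second moment suffices. A variance bound needs only this upper side.
-/
lemma exists_covariance_le (hμ : IsEntangledMedium μ) :
    ∃ K > (0 : ℝ), ∃ g > (0 : ℝ), ∀ a b : ℤ,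
      ∫ ζ, (|ζ a| - ∫ ξ, ξ 1 ∂μ) * (|ζ b| - ∫ ξ, ξ 1 ∂μ) ∂μ ≤ K * decay g (a - b) := by
  obtain ⟨C, hC, g, hg, hent⟩ := hμ.entangled
  set ℓ := ∫ ξ, ξ 1 ∂μ with hℓ
  have hℓ0 : 0 < ℓ := hμ.mean_pos
  have hintg : ∀ r, Integrable (fun ζ : ℤ → ℝ => |ζ r|) μ := fun r =>
    ((hμ.memLp_two r).integrable one_le_two).abs
  have hint2 : ∀ a b, Integrable (fun ζ : ℤ → ℝ => |ζ a| * |ζ b|) μ := fun a b =>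
    (hμ.memLp_two a).abs.integrable_mul (hμ.memLp_two b).abs
  have hmean : ∀ r, ∫ ζ, |ζ r| ∂μ = ℓ := hμ.integral_abs_eq
  have hexpand : ∀ a b, ∫ ζ, (|ζ a| - ℓ) * (|ζ b| - ℓ) ∂μ = ∫ ζ, |ζ a| * |ζ b| ∂μ - ℓ ^ 2 := by
    intro a b
    have h : ∀ ζ : ℤ → ℝ, (|ζ a| - ℓ) * (|ζ b| - ℓ) =
        |ζ a| * |ζ b| - (ℓ * |ζ a| + ℓ * |ζ b| - ℓ ^ 2) := fun ζ => by ring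
    have i1 : Integrable (fun ζ : ℤ → ℝ => ℓ * |ζ a| + ℓ * |ζ b|) μ :=
      ((hintg a).const_mul ℓ).add ((hintg b).const_mul ℓ)
    have i2 : Integrable (fun ζ : ℤ → ℝ => ℓ * |ζ a| + ℓ * |ζ b| - ℓ ^ 2) μ :=
      i1.sub (integrable_const _)
    simp only [h]
    rw [integral_sub (hint2 a b) i2, integral_sub i1 (integrable_const _),
      integral_add ((hintg a).const_mul ℓ) ((hintg b).const_mul ℓ),
      integral_const_mul, integral_const_mul, hmean a, hmean b]
    simp
    ring
  have hoff : ∀ a b, a ≠ b → ∫ ζ, |ζ a| * |ζ b| ∂μ ≤ Real.exp (C * decay g (a - b)) * ℓ ^ 2 := by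
    intro a b hab
    have h := lintegral_enorm_mul_le (hent {a} {b} ({b} : Set ℤ)ᶜ (by simpa using hab.symm)
      (by simp))
    have e1 : ∀ r, ∫⁻ ζ : ℤ → ℝ, ‖ζ r‖ₑ ∂μ = ENNReal.ofReal ℓ := by
      intro r
      rw [← hmean r, ofReal_integral_eq_lintegral_ofReal (hintg r)
        (ae_of_all _ fun _ => abs_nonneg _)]
      refine lintegral_congr fun ζ => ?_
      rw [Real.enorm_eq_ofReal_abs]
    have e2 : ∫⁻ ζ : ℤ → ℝ, ‖ζ a‖ₑ * ‖ζ b‖ₑ ∂μ = ENNReal.ofReal (∫ ζ, |ζ a| * |ζ b| ∂μ) := by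
      rw [ofReal_integral_eq_lintegral_ofReal (hint2 a b)
        (ae_of_all _ fun _ => mul_nonneg (abs_nonneg _) (abs_nonneg _))]
      refine lintegral_congr fun ζ => ?_
      rw [Real.enorm_eq_ofReal_abs, Real.enorm_eq_ofReal_abs, ENNReal.ofReal_mul (abs_nonneg _)]
    rw [e1, e1, e2, ← ENNReal.ofReal_mul hℓ0.le, ← ENNReal.ofReal_mul (Real.exp_pos _).le,
      ENNReal.ofReal_le_ofReal_iff (by positivity)] at h
    linarith [h, sq ℓ]
  set m := ∫ ζ, |ζ 1| * |ζ 1| ∂μ with hm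
  have hm0 : 0 ≤ m := integral_nonneg fun _ => mul_self_nonneg _
  have hdiag : ∀ a, ∫ ζ, |ζ a| * |ζ a| ∂μ = m := fun a =>
    ((hμ.identDistrib a).comp (u := fun x : ℝ => |x| * |x|) (by fun_prop)).integral_eq
  refine ⟨C * Real.exp C * ℓ ^ 2 + m, by positivity, g, hg, fun a b => ?_⟩
  rw [hexpand]
  rcases eq_or_ne a b with rfl | hab
  · have : decay g (a - a) = 1 := by simp [decay]
    rw [hdiag, this]
    have : 0 ≤ C * Real.exp C * ℓ ^ 2 := by positivity
    nlinarith [sq_nonneg ℓ]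
  · have h := hoff a b hab
    set d := decay g (a - b)
    have hd0 : 0 < d := decay_pos _ _
    have hd1 : d ≤ 1 := decay_le_one hg _
    -- This is `e^x - 1 ≤ x e^x`, obtained from `1 - x ≤ e^{-x}`.
    have h1 : Real.exp (C * d) - 1 ≤ C * d * Real.exp C := by
      have h2 : 1 - C * d ≤ Real.exp (-(C * d)) := by linarith [Real.add_one_le_exp (-(C * d))]
      have h3 : Real.exp (C * d) ≤ Real.exp C := Real.exp_le_exp.2 (by nlinarith)
      have h4 : Real.exp (C * d) * Real.exp (-(C * d)) = 1 := by
        rw [← Real.exp_add]; simp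
      have h5 := mul_le_mul_of_nonneg_left h2 (Real.exp_pos (C * d)).le
      have h6 : C * d * Real.exp (C * d) ≤ C * d * Real.exp C := by gcongr
      nlinarith
    have h7 := mul_le_mul_of_nonneg_right h1 (sq_nonneg ℓ)
    nlinarith [mul_nonneg hm0 hd0.le]

/-- The variance of the total length of a finite family of gaps. -/
lemma exists_variance_le (hμ : IsEntangledMedium μ) :
    ∃ K > (0 : ℝ), ∃ g > (0 : ℝ), ∀ (n : ℕ) (e : ℕ → ℤ),
      ∫⁻ ζ, ENNReal.ofReal ((∑ k ∈ Finset.range n, |ζ (e k)| - n * ∫ ξ, ξ 1 ∂μ) ^ 2) ∂μ ≤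
        ENNReal.ofReal (K * ∑ j ∈ Finset.range n, ∑ k ∈ Finset.range n, decay g (e k - e j)) := by
  obtain ⟨K, hK, g, hg, h⟩ := hμ.exists_covariance_le
  refine ⟨K, hK, g, hg, fun n e => ?_⟩
  set ℓ := ∫ ξ, ξ 1 ∂μ with hℓ
  have hsq : ∀ ζ : ℤ → ℝ, (∑ k ∈ Finset.range n, |ζ (e k)| - n * ℓ) ^ 2 =
      ∑ j ∈ Finset.range n, ∑ k ∈ Finset.range n, (|ζ (e k)| - ℓ) * (|ζ (e j)| - ℓ) := by
    intro ζ
    have : ∑ k ∈ Finset.range n, |ζ (e k)| - n * ℓ = ∑ k ∈ Finset.range n, (|ζ (e k)| - ℓ) := by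
      simp
    rw [this, sq, Finset.sum_mul_sum, Finset.sum_comm]
  have hintg : ∀ a b, Integrable (fun ζ : ℤ → ℝ => (|ζ a| - ℓ) * (|ζ b| - ℓ)) μ := fun a b =>
    (hμ.memLp_abs_sub a ℓ).integrable_mul (hμ.memLp_abs_sub b ℓ)
  have hint2 : Integrable (fun ζ : ℤ → ℝ => (∑ k ∈ Finset.range n, |ζ (e k)| - n * ℓ) ^ 2) μ := by
    simp only [hsq]
    exact integrable_finsetSum _ fun j _ => integrable_finsetSum _ fun k _ => hintg _ _
  rw [← ofReal_integral_eq_lintegral_ofReal hint2 (ae_of_all _ fun _ => sq_nonneg _)]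
  refine ENNReal.ofReal_le_ofReal ?_
  simp only [hsq]
  rw [integral_finsetSum _ fun j _ => integrable_finsetSum _ fun k _ => hintg _ _, Finset.mul_sum]
  refine Finset.sum_le_sum fun j _ => ?_
  rw [integral_finsetSum _ fun k _ => hintg _ _, Finset.mul_sum]
  exact Finset.sum_le_sum fun k _ => h _ _

end IsEntangledMedium

end Medium

/-! ### A law of large numbers for monotone sequences -/

/-- Consecutive terms of `N^16` have ratio tending to `1`, so monotonicity fills the gaps. The
exponent is the one for which returns of the walk are counted. -/
lemma tendsto_div_of_tendsto_pow {u : ℕ → ℝ} {l : ℝ} (hu : Monotone u)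
    (h : Tendsto (fun N : ℕ => u (N ^ 16) / (N ^ 16 : ℕ)) atTop (𝓝 l)) :
    Tendsto (fun n : ℕ => u n / n) atTop (𝓝 l) := by
  refine tendsto_div_of_monotone_of_exists_subseq_tendsto_div u l hu fun a ha => ?_
  refine ⟨fun N => N ^ 16, ?_, tendsto_pow_atTop (by norm_num), h⟩
  have hlim : Tendsto (fun N : ℕ => (1 + 1 / (N : ℝ)) ^ 16) atTop (𝓝 1) := by
    simpa using (tendsto_one_div_atTop_nhds_zero_nat.const_add (1 : ℝ)).pow 16
  filter_upwards [hlim.eventually_le_const ha, eventually_ge_atTop 1] with N hN hN1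
  have hNpos : (0 : ℝ) < N := by exact_mod_cast hN1
  have : ((N : ℝ) + 1) ^ 16 = (1 + 1 / (N : ℝ)) ^ 16 * N ^ 16 := by
    rw [← mul_pow]; congr 1; field_simp
  push_cast
  rw [this]
  gcongr

/-- Along `n = N^16` the mean square of `Y_n / n - l` is `O(N⁻²)`, hence summable: almost surely the
squares themselves are summable and tend to `0`. -/
lemma ae_tendsto_div_of_lintegral_le {Ω : Type*} [MeasurableSpace Ω] {Q : Measure Ω}
    {Y : ℕ → Ω → ℝ} (hY : ∀ n, Measurable (Y n)) (hmono : ∀ x, Monotone fun n => Y n x) {l K : ℝ}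
    (hK : ∀ N n : ℕ, 1 ≤ N → n = N ^ 16 → ∫⁻ x, ENNReal.ofReal ((Y n x - n * l) ^ 2) ∂Q ≤
      ENNReal.ofReal (K * n ^ 2 / N ^ 2)) :
    ∀ᵐ x ∂Q, Tendsto (fun n : ℕ => Y n x / n) atTop (𝓝 l) := by
  set D : ℕ → Ω → ENNReal := fun N x =>
    ENNReal.ofReal ((Y ((N + 1) ^ 16) x / ((N + 1) ^ 16 : ℕ) - l) ^ 2) with hD
  have hDm : ∀ N, Measurable (D N) := fun N =>
    ((((hY _).div_const _).sub_const _).pow_const _).ennreal_ofReal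
  have hbound : ∀ N, ∫⁻ x, D N x ∂Q ≤ ENNReal.ofReal (K * (1 / ((N : ℝ) + 1) ^ 2)) := by
    intro N
    have hpos : (0 : ℝ) < (((N + 1) ^ 16 : ℕ) : ℝ) := by positivity
    have e : ∀ x, D N x = ENNReal.ofReal (1 / (((N + 1) ^ 16 : ℕ) : ℝ) ^ 2) *
        ENNReal.ofReal ((Y ((N + 1) ^ 16) x - ((N + 1) ^ 16 : ℕ) * l) ^ 2) := by
      intro x
      rw [← ENNReal.ofReal_mul (by positivity), hD]
      field_simp
    simp only [e]
    rw [lintegral_const_mul _ ((((hY _).sub_const _).pow_const _).ennreal_ofReal)]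
    refine (mul_le_mul_right (hK (N + 1) _ (by omega) rfl) _).trans (le_of_eq ?_)
    rw [← ENNReal.ofReal_mul (by positivity)]
    congr 1
    push_cast
    field_simp
  have hsum : ∑' N, ∫⁻ x, D N x ∂Q ≠ ⊤ := by
    have hs : Summable fun N : ℕ => K * (1 / ((N : ℝ) + 1) ^ 2) := by
      have := (summable_nat_add_iff 1).2 (Real.summable_one_div_nat_pow.2 one_lt_two)
      simpa using this.mul_left K
    exact ne_top_of_le_ne_top hs.tsum_ofReal_ne_top (ENNReal.tsum_le_tsum hbound)
  rw [← lintegral_tsum fun N => (hDm N).aemeasurable] at hsum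
  filter_upwards [ae_lt_top' (AEMeasurable.tsum fun N => (hDm N).aemeasurable) hsum]
    with x hx
  refine tendsto_div_of_tendsto_pow (hmono x) ?_
  rw [← tendsto_add_atTop_iff_nat 1]
  have h1 := ENNReal.tendsto_atTop_zero_of_tsum_ne_top hx.ne
  have h2 : Tendsto (fun N => (Y ((N + 1) ^ 16) x / ((N + 1) ^ 16 : ℕ) - l) ^ 2) atTop (𝓝 0) := by
    have := (ENNReal.tendsto_toReal ENNReal.zero_ne_top).comp h1
    refine this.congr fun N => ?_
    simp only [Function.comp, hD]
    exact ENNReal.toReal_ofReal (sq_nonneg _)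
  have h3 : Tendsto (fun N => |Y ((N + 1) ^ 16) x / ((N + 1) ^ 16 : ℕ) - l|) atTop (𝓝 0) := by
    have := h2.sqrt
    rw [Real.sqrt_zero] at this
    exact this.congr fun N => Real.sqrt_sq_eq_abs _
  exact tendsto_iff_norm_sub_tendsto_zero.2 h3

end LevyLorentz

end

noncomputable section

namespace LevyLorentz

/-! ### Laws of large numbers for the scatterers and the collision times -/

lemma scatterer_zero (ζ : ℤ → ℝ) : scatterer ζ 0 = 0 := by simp [scatterer]

lemma scatterer_add_one (ζ : ℤ → ℝ) (r : ℤ) : scatterer ζ (r + 1) = scatterer ζ r + ζ (r + 1) := by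
  rcases le_or_gt 0 r with hr | hr
  · have h1 : Finset.Ioc 0 (r + 1) = insert (r + 1) (Finset.Ioc 0 r) := by
      ext i; simp only [Finset.mem_Ioc, Finset.mem_insert]; omega
    have h2 : Finset.Ioc (r + 1) 0 = ∅ := Finset.Ioc_eq_empty (by omega)
    have h3 : Finset.Ioc r 0 = ∅ := Finset.Ioc_eq_empty (by omega)
    rw [scatterer, scatterer, h1, h2, h3, Finset.sum_insert (by simp)]
    ring
  · have h1 : Finset.Ioc r 0 = insert (r + 1) (Finset.Ioc (r + 1) 0) := by
      ext i; simp only [Finset.mem_Ioc, Finset.mem_insert]; omega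
    have h2 : Finset.Ioc 0 (r + 1) = ∅ := Finset.Ioc_eq_empty (by omega)
    have h3 : Finset.Ioc 0 r = ∅ := Finset.Ioc_eq_empty (by omega)
    rw [scatterer, scatterer, h1, h2, h3, Finset.sum_insert (by simp)]
    ring

lemma measurable_scatterer : Measurable fun z : (ℤ → ℝ) × ℤ => scatterer z.1 z.2 := by
  refine measurable_from_prod_countable_left fun r => ?_
  simp only [scatterer]
  exact (Finset.measurable_fun_sum _ fun i _ => measurable_pi_apply i).sub
    (Finset.measurable_fun_sum _ fun i _ => measurable_pi_apply i)

lemma scatterer_natCast (ζ : ℤ → ℝ) (n : ℕ) :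
    scatterer ζ n = ∑ k ∈ Finset.range n, ζ ((k : ℤ) + 1) := by
  induction n with
  | zero => simp [scatterer_zero]
  | succ n ih =>
    rw [Finset.sum_range_succ, ← ih]
    push_cast
    exact scatterer_add_one ζ n

lemma scatterer_neg_natCast (ζ : ℤ → ℝ) (n : ℕ) :
    scatterer ζ (-n) = -∑ k ∈ Finset.range n, ζ (-(k : ℤ)) := by
  induction n with
  | zero => simp [scatterer_zero]
  | succ n ih =>
    have h := scatterer_add_one ζ (-(n + 1 : ℕ) : ℤ)
    rw [show (-(n + 1 : ℕ) : ℤ) + 1 = -n by push_cast; ring, ih] at h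
    rw [Finset.sum_range_succ]
    linarith

namespace IsEntangledMedium

variable {μ : Measure (ℤ → ℝ)} [IsProbabilityMeasure μ]

lemma ae_nonneg (hμ : IsEntangledMedium μ) : ∀ᵐ ζ ∂μ, ∀ r, 0 ≤ ζ r :=
  ae_all_iff.2 hμ.nonneg

/-- The law of large numbers for the gaps along an injective sequence of labels. -/
lemma ae_tendsto_sum_abs (hμ : IsEntangledMedium μ) {e : ℕ → ℤ} (he : Function.Injective e) :
    ∀ᵐ (ζ : ℤ → ℝ) ∂μ, Tendsto (fun n : ℕ => (∑ k ∈ Finset.range n, |ζ (e k)|) / n) atTop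
      (𝓝 (∫ ξ, ξ 1 ∂μ)) := by
  obtain ⟨K, hK, g, hg, h⟩ := hμ.exists_variance_le
  have hT : 0 ≤ ∑' r, decay g r := tsum_nonneg fun r => (decay_pos g r).le
  refine ae_tendsto_div_of_lintegral_le (K := K * ∑' r, decay g r)
    (Y := fun n (ζ : ℤ → ℝ) => ∑ k ∈ Finset.range n, |ζ (e k)|)
    (fun n => Finset.measurable_fun_sum _ fun k _ => (measurable_pi_apply (e k)).abs)
    (fun ζ => monotone_nat_of_le_succ fun n => by
      rw [Finset.sum_range_succ]; exact le_add_of_nonneg_right (abs_nonneg _)) fun N n hN hn => ?_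
  refine (h _ e).trans (ENNReal.ofReal_le_ofReal ?_)
  have hN' : (1 : ℝ) ≤ N := by exact_mod_cast hN
  have h1 : ∑ j ∈ Finset.range n, ∑ k ∈ Finset.range n, decay g (e k - e j) ≤
      n * ∑' r, decay g r := by
    refine (Finset.sum_le_sum fun j _ => sum_decay_le hg he (e j) _).trans (le_of_eq ?_)
    simp
  have h2 : (n : ℝ) ≤ n ^ 2 / N ^ 2 := by
    rw [le_div_iff₀ (by positivity), sq (n : ℝ)]
    refine mul_le_mul_of_nonneg_left ?_ (Nat.cast_nonneg n)
    rw [hn]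
    push_cast
    exact pow_le_pow_right₀ hN' (by norm_num)
  calc K * _ ≤ K * (n * ∑' r, decay g r) := by gcongr
    _ ≤ K * ((n : ℝ) ^ 2 / N ^ 2 * ∑' r, decay g r) := by gcongr
    _ = _ := by ring

lemma ae_tendsto_scatterer (hμ : IsEntangledMedium μ) :
    ∀ᵐ ζ ∂μ, Tendsto (fun n : ℕ => scatterer ζ n / n) atTop (𝓝 (∫ ξ, ξ 1 ∂μ)) := by
  filter_upwards [hμ.ae_nonneg, hμ.ae_tendsto_sum_abs (e := fun k => (k : ℤ) + 1)
    fun a b h => by simpa using h] with ζ h0 h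
  refine h.congr fun n => ?_
  rw [scatterer_natCast]
  simp only [abs_of_nonneg (h0 _)]

lemma ae_tendsto_scatterer_neg (hμ : IsEntangledMedium μ) :
    ∀ᵐ ζ ∂μ, Tendsto (fun n : ℕ => -scatterer ζ (-n) / n) atTop (𝓝 (∫ ξ, ξ 1 ∂μ)) := by
  filter_upwards [hμ.ae_nonneg, hμ.ae_tendsto_sum_abs (e := fun k => -(k : ℤ))
    fun a b h => by simpa using h] with ζ h0 h
  refine h.congr fun n => ?_
  rw [scatterer_neg_natCast, neg_neg]
  simp only [abs_of_nonneg (h0 _)]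

end IsEntangledMedium

lemma exists_abs_sub_le_of_tendsto {u : ℕ → ℝ} {ℓ : ℝ}
    (h : Tendsto (fun n : ℕ => u n / n) atTop (𝓝 ℓ)) {ε : ℝ} (hε : 0 < ε) :
    ∃ C : ℝ, 0 ≤ C ∧ ∀ n : ℕ, |u n - ℓ * n| ≤ ε * n + C := by
  obtain ⟨N, hN⟩ := eventually_atTop.1 (Metric.tendsto_nhds.1 h ε hε)
  refine ⟨∑ n ∈ Finset.range (N + 1), |u n - ℓ * n|, Finset.sum_nonneg fun _ _ => abs_nonneg _,
    fun n => ?_⟩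
  have hC : 0 ≤ ∑ n ∈ Finset.range (N + 1), |u n - ℓ * n| :=
    Finset.sum_nonneg fun _ _ => abs_nonneg _
  rcases lt_or_ge n (N + 1) with hn | hn
  · have := Finset.single_le_sum (f := fun n : ℕ => |u n - ℓ * n|) (fun _ _ => abs_nonneg _)
      (Finset.mem_range.2 hn)
    have h2 : 0 ≤ ε * n := by positivity
    linarith
  · have hnpos : (0 : ℝ) < n := by exact_mod_cast (by omega : 0 < n)
    have h1 := hN n (by omega)
    rw [Real.dist_eq] at h1
    have h2 : u n - ℓ * n = (u n / n - ℓ) * n := by field_simp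
    rw [h2, abs_mul, abs_of_pos hnpos]
    nlinarith

/-- A bound at all labels with a fixed additive constant can be evaluated at the random label `S_n`:
after division by `√n`, `C` disappears and `ε |S_n|` is controlled by the second moment. -/
lemma exists_abs_scatterer_sub_le {ζ : ℤ → ℝ} {ℓ : ℝ}
    (h1 : Tendsto (fun n : ℕ => scatterer ζ n / n) atTop (𝓝 ℓ))
    (h2 : Tendsto (fun n : ℕ => -scatterer ζ (-n) / n) atTop (𝓝 ℓ)) {ε : ℝ} (hε : 0 < ε) :
    ∃ C : ℝ, 0 ≤ C ∧ ∀ r : ℤ, |scatterer ζ r - ℓ * r| ≤ ε * |(r : ℝ)| + C := by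
  obtain ⟨C₁, hC₁, h1⟩ := exists_abs_sub_le_of_tendsto h1 hε
  obtain ⟨C₂, hC₂, h2⟩ := exists_abs_sub_le_of_tendsto h2 hε
  refine ⟨C₁ + C₂, by positivity, fun r => ?_⟩
  obtain ⟨n, rfl | rfl⟩ := r.eq_nat_or_neg
  · have := h1 n
    simp only [Int.cast_natCast, Nat.abs_cast]
    linarith
  · have := h2 n
    rw [show -scatterer ζ (-(n : ℤ)) - ℓ * n = -(scatterer ζ (-(n : ℤ)) - ℓ * (-(n : ℝ))) by ring,
      abs_neg] at this
    simp only [Int.cast_neg, Int.cast_natCast, abs_neg, Nat.abs_cast]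
    linarith

/-! ### The collision times -/

lemma collisionTime_mono (ζ : ℤ → ℝ) (v : ℕ → ℤ) : Monotone (collisionTime ζ v) :=
  monotone_nat_of_le_succ fun n => by
    rw [collisionTime, collisionTime, Finset.sum_range_succ]
    exact le_add_of_nonneg_right (abs_nonneg _)

/-- The label of the gap crossed at step `k`. -/
def edge (v : ℕ → ℤ) (k : ℕ) : ℤ := walk v k + if v k = 1 then 1 else 0

/-- A step up from `s` crosses gap `s + 1`, a step down crosses gap `s`. -/
lemma abs_gas_sub (ζ : ℤ → ℝ) {v : ℕ → ℤ} (hv : ∀ k, v k = 1 ∨ v k = -1) (k : ℕ) :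
    |gas ζ v (k + 1) - gas ζ v k| = |ζ (edge v k)| := by
  have hw : walk v (k + 1) = walk v k + v k := by simp [walk, Finset.sum_range_succ]
  rw [gas, gas, hw, edge]
  rcases hv k with h | h
  · rw [h, scatterer_add_one]; simp
  · have := scatterer_add_one ζ (walk v k - 1)
    rw [sub_add_cancel] at this
    rw [h, this, abs_sub_comm]
    simp [← sub_eq_add_neg]

lemma collisionTime_eq (ζ : ℤ → ℝ) {v : ℕ → ℤ} (hv : ∀ k, v k = 1 ∨ v k = -1) (n : ℕ) :
    collisionTime ζ v n = ∑ k ∈ Finset.range n, |ζ (edge v k)| :=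
  Finset.sum_congr rfl fun k _ => abs_gas_sub ζ hv k

lemma abs_edge_sub_le (v : ℕ → ℤ) (j k : ℕ) :
    |(edge v k - edge v j) - (walk v k - walk v j)| ≤ 1 := by
  rw [edge, edge, abs_le]
  split_ifs <;> constructor <;> omega

section Walk

variable {Ω : Type*} [MeasurableSpace Ω] {P : Measure Ω} [IsProbabilityMeasure P] {p : ℝ}
  {V : ℕ → Ω → ℤ}

lemma IsStepReinforced.measurable_gas (hV : IsStepReinforced p V P) (n : ℕ) :
    Measurable fun z : (ℤ → ℝ) × Ω => gas z.1 (fun i => V i z.2) n := by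
  have h : Measurable fun z : (ℤ → ℝ) × Ω => (z.1, pos V n z.2) :=
    measurable_fst.prodMk ((hV.measurable_pos n).comp measurable_snd)
  have h' := measurable_scatterer.comp h
  simp only [Function.comp_def, pos] at h'
  exact h'

lemma IsStepReinforced.measurable_collisionTime (hV : IsStepReinforced p V P) (n : ℕ) :
    Measurable fun z : (ℤ → ℝ) × Ω => collisionTime z.1 (fun i => V i z.2) n :=
  Finset.measurable_fun_sum _ fun k _ => ((hV.measurable_gas (k + 1)).sub (hV.measurable_gas k)).abs

/-- For almost every medium, `T_n / n → ℓ` almost surely. -/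
lemma ae_tendsto_collisionTime {μ : Measure (ℤ → ℝ)} [IsProbabilityMeasure μ]
    (hμ : IsEntangledMedium μ) (hV : IsStepReinforced p V P) (hp0 : 0 ≤ p) (hp : p < 3 / 4) :
    ∀ᵐ ζ ∂μ, ∀ᵐ x ∂P, Tendsto (fun n : ℕ => collisionTime ζ (fun i => V i x) n / n) atTop
      (𝓝 (∫ ξ, ξ 1 ∂μ)) := by
  obtain ⟨K, hK, g, hg, hvar⟩ := hμ.exists_variance_le
  obtain ⟨K', hK', hret⟩ := hV.exists_sum_integral_comp_pos_sub_le hp0 hp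
    (fun s => (decay_pos g s).le) (decay_le_one hg) (summable_decay hg) (decay_neg g)
  set ℓ := ∫ ξ, ξ 1 ∂μ with hℓ
  -- The law of large numbers is proved under the product of medium and walk; Fubini then gives it
  -- for almost every medium.
  have key := ae_tendsto_div_of_lintegral_le (Q := μ.prod P) (l := ℓ) (K := K * Real.exp g * K')
    (Y := fun n (z : (ℤ → ℝ) × Ω) => collisionTime z.1 (fun i => V i z.2) n)
    hV.measurable_collisionTime (fun z => collisionTime_mono _ _) ?_
  · exact Measure.ae_ae_of_ae_prod key
  intro N n hN hn
  have hret := hret N n hN hn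
  have hmeas : Measurable fun z : (ℤ → ℝ) × Ω =>
      ENNReal.ofReal ((collisionTime z.1 (fun i => V i z.2) n - n * ℓ) ^ 2) :=
    (((hV.measurable_collisionTime n).sub_const _).pow_const _).ennreal_ofReal
  -- The medium is integrated first: with the walk frozen, the crossed gaps form a fixed sequence,
  -- possibly with repetitions, to which the variance bound applies.
  rw [lintegral_prod_symm _ hmeas.aemeasurable]
  have hintg : ∀ j k, Integrable (fun x => decay g (pos V k x - pos V j x)) P := fun j k =>
    hV.integrable_pos j k fun a b => decay g (b - a)
  have hint2 : Integrable (fun x => K * Real.exp g * ∑ j ∈ Finset.range n, ∑ k ∈ Finset.range n,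
      decay g (pos V k x - pos V j x)) P :=
    (integrable_finsetSum _ fun j _ => integrable_finsetSum _ fun k _ => hintg j k).const_mul _
  have hle : ∫⁻ x, ∫⁻ ζ, ENNReal.ofReal ((collisionTime ζ (fun i => V i x) n - n * ℓ) ^ 2) ∂μ ∂P ≤
      ∫⁻ x, ENNReal.ofReal (K * Real.exp g * ∑ j ∈ Finset.range n, ∑ k ∈ Finset.range n,
        decay g (pos V k x - pos V j x)) ∂P := by
    refine lintegral_mono_ae ?_
    filter_upwards [hV.ae_step] with x hx
    simp only [collisionTime_eq _ hx]
    refine (hvar n (edge fun i => V i x)).trans (ENNReal.ofReal_le_ofReal ?_)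
    rw [mul_assoc, Finset.mul_sum (Finset.range n) _ (Real.exp g)]
    gcongr with j _
    rw [Finset.mul_sum]
    gcongr with k _
    exact decay_le_of_abs_sub_le hg (abs_edge_sub_le _ j k)
  refine hle.trans ?_
  rw [← ofReal_integral_eq_lintegral_ofReal hint2 (ae_of_all _ fun x => by
    have : ∀ j k, 0 ≤ decay g (pos V k x - pos V j x) := fun j k => (decay_pos _ _).le
    have := Finset.sum_nonneg fun j (_ : j ∈ Finset.range n) =>
      Finset.sum_nonneg fun k (_ : k ∈ Finset.range n) => this j k
    simp only [Pi.zero_apply]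
    positivity), integral_const_mul,
    integral_finsetSum _ fun j _ => integrable_finsetSum _ fun k _ => hintg j k]
  simp only [fun j => integral_finsetSum (Finset.range n) fun k _ => hintg j k]
  refine ENNReal.ofReal_le_ofReal ?_
  calc _ ≤ K * Real.exp g * (K' * (n : ℝ) ^ 2 / N ^ 2) := by
        gcongr
    _ = _ := by ring

end Walk

end LevyLorentz

end

noncomputable section

namespace LevyLorentz

/-! ### The martingale part of the walk and its maximal inequality -/

/-- The martingale part of the increment of the walk between the times `n` and `m`. -/
def noiseSum (p : ℝ) (v : ℕ → ℤ) (n m : ℕ) : ℝ :=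
  ∑ i ∈ Finset.Ico n m, ((v i : ℝ) - (2 * p - 1) * walk v i / i)

lemma walk_congr {v w : ℕ → ℤ} {m : ℕ} (h : ∀ i < m, v i = w i) : walk v m = walk w m :=
  Finset.sum_congr rfl fun i hi => h i (Finset.mem_range.1 hi)

lemma noiseSum_congr (p : ℝ) {v w : ℕ → ℤ} (n : ℕ) {m : ℕ} (h : ∀ i < m, v i = w i) :
    noiseSum p v n m = noiseSum p w n m := by
  refine Finset.sum_congr rfl fun i hi => ?_
  have hin := (Finset.mem_Ico.1 hi).2
  rw [h i hin, walk_congr fun j hj => h j (hj.trans hin)]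

/-- Extension by zero of a finite sequence of steps. -/
def extendSteps {m : ℕ} (w : Fin m → ℤ) (i : ℕ) : ℤ := if h : i < m then w ⟨i, h⟩ else 0

section Walk

variable {Ω : Type*} [MeasurableSpace Ω] {P : Measure Ω} [IsProbabilityMeasure P] {p : ℝ}
  {V : ℕ → Ω → ℤ}

lemma extendSteps_past (x : Ω) {i m : ℕ} (h : i < m) : extendSteps (past V m x) i = V i x := by
  simp [extendSteps, h, past]

lemma noiseSum_extendSteps_past (n m : ℕ) (x : Ω) :
    noiseSum p (extendSteps (past V m x)) n m = noiseSum p (fun i => V i x) n m :=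
  noiseSum_congr p n fun _ hi => extendSteps_past x hi

lemma noiseSum_succ {n m : ℕ} (h : n ≤ m) (x : Ω) :
    noiseSum p (fun i => V i x) n (m + 1) =
      noiseSum p (fun i => V i x) n m + (V m x - drift p V m x) := by
  rw [noiseSum, Finset.sum_Ico_succ_top h]
  rfl

lemma noiseSum_of_le {v : ℕ → ℤ} {n m : ℕ} (h : m ≤ n) : noiseSum p v n m = 0 := by
  simp [noiseSum, Finset.Ico_eq_empty_of_le h]

namespace IsStepReinforced

/-- The filtration generated by the steps. -/
def filtration (hV : IsStepReinforced p V P) :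
    Filtration ℕ (inferInstance : MeasurableSpace Ω) where
  seq n := MeasurableSpace.comap (past V n) inferInstance
  mono' i j hij := by
    have h : past V i =
        (fun w : Fin j → ℤ => fun k : Fin i => w (Fin.castLE hij k)) ∘ past V j := rfl
    simp only
    rw [h, ← MeasurableSpace.comap_comp]
    exact MeasurableSpace.comap_mono (measurable_of_countable _).comap_le
  le' n := (hV.measurable_past n).comap_le

lemma integrable_noiseSum (hV : IsStepReinforced p V P) (n m : ℕ) (f : ℝ → ℝ) :
    Integrable (fun x => f (noiseSum p (fun i => V i x) n m)) P := by
  have h := hV.integrable_past m fun w => f (noiseSum p (extendSteps w) n m)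
  simpa only [noiseSum_extendSteps_past] using h

/-- Given the past, the new increment has mean zero and variance `1 - drift²`. With `φ` an indicator
this yields the submartingale property, with `φ = 1` the second moment. -/
lemma integral_mul_noiseSum_sq_succ (hV : IsStepReinforced p V P) {n m : ℕ} (hn : 1 ≤ n)
    (hnm : n ≤ m) (φ : (Fin m → ℤ) → ℝ) :
    ∫ x, φ (past V m x) * noiseSum p (fun i => V i x) n (m + 1) ^ 2 ∂P =
      ∫ x, φ (past V m x) *
        (noiseSum p (fun i => V i x) n m ^ 2 + (1 - drift p V m x ^ 2)) ∂P := by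
  have h := hV.integral_past_step (hn.trans hnm) fun w e => φ w *
    (noiseSum p (extendSteps w) n m + (e - (2 * p - 1) * walk (extendSteps w) m / m)) ^ 2
  have hw : ∀ x, walk (extendSteps (past V m x)) m = pos V m x := fun x =>
    walk_congr fun i hi => extendSteps_past x hi
  simp only [noiseSum_extendSteps_past, hw] at h
  simp only [noiseSum_succ hnm]
  refine Eq.trans h (integral_congr_ae (ae_of_all _ fun x => ?_))
  simp only [smul_eq_mul]
  change (1 + drift p V m x) / 2 * (φ (past V m x) *
    (noiseSum p (fun i => V i x) n m + ((1 : ℤ) - drift p V m x)) ^ 2) +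
    (1 - drift p V m x) / 2 * (φ (past V m x) *
    (noiseSum p (fun i => V i x) n m + ((-1 : ℤ) - drift p V m x)) ^ 2) = _
  push_cast
  ring

lemma submartingale_noiseSum_sq (hV : IsStepReinforced p V P) (hp0 : 0 ≤ p) (hp : p < 3 / 4)
    {n : ℕ} (hn : 1 ≤ n) :
    Submartingale (fun m x => noiseSum p (fun i => V i x) n m ^ 2) hV.filtration P := by
  refine submartingale_of_setIntegral_le_succ (fun m => ?_)
    (fun m => hV.integrable_noiseSum n m fun s => s ^ 2) fun m s hs => ?_
  · have h : (fun x => noiseSum p (fun i => V i x) n m ^ 2) =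
        (fun w : Fin m → ℤ => noiseSum p (extendSteps w) n m ^ 2) ∘ past V m := by
      funext x
      simp only [Function.comp, noiseSum_extendSteps_past]
    rw [h]
    exact ((measurable_of_countable _).comp (comap_measurable (past V m))).stronglyMeasurable
  · have hs' : MeasurableSet s := hV.filtration.le m s hs
    rcases lt_or_ge m n with hmn | hmn
    · simp only [noiseSum_of_le hmn.le, noiseSum_of_le (Nat.succ_le_of_lt hmn)]
      exact le_rfl
    obtain ⟨B, hB, rfl⟩ := hs
    have e : ∀ f : Ω → ℝ, ∫ x in past V m ⁻¹' B, f x ∂P =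
        ∫ x, B.indicator (fun _ => (1 : ℝ)) (past V m x) * f x ∂P := by
      intro f
      rw [← integral_indicator hs']
      refine integral_congr_ae (ae_of_all _ fun x => ?_)
      by_cases hx : past V m x ∈ B
      · simp [Set.indicator, hx]
      · simp [Set.indicator, hx]
    rw [e, e, hV.integral_mul_noiseSum_sq_succ hn hmn]
    refine integral_mono_ae ?_ ?_ ?_
    · have h := hV.integrable_past m fun w => B.indicator (fun _ => (1 : ℝ)) w *
        noiseSum p (extendSteps w) n m ^ 2
      simpa only [noiseSum_extendSteps_past] using h
    · have h := hV.integrable_past m fun w => B.indicator (fun _ => (1 : ℝ)) w *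
        (noiseSum p (extendSteps w) n m ^ 2 +
          (1 - ((2 * p - 1) * (∑ k : Fin m, w (Fin.castLE le_rfl k) : ℤ) / m) ^ 2))
      simpa only [noiseSum_extendSteps_past, ← pos_eq_sum_past, drift] using h
    · filter_upwards [hV.ae_abs_drift_le hp0 hp] with x hx
      have h1 : drift p V m x ^ 2 ≤ 1 := (sq_le_one_iff_abs_le_one _).2 (hx m)
      have h2 : 0 ≤ B.indicator (fun _ => (1 : ℝ)) (past V m x) :=
        Set.indicator_nonneg (fun _ _ => zero_le_one) _
      exact mul_le_mul_of_nonneg_left (by linarith) h2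

lemma integral_noiseSum_sq_le (hV : IsStepReinforced p V P) {n m : ℕ} (hn : 1 ≤ n)
    (hnm : n ≤ m) : ∫ x, noiseSum p (fun i => V i x) n m ^ 2 ∂P ≤ m - n := by
  induction m, hnm using Nat.le_induction with
  | base => simp [noiseSum_of_le le_rfl]
  | succ m hnm ih =>
    have h := hV.integral_mul_noiseSum_sq_succ hn hnm fun _ => 1
    simp only [one_mul] at h
    rw [h, integral_add (hV.integrable_noiseSum n m fun s => s ^ 2)
      (hV.integrable_drift m fun u => 1 - u ^ 2)]
    have h1 : ∫ x, (1 - drift p V m x ^ 2) ∂P ≤ ∫ _, (1 : ℝ) ∂P :=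
      integral_mono (hV.integrable_drift m fun u => 1 - u ^ 2) (integrable_const _) fun x => by
        have := sq_nonneg (drift p V m x)
        simp only
        linarith
    simp only [integral_const, probReal_univ, one_smul] at h1
    push_cast
    linarith

/-- Doob's maximal inequality for the squared martingale, whose mean grows by at most one per step.
-/
lemma measureReal_noiseSum_ge_le (hV : IsStepReinforced p V P) (hp0 : 0 ≤ p) (hp : p < 3 / 4)
    {n N : ℕ} (hn : 1 ≤ n) (hnN : n ≤ N) {ε : ℝ} (hε : 0 < ε) :
    P.real {x | ∃ m ≤ N, ε ≤ |noiseSum p (fun i => V i x) n m|} ≤ (N - n) / ε ^ 2 := by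
  have hsub := hV.submartingale_noiseSum_sq hp0 hp hn
  have h := maximal_ineq hsub (fun m x => sq_nonneg _) (ε := (ε ^ 2).toNNReal) N
  rw [Real.coe_toNNReal _ (sq_nonneg ε)] at h
  set A := {x | ε ^ 2 ≤ (Finset.range (N + 1)).sup' Finset.nonempty_range_add_one
    fun k => noiseSum p (fun i => V i x) n k ^ 2} with hA
  have hsubset : {x | ∃ m ≤ N, ε ≤ |noiseSum p (fun i => V i x) n m|} ⊆ A := by
    rintro x ⟨m, hm, hx⟩
    rw [hA, Set.mem_ofPred_eq]
    have h1 : ε ^ 2 ≤ noiseSum p (fun i => V i x) n m ^ 2 := by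
      rw [← sq_abs (noiseSum p (fun i => V i x) n m)]
      gcongr
    exact h1.trans (Finset.le_sup' (fun k => noiseSum p (fun i => V i x) n k ^ 2)
      (Finset.mem_range.2 (by omega)))
  have hle : ∫ x in A, noiseSum p (fun i => V i x) n N ^ 2 ∂P ≤ N - n :=
    (setIntegral_le_integral (hV.integrable_noiseSum n N fun s => s ^ 2)
      (ae_of_all _ fun x => sq_nonneg _)).trans (hV.integral_noiseSum_sq_le hn hnN)
  have h2 : ENNReal.ofReal (ε ^ 2) * P A ≤ ENNReal.ofReal (N - n) :=
    h.trans (ENNReal.ofReal_le_ofReal hle)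
  have hNn : (0 : ℝ) ≤ N - n := by
    have : (n : ℝ) ≤ N := by exact_mod_cast hnN
    linarith
  have h3 : ε ^ 2 * P.real A ≤ N - n := by
    have := ENNReal.toReal_mono ENNReal.ofReal_ne_top h2
    rwa [ENNReal.toReal_mul, ENNReal.toReal_ofReal (sq_nonneg ε), ENNReal.toReal_ofReal hNn] at this
  refine (measureReal_mono hsubset).trans ?_
  rw [le_div_iff₀ (by positivity)]
  linarith

/-- The oscillation of the walk between the times `n` and `N`. -/
lemma measureReal_oscillation_le (hV : IsStepReinforced p V P) (hp0 : 0 ≤ p) (hp : p < 3 / 4)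
    {M : ℝ} (hM0 : 0 < M) (hM : ∀ n : ℕ, ∫ x, (pos V n x : ℝ) ^ 2 ∂P ≤ M * n) {n N : ℕ}
    (hn : 1 ≤ n) (hnN : n ≤ N) {ε : ℝ} (hε : 0 < ε) :
    P.real {x | ∃ m, n ≤ m ∧ m ≤ N ∧ 2 * ε ≤ |(pos V m x : ℝ) - pos V n x|} ≤
      (N - n) / ε ^ 2 + (N - n) * (M + 1) / (√n * ε) := by
  have hn' : (0 : ℝ) < n := by exact_mod_cast hn
  have hdecomp : ∀ x m, n ≤ m → (pos V m x : ℝ) - pos V n x =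
      noiseSum p (fun i => V i x) n m + ∑ i ∈ Finset.Ico n m, drift p V i x := by
    intro x m hm
    have : (pos V m x : ℝ) - pos V n x = ∑ i ∈ Finset.Ico n m, (V i x : ℝ) := by
      rw [Finset.sum_Ico_eq_sub _ hm]
      simp [pos, walk]
    rw [this, noiseSum, ← Finset.sum_add_distrib]
    refine Finset.sum_congr rfl fun i _ => ?_
    simp [drift, pos]
  -- The drift is summed in absolute value, which dominates it at all intermediate times; Markov's
  -- inequality then suffices.
  set D : Ω → ℝ := fun x => ∑ i ∈ Finset.Ico n N, |drift p V i x| with hD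
  have hDint : Integrable D P :=
    integrable_finsetSum _ fun i _ => hV.integrable_drift i fun u => |u|
  have hDle : ∫ x, D x ∂P ≤ (N - n) * (M + 1) / √n := by
    rw [hD, integral_finsetSum _ fun i _ => hV.integrable_drift i fun u => |u|]
    calc ∑ i ∈ Finset.Ico n N, ∫ x, |drift p V i x| ∂P
        ≤ ∑ i ∈ Finset.Ico n N, (M + 1) / √n := by
          refine Finset.sum_le_sum fun i hi => ?_
          refine (hV.integral_abs_drift_le hp0 hp hM i).trans ?_
          have : (n : ℝ) ≤ i := by exact_mod_cast (Finset.mem_Ico.1 hi).1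
          gcongr
      _ = (N - n) * (M + 1) / √n := by
          rw [Finset.sum_const, Nat.card_Ico, nsmul_eq_mul, Nat.cast_sub hnN]
          ring
  have hmarkov : P.real {x | ε ≤ D x} ≤ (N - n) * (M + 1) / (√n * ε) := by
    have h := mul_meas_ge_le_integral_of_nonneg
      (ae_of_all P fun x => Finset.sum_nonneg fun i _ => abs_nonneg _) hDint ε
    rw [← div_div, le_div_iff₀ hε]
    linarith
  have hsubset : {x | ∃ m, n ≤ m ∧ m ≤ N ∧ 2 * ε ≤ |(pos V m x : ℝ) - pos V n x|} ⊆
      {x | ∃ m ≤ N, ε ≤ |noiseSum p (fun i => V i x) n m|} ∪ {x | ε ≤ D x} := by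
    rintro x ⟨m, hnm, hmN, hx⟩
    rw [hdecomp x m hnm] at hx
    by_cases h1 : ε ≤ |noiseSum p (fun i => V i x) n m|
    · exact Or.inl ⟨m, hmN, h1⟩
    · refine Or.inr ?_
      have h2 : |∑ i ∈ Finset.Ico n m, drift p V i x| ≤ D x := by
        refine (Finset.abs_sum_le_sum_abs _ _).trans ?_
        exact Finset.sum_le_sum_of_subset_of_nonneg (Finset.Ico_subset_Ico_right hmN)
          fun _ _ _ => abs_nonneg _
      have h3 := hx.trans (abs_add_le _ _)
      simp only [Set.mem_ofPred_eq]
      linarith [not_le.1 h1]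
  refine (measureReal_mono hsubset).trans ((measureReal_union_le _ _).trans ?_)
  exact add_le_add (hV.measureReal_noiseSum_ge_le hp0 hp hn hnN hε) hmarkov

lemma measureReal_abs_pos_ge_le (hV : IsStepReinforced p V P)
    {M : ℝ} (hM : ∀ n : ℕ, ∫ x, (pos V n x : ℝ) ^ 2 ∂P ≤ M * n) (n : ℕ) {c : ℝ} (hc : 0 < c) :
    P.real {x | c ≤ |(pos V n x : ℝ)|} ≤ M * n / c ^ 2 := by
  have h := mul_meas_ge_le_integral_of_nonneg (ae_of_all P fun x => sq_nonneg (pos V n x : ℝ))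
    (hV.integrable_pos 0 n fun _ s => (s : ℝ) ^ 2) (c ^ 2)
  have hsubset : {x | c ≤ |(pos V n x : ℝ)|} ⊆ {x | c ^ 2 ≤ (pos V n x : ℝ) ^ 2} := by
    intro x hx
    rw [Set.mem_ofPred_eq] at hx ⊢
    rw [← sq_abs (pos V n x : ℝ)]
    gcongr
  refine (measureReal_mono hsubset).trans ?_
  rw [le_div_iff₀ (by positivity)]
  have := hM n
  linarith

end IsStepReinforced

end Walk

end LevyLorentz

end

noncomputable section

namespace LevyLorentz

/-! ### Limits in distribution -/

lemma tendstoInDistribution_const_mul_gaussian {ι Ω : Type*} [MeasurableSpace Ω] {P : Measure Ω}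
    [IsProbabilityMeasure P] {Y : ι → Ω → ℝ} {l : Filter ι} {v : NNReal} (c : ℝ) (w : NNReal)
    (hw : c ^ 2 * v = w)
    (h : TendstoInDistribution Y l id (fun _ => P) (gaussianReal 0 v)) :
    TendstoInDistribution (fun n x => c * Y n x) l id (fun _ => P) (gaussianReal 0 w) := by
  have h1 := h.continuous_comp (g := fun y : ℝ => c * y) (by fun_prop)
  refine ⟨h1.forall_aemeasurable, aemeasurable_id, ?_⟩
  refine Eq.subst (motive := fun m => Tendsto _ l (𝓝 m)) (Subtype.ext ?_) h1.tendsto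
  change Measure.map ((fun y : ℝ => c * y) ∘ id) (gaussianReal 0 v) =
    Measure.map id (gaussianReal 0 w)
  rw [Measure.map_id, Function.comp_id, gaussianReal_map_const_mul, mul_zero]
  congr 1
  exact NNReal.eq (by simp [← hw])

/-! ### The continuous-time gas -/

lemma collisionTime_zero (ζ : ℤ → ℝ) (v : ℕ → ℤ) : collisionTime ζ v 0 = 0 := by
  simp [collisionTime]

lemma exists_collisionTime_le_lt {ζ : ℤ → ℝ} {v : ℕ → ℤ} {t : ℝ} (ht : 0 ≤ t) {b : ℕ}
    (hb : t < collisionTime ζ v b) :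
    ∃ n, collisionTime ζ v n ≤ t ∧ t < collisionTime ζ v (n + 1) := by
  classical
  have hex : ∃ b, t < collisionTime ζ v b := ⟨b, hb⟩
  have hspec := Nat.find_spec hex
  have hpos : Nat.find hex ≠ 0 := by
    intro h
    rw [h, collisionTime_zero] at hspec
    linarith
  obtain ⟨n, hn⟩ := Nat.exists_eq_succ_of_ne_zero hpos
  refine ⟨n, not_lt.1 (Nat.find_min hex (by omega)), ?_⟩
  rw [← Nat.succ_eq_add_one, ← hn]
  exact hspec

/-- Collision times are monotone, so the half-open flight intervals are disjoint and the index is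
unique; flights of zero length contain no time at all. -/
lemma continuousGas_eq {ζ : ℤ → ℝ} {v : ℕ → ℤ} {t : ℝ} {n : ℕ} (h1 : collisionTime ζ v n ≤ t)
    (h2 : t < collisionTime ζ v (n + 1)) :
    continuousGas ζ v t = gas ζ v n + v n * (t - collisionTime ζ v n) := by
  classical
  have hex : ∃ n, collisionTime ζ v n ≤ t ∧ t < collisionTime ζ v (n + 1) := ⟨n, h1, h2⟩
  have huniq : ∀ m, collisionTime ζ v m ≤ t → t < collisionTime ζ v (m + 1) → m = n := by
    intro m h3 h4
    by_contra hne
    rcases lt_or_gt_of_ne hne with h | h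
    · exact absurd (collisionTime_mono ζ v (Nat.succ_le_of_lt h)) (not_le.2 (h1.trans_lt h4))
    · exact absurd (collisionTime_mono ζ v (Nat.succ_le_of_lt h)) (not_le.2 (h3.trans_lt h2))
  rw [continuousGas, dif_pos hex]
  have hfind := huniq _ (Nat.find_spec hex).1 (Nat.find_spec hex).2
  convert rfl using 3 <;> rw [← hfind]

/-- The unfinished flight is no longer than its gap, itself at most `ℓ + 2ε|S| + ε + 2C`. Adding the
error at the scatterer `S` and using `|S| ≤ |s| + |S - s|` compares with any reference label `s`. -/
lemma abs_continuousGas_sub_le {ζ : ℤ → ℝ} {ℓ C ε : ℝ} (hε : 0 ≤ ε) (hℓ : 0 ≤ ℓ)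
    (hbound : ∀ r : ℤ, |scatterer ζ r - ℓ * r| ≤ ε * |(r : ℝ)| + C) {v : ℕ → ℤ}
    (hv : ∀ k, v k = 1 ∨ v k = -1) {t : ℝ} {n : ℕ} (h1 : collisionTime ζ v n ≤ t)
    (h2 : t < collisionTime ζ v (n + 1)) (s : ℤ) :
    |continuousGas ζ v t - ℓ * s| ≤ 3 * ε * |(s : ℝ)| + (ℓ + ε + 3 * C) +
      (ℓ + 3 * ε) * |(walk v n : ℝ) - s| := by
  have hvn : |(v n : ℝ)| = 1 := by rcases hv n with h | h <;> simp [h]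
  have hw : walk v (n + 1) = walk v n + v n := by simp [walk, Finset.sum_range_succ]
  rw [continuousGas_eq h1 h2]
  set S := walk v n with hS
  have ha : |(v n : ℝ) * (t - collisionTime ζ v n)| ≤ ℓ + 2 * ε * |(S : ℝ)| + ε + 2 * C := by
    rw [abs_mul, hvn, one_mul, abs_of_nonneg (by linarith)]
    have h3 : collisionTime ζ v (n + 1) =
        collisionTime ζ v n + |gas ζ v (n + 1) - gas ζ v n| := by
      rw [collisionTime, Finset.sum_range_succ]; rfl
    have h4 : |gas ζ v (n + 1) - gas ζ v n| ≤ ℓ + 2 * ε * |(S : ℝ)| + ε + 2 * C := by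
      have b1 := hbound S
      have b2 := hbound (S + v n)
      rw [gas, gas, hw, ← hS]
      have e : scatterer ζ (S + v n) - scatterer ζ S =
          (scatterer ζ (S + v n) - ℓ * ((S + v n : ℤ) : ℝ)) - (scatterer ζ S - ℓ * S) +
            ℓ * v n := by push_cast; ring
      rw [e]
      refine (abs_add_le _ _).trans ?_
      have b3 := abs_sub (scatterer ζ (S + v n) - ℓ * ((S + v n : ℤ) : ℝ)) (scatterer ζ S - ℓ * S)
      have b4 : |((S + v n : ℤ) : ℝ)| ≤ |(S : ℝ)| + 1 := by
        push_cast
        exact (abs_add_le _ _).trans (by rw [hvn])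
      rw [abs_mul, hvn, abs_of_nonneg hℓ]
      nlinarith
    linarith
  have hb := hbound S
  have hSs : |(S : ℝ)| ≤ |(s : ℝ)| + |(S : ℝ) - s| := by
    have := abs_add_le (s : ℝ) ((S : ℝ) - s)
    simpa using this
  have e : gas ζ v n + v n * (t - collisionTime ζ v n) - ℓ * s =
      (scatterer ζ S - ℓ * S) + v n * (t - collisionTime ζ v n) + ℓ * ((S : ℝ) - s) := by
    rw [gas, ← hS]; ring
  rw [e]
  refine (abs_add_le _ _).trans ?_
  have hc := abs_add_le (scatterer ζ S - ℓ * S) ((v n : ℝ) * (t - collisionTime ζ v n))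
  rw [abs_mul ℓ, abs_of_nonneg hℓ]
  nlinarith

/-- The contribution to the continuous-time gas of the flight number `n + 1`. -/
def flight (ζ : ℤ → ℝ) (v : ℕ → ℤ) (t : ℝ) (n : ℕ) : ℝ :=
  ({s | collisionTime ζ v n ≤ s ∧ s < collisionTime ζ v (n + 1)} : Set ℝ).indicator
    (fun s => gas ζ v n + v n * (s - collisionTime ζ v n)) t

/-- At most one flight contributes; writing the gas as a series of indicators gives its
measurability. -/
lemma hasSum_flight (ζ : ℤ → ℝ) (v : ℕ → ℤ) (t : ℝ) :
    HasSum (flight ζ v t) (continuousGas ζ v t) := by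
  by_cases hex : ∃ n, collisionTime ζ v n ≤ t ∧ t < collisionTime ζ v (n + 1)
  · obtain ⟨n, h1, h2⟩ := hex
    have hval : flight ζ v t n = continuousGas ζ v t := by
      rw [continuousGas_eq h1 h2, flight, Set.indicator_of_mem]
      exact ⟨h1, h2⟩
    rw [← hval]
    refine hasSum_single n fun m hm => ?_
    refine Set.indicator_of_notMem ?_ _
    rintro ⟨h3, h4⟩
    rcases lt_or_gt_of_ne hm with h | h
    · exact absurd (collisionTime_mono ζ v (Nat.succ_le_of_lt h)) (not_le.2 (h1.trans_lt h4))
    · exact absurd (collisionTime_mono ζ v (Nat.succ_le_of_lt h)) (not_le.2 (h3.trans_lt h2))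
  · have h0 : continuousGas ζ v t = 0 := by rw [continuousGas, dif_neg hex]
    rw [h0]
    have : flight ζ v t = 0 := by
      funext n
      rw [flight, Set.indicator_of_notMem]
      · rfl
      · exact fun h => hex ⟨n, h⟩
    rw [this]
    exact hasSum_zero

section Walk

variable {Ω : Type*} [MeasurableSpace Ω] {P : Measure Ω} [IsProbabilityMeasure P] {p : ℝ}
  {V : ℕ → Ω → ℤ} {ζ : ℤ → ℝ} {ℓ : ℝ}

namespace IsStepReinforced

lemma measurable_gas_right (hV : IsStepReinforced p V P) (ζ : ℤ → ℝ) (n : ℕ) :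
    Measurable fun x => gas ζ (fun i => V i x) n := by
  have h := (hV.measurable_gas n).comp (measurable_prodMk_left (x := ζ))
  simpa only [Function.comp_def] using h

lemma measurable_collisionTime_right (hV : IsStepReinforced p V P) (ζ : ℤ → ℝ) (n : ℕ) :
    Measurable fun x => collisionTime ζ (fun i => V i x) n := by
  have h := (hV.measurable_collisionTime n).comp (measurable_prodMk_left (x := ζ))
  simpa only [Function.comp_def] using h

lemma measurable_continuousGas (hV : IsStepReinforced p V P) (ζ : ℤ → ℝ) (t : ℝ) :
    Measurable fun x => continuousGas ζ (fun i => V i x) t := by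
  have hcast : ∀ n, Measurable fun x => (V n x : ℝ) := fun n =>
    (measurable_of_countable fun z : ℤ => (z : ℝ)).comp (hV.measurable n)
  have hm : ∀ n, Measurable fun x => flight ζ (fun i => V i x) t n := by
    intro n
    have hset : MeasurableSet {x | collisionTime ζ (fun i => V i x) n ≤ t ∧
        t < collisionTime ζ (fun i => V i x) (n + 1)} :=
      (measurableSet_le (hV.measurable_collisionTime_right ζ n) measurable_const).inter
        (measurableSet_lt measurable_const (hV.measurable_collisionTime_right ζ (n + 1)))
    have h := ((hV.measurable_gas_right ζ n).add ((hcast n).mul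
      ((hV.measurable_collisionTime_right ζ n).const_sub t))).indicator hset
    exact h
  refine measurable_of_tendsto_metrizable (f := fun N x =>
    ∑ n ∈ Finset.range N, flight ζ (fun i => V i x) t n)
    (fun N => Finset.measurable_fun_sum _ fun n _ => hm n) ?_
  rw [tendsto_pi_nhds]
  exact fun x => (hasSum_flight ζ _ t).tendsto_sum_nat

/-- The discrete-time gas satisfies a central limit theorem in a medium of density `1 / ℓ`. -/
theorem tendstoInDistribution_gas (hV : IsStepReinforced p V P) (hp0 : 0 ≤ p) (hp : p < 3 / 4)
    (h1 : Tendsto (fun n : ℕ => scatterer ζ n / n) atTop (𝓝 ℓ))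
    (h2 : Tendsto (fun n : ℕ => -scatterer ζ (-n) / n) atTop (𝓝 ℓ)) :
    TendstoInDistribution (fun (n : ℕ) (x : Ω) => 1 / √(n : ℝ) * gas ζ (fun i => V i x) n)
      atTop id (fun _ => P) (gaussianReal 0 (ℓ ^ 2 / (3 - 4 * p)).toNNReal) := by
  obtain ⟨M, hM0, hM⟩ := hV.exists_integral_pos_sq_le hp0 hp
  have hpos : 0 < 3 - 4 * p := by linarith
  have hclt := tendstoInDistribution_const_mul_gaussian ℓ (ℓ ^ 2 / (3 - 4 * p)).toNNReal (by
    rw [Real.coe_toNNReal _ (by positivity), Real.coe_toNNReal _ (by positivity)]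
    ring) (hV.tendstoInDistribution_pos hp0 hp)
  -- Slutsky: it remains to see that the normalized gas minus `ℓ` times the normalized walk tends to
  -- `0` in probability.
  refine tendstoInDistribution_of_tendstoInMeasure_sub _ id hclt ?_
    fun n => ((hV.measurable_gas_right ζ n).const_mul _).aemeasurable
  rw [tendstoInMeasure_iff_measureReal_norm]
  intro ε hε
  rw [Metric.tendsto_nhds]
  intro κ hκ
  obtain ⟨ε', hε', hε'κ⟩ : ∃ ε' > 0, 4 * ε' ^ 2 * M / ε ^ 2 < κ := by
    have hlim : Tendsto (fun e : ℝ => 4 * e ^ 2 * M / ε ^ 2) (𝓝[>] 0) (𝓝 0) := by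
      have : Tendsto (fun e : ℝ => 4 * e ^ 2 * M / ε ^ 2) (𝓝 0) (𝓝 (4 * 0 ^ 2 * M / ε ^ 2)) :=
        Continuous.tendsto (by fun_prop) 0
      simpa using this.mono_left nhdsWithin_le_nhds
    obtain ⟨e, h3, h4⟩ := ((hlim.eventually_lt_const hκ).and self_mem_nhdsWithin).exists
    exact ⟨e, h4, h3⟩
  obtain ⟨C, hC, hbound⟩ := exists_abs_scatterer_sub_le h1 h2 hε'
  have hsqrt : Tendsto (fun n : ℕ => √(n : ℝ)) atTop atTop :=
    Real.tendsto_sqrt_atTop.comp tendsto_natCast_atTop_atTop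
  filter_upwards [hsqrt.eventually_gt_atTop (2 * C / ε), eventually_ge_atTop 1] with n hn hn1
  have hnpos : (0 : ℝ) < n := by exact_mod_cast hn1
  have hs : 0 < √(n : ℝ) := Real.sqrt_pos.2 hnpos
  rw [div_lt_iff₀ hε] at hn
  rw [Real.dist_eq, sub_zero, abs_of_nonneg measureReal_nonneg]
  refine lt_of_le_of_lt ?_ hε'κ
  have hsubset : {x | ε ≤ ‖((fun (n : ℕ) (x : Ω) => 1 / √(n : ℝ) * gas ζ (fun i => V i x) n) -
      fun (n : ℕ) x => ℓ * (1 / √(n : ℝ) * (pos V n x : ℝ))) n x - (0 : Ω → ℝ) x‖} ⊆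
      {x | ε * √(n : ℝ) / (2 * ε') ≤ |(pos V n x : ℝ)|} := by
    intro x hx
    simp only [Set.mem_ofPred_eq, Pi.sub_apply, Pi.zero_apply, sub_zero, Real.norm_eq_abs] at hx ⊢
    have e : 1 / √(n : ℝ) * gas ζ (fun i => V i x) n - ℓ * (1 / √(n : ℝ) * (pos V n x : ℝ)) =
        (scatterer ζ (pos V n x) - ℓ * pos V n x) / √(n : ℝ) := by
      rw [gas, ← pos]; ring
    rw [e, abs_div, abs_of_pos hs, le_div_iff₀ hs] at hx
    have := hx.trans (hbound (pos V n x))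
    rw [div_le_iff₀ (by positivity)]
    linarith
  refine (measureReal_mono hsubset).trans
    ((hV.measureReal_abs_pos_ge_le hM n (by positivity)).trans (le_of_eq ?_))
  rw [div_pow, mul_pow, mul_pow, Real.sq_sqrt hnpos.le]
  field_simp
  ring

end IsStepReinforced

end Walk

end LevyLorentz

end

noncomputable section

namespace LevyLorentz

/-! ### Time change and the central limit theorem for the continuous-time gas -/

lemma exists_pos_mul_sq_lt (A : ℝ) {κ : ℝ} (hκ : 0 < κ) :
    ∃ e : ℝ, 0 < e ∧ e ≤ 1 ∧ A * e ^ 2 < κ := by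
  have hlim : Tendsto (fun e : ℝ => A * e ^ 2) (𝓝[>] 0) (𝓝 0) := by
    have : Tendsto (fun e : ℝ => A * e ^ 2) (𝓝 0) (𝓝 (A * 0 ^ 2)) :=
      Continuous.tendsto (by fun_prop) 0
    simpa using this.mono_left nhdsWithin_le_nhds
  obtain ⟨e, h1, h2, h3⟩ := ((hlim.eventually_lt_const hκ).and
    ((eventually_mem_nhdsWithin).and (Ioc_mem_nhdsGT zero_lt_one))).exists
  exact ⟨e, h2, h3.2, h1⟩

/-- The oscillation bound over the time window `[a, b]` around `t / ℓ`. -/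
lemma window_bound_le {a b t ℓ δ η M : ℝ} (ht : 0 < t) (hℓ : 0 < ℓ) (hδ : 0 < δ) (hη : 0 < η)
    (hM : 0 < M) (hab : b - a ≤ 3 * δ * t / ℓ) (ha : t / (4 * ℓ) ≤ a) :
    (b - a) / (η * √t) ^ 2 + (b - a) * (M + 1) / (√a * (η * √t)) ≤
      δ * (3 / (ℓ * η ^ 2) + 6 * (M + 1) / (√ℓ * η)) := by
  have hst : 0 < √t := Real.sqrt_pos.2 ht
  have hsl : 0 < √ℓ := Real.sqrt_pos.2 hℓ
  have ht2 : √t ^ 2 = t := Real.sq_sqrt ht.le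
  have hl2 : √ℓ ^ 2 = ℓ := Real.sq_sqrt hℓ.le
  have hsa : √t / (2 * √ℓ) ≤ √a := by
    refine Real.le_sqrt_of_sq_le ?_
    rw [div_pow, mul_pow, ht2, hl2]
    linarith [ha, show t / (4 * ℓ) = t / (2 ^ 2 * ℓ) by norm_num]
  have h1 : (b - a) / (η * √t) ^ 2 ≤ δ * (3 / (ℓ * η ^ 2)) := by
    rw [mul_pow, ht2]
    calc (b - a) / (η ^ 2 * t) ≤ (3 * δ * t / ℓ) / (η ^ 2 * t) := by gcongr
      _ = δ * (3 / (ℓ * η ^ 2)) := by field_simp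
  have h2 : (b - a) * (M + 1) / (√a * (η * √t)) ≤ δ * (6 * (M + 1) / (√ℓ * η)) := by
    calc (b - a) * (M + 1) / (√a * (η * √t))
        ≤ (3 * δ * t / ℓ) * (M + 1) / (√t / (2 * √ℓ) * (η * √t)) := by gcongr
      _ = (3 * δ * √t ^ 2 / √ℓ ^ 2) * (M + 1) / (√t / (2 * √ℓ) * (η * √t)) := by rw [ht2, hl2]
      _ = δ * (6 * (M + 1) / (√ℓ * η)) := by field_simp; ring
  linarith

/-- Relative precision `δ/2` on `T` suffices because `(1 + δ/2)(1 - δ) ≤ 1` and `(1 - δ/2)(1 + δ) ≥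
1`. -/
lemma collisionTime_le_and_lt {ζ : ℤ → ℝ} {v : ℕ → ℤ} {ℓ δ t : ℝ} (hℓ : 0 < ℓ) (hδ0 : 0 < δ)
    (hδ1 : δ ≤ 1 / 2) (ht : 0 < t) {a b : ℕ} (ha1 : 1 ≤ a) (hb1 : 1 ≤ b)
    (ha : (a : ℝ) ≤ (1 - δ) * (t / ℓ)) (hb : (1 + δ) * (t / ℓ) ≤ b)
    (hTa : |collisionTime ζ v a / a - ℓ| < ℓ * δ / 2)
    (hTb : |collisionTime ζ v b / b - ℓ| < ℓ * δ / 2) :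
    collisionTime ζ v a ≤ t ∧ t < collisionTime ζ v b := by
  have hapos : (0 : ℝ) < a := by exact_mod_cast ha1
  have hbpos : (0 : ℝ) < b := by exact_mod_cast hb1
  constructor
  · have h3 := (abs_lt.1 hTa).2
    rw [sub_lt_iff_lt_add, div_lt_iff₀ hapos] at h3
    have h4 : a * ℓ ≤ (1 - δ) * t := by
      have := mul_le_mul_of_nonneg_right ha hℓ.le
      rwa [mul_assoc, div_mul_cancel₀ _ hℓ.ne'] at this
    have h5 : (1 + δ / 2) * (a * ℓ) ≤ (1 + δ / 2) * ((1 - δ) * t) :=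
      mul_le_mul_of_nonneg_left h4 (by linarith)
    have h6 : 0 ≤ δ * t * (1 + δ) := by positivity
    linarith
  · have h3 := (abs_lt.1 hTb).1
    rw [lt_sub_iff_add_lt, lt_div_iff₀ hbpos] at h3
    have h4 : (1 + δ) * t ≤ b * ℓ := by
      have := mul_le_mul_of_nonneg_right hb hℓ.le
      rwa [mul_assoc, div_mul_cancel₀ _ hℓ.ne'] at this
    have h6 : (1 - δ / 2) * ((1 + δ) * t) ≤ (1 - δ / 2) * (b * ℓ) :=
      mul_le_mul_of_nonneg_left h4 (by linarith)
    have h5 : 0 ≤ δ * t * (1 - δ) := mul_nonneg (by positivity) (by linarith)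
    linarith

/-- For a fixed trajectory, the continuous-time gas is close to `ℓ` times the walk at a time in the
window `[a, b]`, when the collision times at both ends are typical and the walk oscillates little
in the window. -/
lemma abs_continuousGas_sub_lt {ζ : ℤ → ℝ} {v : ℕ → ℤ} {ℓ δ t ε ε' η C : ℝ} (hℓ : 0 < ℓ)
    (hδ0 : 0 < δ) (hδ1 : δ ≤ 1 / 2) (ht : 0 < t) (hε : 0 < ε) (hε'0 : 0 < ε') (hε'1 : ε' ≤ 1)
    (hηε : (ℓ + 3) * (4 * η) = ε / 4)
    (hbound : ∀ r : ℤ, |scatterer ζ r - ℓ * r| ≤ ε' * |(r : ℝ)| + C)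
    (htC : ℓ + ε' + 3 * C < ε * √t / 4) {a b n : ℕ} (ha1 : 1 ≤ a) (han : a ≤ n) (hnb : n ≤ b)
    (ha : (a : ℝ) ≤ (1 - δ) * (t / ℓ)) (hb : (1 + δ) * (t / ℓ) ≤ b)
    (hv : ∀ k, v k = 1 ∨ v k = -1)
    (hTa : |collisionTime ζ v a / a - ℓ| < ℓ * δ / 2)
    (hTb : |collisionTime ζ v b / b - ℓ| < ℓ * δ / 2)
    (hosc : ∀ m, a ≤ m → m ≤ b → |(walk v m : ℝ) - walk v a| < 2 * (η * √t))
    (hwalk : |(walk v n : ℝ)| < ε * √t / (12 * ε')) :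
    |continuousGas ζ v t - ℓ * walk v n| < ε * √t := by
  obtain ⟨hTa, hTb⟩ := collisionTime_le_and_lt hℓ hδ0 hδ1 ht ha1 (ha1.trans (han.trans hnb)) ha hb
    hTa hTb
  obtain ⟨N, hN1, hN2⟩ := exists_collisionTime_le_lt ht.le hTb
  have haN : a ≤ N := by
    by_contra hlt
    have := collisionTime_mono ζ v (by omega : N + 1 ≤ a)
    linarith
  have hNb : N ≤ b := by
    by_contra hlt
    have := collisionTime_mono ζ v (by omega : b ≤ N)
    linarith
  have hSN := hosc N haN hNb
  have hSn := hosc n han hnb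
  have hSNn : |(walk v N : ℝ) - walk v n| ≤ 4 * η * √t := by
    have := abs_sub_le (walk v N : ℝ) (walk v a) (walk v n)
    rw [abs_sub_comm (walk v a : ℝ)] at this
    linarith
  -- The flight number `N` at time `t` and the reference time `n` both lie in the window. Constants,
  -- the term `3ε'|S_n|` and the oscillation term each take at most a quarter of `ε √t`.
  have hmain := abs_continuousGas_sub_le hε'0.le hℓ.le hbound hv hN1 hN2 (walk v n)
  rw [lt_div_iff₀ (by positivity)] at hwalk
  have h7 : (ℓ + 3 * ε') * |(walk v N : ℝ) - walk v n| ≤ ε / 4 * √t := by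
    calc (ℓ + 3 * ε') * |(walk v N : ℝ) - walk v n| ≤ (ℓ + 3) * (4 * η * √t) := by
          gcongr
          linarith
      _ = ε / 4 * √t := by rw [← hηε]; ring
  have h8 : 0 < ε * √t := by positivity
  linarith

section Walk

variable {Ω : Type*} [MeasurableSpace Ω] {P : Measure Ω} [IsProbabilityMeasure P] {p : ℝ}
  {V : ℕ → Ω → ℤ} {ζ : ℤ → ℝ} {ℓ : ℝ}

namespace IsStepReinforced

set_option maxHeartbeats 800000 in
/-- The continuous-time gas is close to `ℓ` times the walk at time `t / ℓ`. -/
lemma eventually_measureReal_continuousGas_sub_le (hV : IsStepReinforced p V P) (hp0 : 0 ≤ p)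
    (hp : p < 3 / 4) (hℓ : 0 < ℓ)
    (h1 : Tendsto (fun n : ℕ => scatterer ζ n / n) atTop (𝓝 ℓ))
    (h2 : Tendsto (fun n : ℕ => -scatterer ζ (-n) / n) atTop (𝓝 ℓ))
    (hT : ∀ᵐ x ∂P, Tendsto (fun n : ℕ => collisionTime ζ (fun i => V i x) n / n) atTop (𝓝 ℓ))
    {ε κ : ℝ} (hε : 0 < ε) (hκ : 0 < κ) :
    ∀ᶠ t : ℝ in atTop, P.real {x | ε * √t ≤
      |continuousGas ζ (fun i => V i x) t - ℓ * pos V ⌊t / ℓ⌋₊ x|} ≤ κ := by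
  obtain ⟨M, hM0, hM⟩ := hV.exists_integral_pos_sq_le hp0 hp
  set η : ℝ := ε / (16 * (ℓ + 3)) with hη
  have hη0 : 0 < η := by positivity
  have hηε : (ℓ + 3) * (4 * η) = ε / 4 := by rw [hη]; field_simp; norm_num
  set Q : ℝ := 3 / (ℓ * η ^ 2) + 6 * (M + 1) / (√ℓ * η) with hQ
  have hQ0 : 0 < Q := by
    have : 0 < √ℓ := Real.sqrt_pos.2 hℓ
    positivity
  -- The window is narrow enough for the oscillation probability, bounded by `δ Q` uniformly in `t`,
  -- to be at most `κ / 4`.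
  set δ : ℝ := min (1 / 2) (κ / (4 * Q)) with hδ
  have hδ0 : 0 < δ := lt_min (by norm_num) (by positivity)
  have hδ1 : δ ≤ 1 / 2 := min_le_left _ _
  have hδQ : δ * Q ≤ κ / 4 := by
    calc δ * Q ≤ κ / (4 * Q) * Q := by gcongr; exact min_le_right _ _
      _ = κ / 4 := by field_simp
  -- Chosen so that Chebyshev's inequality for `S_n` at level `ε√t / (12 ε')` costs at most `κ / 4`.
  obtain ⟨ε', hε'0, hε'1, hε'κ⟩ := exists_pos_mul_sq_lt (M * 144 / (ε ^ 2 * ℓ))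
    (by positivity : 0 < κ / 4)
  obtain ⟨C, hC, hbound⟩ := exists_abs_scatterer_sub_le h1 h2 hε'0
  have hTm : Tendsto (fun n : ℕ => P.real {x | ℓ * δ / 2 ≤
      |collisionTime ζ (fun i => V i x) n / n - ℓ|}) atTop (𝓝 0) := by
    have h := tendstoInMeasure_of_tendsto_ae (fun n : ℕ =>
      ((hV.measurable_collisionTime_right ζ n).div_const (n : ℝ)).aestronglyMeasurable) hT
    rw [tendstoInMeasure_iff_measureReal_norm] at h
    exact h (ℓ * δ / 2) (by positivity)
  have hdiv : ∀ c : ℝ, 0 < c → Tendsto (fun t : ℝ => c * t / ℓ) atTop atTop := fun c hc =>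
    (tendsto_id.const_mul_atTop hc).atTop_div_const hℓ
  have ha := hTm.comp (tendsto_nat_floor_atTop.comp (hdiv (1 - δ) (by linarith)))
  have hb := hTm.comp (tendsto_nat_ceil_atTop.comp (hdiv (1 + δ) (by linarith)))
  have hbad : P.real {x | ¬ ∀ k, V k x = 1 ∨ V k x = -1} = 0 := by
    have := hV.ae_step
    rw [ae_iff] at this
    rw [Measure.real, this, ENNReal.toReal_zero]
  -- The condition `δ t / ℓ ≥ 2` absorbs the rounding of `a` and `b`: the window length `2δt/ℓ + 2`
  -- is at most `3δt/ℓ`. The two collision-time events cost `κ / 8` each.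
  filter_upwards [eventually_gt_atTop 0, (hdiv δ hδ0).eventually_ge_atTop 2,
    Real.tendsto_sqrt_atTop.eventually_gt_atTop (4 * (ℓ + ε' + 3 * C) / ε),
    ha.eventually_lt_const (by positivity : 0 < κ / 8),
    hb.eventually_lt_const (by positivity : 0 < κ / 8)] with t ht htδ htC hPa hPb
  simp only [Function.comp] at hPa hPb
  set a := ⌊(1 - δ) * t / ℓ⌋₊ with hadef
  set b := ⌈(1 + δ) * t / ℓ⌉₊ with hbdef
  set n := ⌊t / ℓ⌋₊ with hndef
  have hst : 0 < √t := Real.sqrt_pos.2 ht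
  have htl : 0 < t / ℓ := by positivity
  have htδ' : 2 ≤ δ * (t / ℓ) := by rwa [mul_div_assoc] at htδ
  have hale : (a : ℝ) ≤ (1 - δ) * (t / ℓ) := by
    rw [← mul_div_assoc]
    exact Nat.floor_le (div_nonneg (mul_nonneg (by linarith) ht.le) hℓ.le)
  have halt : (1 - δ) * (t / ℓ) < a + 1 := by
    rw [← mul_div_assoc]; exact Nat.lt_floor_add_one _
  have hbge : (1 + δ) * (t / ℓ) ≤ b := by rw [← mul_div_assoc]; exact Nat.le_ceil _
  have hblt : (b : ℝ) < (1 + δ) * (t / ℓ) + 1 := by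
    rw [← mul_div_assoc]
    exact Nat.ceil_lt_add_one (div_nonneg (mul_nonneg (by linarith) ht.le) hℓ.le)
  have hnle : (n : ℝ) ≤ t / ℓ := Nat.floor_le htl.le
  have han : a ≤ n := by
    refine Nat.floor_le_floor ?_
    rw [mul_div_assoc]
    nlinarith
  have hnb : n ≤ b := by
    have : (n : ℝ) ≤ b := hnle.trans (le_trans (by nlinarith) hbge)
    exact_mod_cast this
  have hba : (b : ℝ) - a ≤ 3 * δ * t / ℓ := by rw [mul_div_assoc]; nlinarith
  have ha4 : t / (4 * ℓ) ≤ a := by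
    rw [show t / (4 * ℓ) = (t / ℓ) / 4 by field_simp]
    nlinarith
  have ha1 : 1 ≤ a := by
    have : (0 : ℝ) < a := lt_of_lt_of_le (by positivity) ha4
    exact_mod_cast this
  have htC' : ℓ + ε' + 3 * C < ε * √t / 4 := by
    rw [div_lt_iff₀ hε] at htC
    linarith
  have hosc := hV.measureReal_oscillation_le hp0 hp hM0 hM ha1 (han.trans hnb)
    (ε := η * √t) (by positivity)
  have hosc' := hosc.trans ((window_bound_le ht hℓ hδ0 hη0 hM0 hba ha4).trans hδQ)
  have hpos := hV.measureReal_abs_pos_ge_le hM n (c := ε * √t / (12 * ε')) (by positivity)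
  have hpos' : M * n / (ε * √t / (12 * ε')) ^ 2 ≤ κ / 4 := by
    refine le_trans ?_ hε'κ.le
    rw [div_pow, mul_pow, Real.sq_sqrt ht.le]
    calc M * n / (ε ^ 2 * t / (12 * ε') ^ 2) ≤ M * (t / ℓ) / (ε ^ 2 * t / (12 * ε') ^ 2) := by
          gcongr
      _ = M * 144 / (ε ^ 2 * ℓ) * ε' ^ 2 := by field_simp; ring
  have hsubset : {x | ε * √t ≤ |continuousGas ζ (fun i => V i x) t - ℓ * pos V n x|} ⊆
      ((({x | ℓ * δ / 2 ≤ |collisionTime ζ (fun i => V i x) a / a - ℓ|} ∪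
        {x | ℓ * δ / 2 ≤ |collisionTime ζ (fun i => V i x) b / b - ℓ|}) ∪
        {x | ∃ m, a ≤ m ∧ m ≤ b ∧ 2 * (η * √t) ≤ |(pos V m x : ℝ) - pos V a x|}) ∪
        {x | ε * √t / (12 * ε') ≤ |(pos V n x : ℝ)|}) ∪
        {x | ¬ ∀ k, V k x = 1 ∨ V k x = -1} := by
    intro x hx
    by_contra hnot
    simp only [Set.mem_union, Set.mem_ofPred_eq, not_or, not_not, not_exists, not_and, not_le]
      at hnot hx
    obtain ⟨⟨⟨⟨hxa, hxb⟩, hxo⟩, hxs⟩, hstep⟩ := hnot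
    refine absurd hx (not_le.2 ?_)
    exact abs_continuousGas_sub_lt hℓ hδ0 hδ1 ht hε hε'0 hε'1 hηε hbound htC' ha1 han hnb hale
      hbge hstep hxa hxb hxo hxs
  refine (measureReal_mono hsubset).trans ?_
  refine (measureReal_union_le _ _).trans ?_
  rw [hbad, add_zero]
  refine (measureReal_union_le _ _).trans ?_
  refine (add_le_add_left ((measureReal_union_le _ _).trans
    (add_le_add_left (measureReal_union_le _ _) _)) _).trans ?_
  linarith

/-- The continuous-time gas satisfies a central limit theorem in a medium of density `1 / ℓ`. -/
theorem tendstoInDistribution_continuousGas (hV : IsStepReinforced p V P) (hp0 : 0 ≤ p)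
    (hp : p < 3 / 4) (hℓ : 0 < ℓ)
    (h1 : Tendsto (fun n : ℕ => scatterer ζ n / n) atTop (𝓝 ℓ))
    (h2 : Tendsto (fun n : ℕ => -scatterer ζ (-n) / n) atTop (𝓝 ℓ))
    (hT : ∀ᵐ x ∂P, Tendsto (fun n : ℕ => collisionTime ζ (fun i => V i x) n / n) atTop (𝓝 ℓ)) :
    TendstoInDistribution (fun (t : ℝ) (x : Ω) => 1 / √t * continuousGas ζ (fun i => V i x) t)
      atTop id (fun _ => P) (gaussianReal 0 (ℓ / (3 - 4 * p)).toNNReal) := by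
  obtain ⟨M, hM0, hM⟩ := hV.exists_integral_pos_sq_le hp0 hp
  have hpos : 0 < 3 - 4 * p := by linarith
  have hfloor : Tendsto (fun t : ℝ => ⌊t / ℓ⌋₊) atTop atTop :=
    tendsto_nat_floor_atTop.comp (tendsto_id.atTop_div_const hℓ)
  have hwalk := hV.tendstoInDistribution_pos hp0 hp
  have hwalk' : TendstoInDistribution
      (fun (t : ℝ) (x : Ω) => 1 / √(⌊t / ℓ⌋₊ : ℝ) * (pos V ⌊t / ℓ⌋₊ x : ℝ)) atTop id (fun _ => P)
      (gaussianReal 0 (1 / (3 - 4 * p)).toNNReal) :=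
    ⟨fun t => hwalk.forall_aemeasurable _, hwalk.aemeasurable_limit, hwalk.tendsto.comp hfloor⟩
  have hclt := tendstoInDistribution_const_mul_gaussian √ℓ (ℓ / (3 - 4 * p)).toNNReal (by
    rw [Real.coe_toNNReal _ (by positivity), Real.coe_toNNReal _ (by positivity),
      Real.sq_sqrt hℓ.le]
    ring) hwalk'
  refine tendstoInDistribution_of_tendstoInMeasure_sub _ id hclt ?_
    fun t => ((hV.measurable_continuousGas ζ t).const_mul _).aemeasurable
  rw [tendstoInMeasure_iff_measureReal_norm]
  intro ε hε
  -- With `n = ⌊t/ℓ⌋` one has `ℓ √(n/t) → √ℓ`; this deterministic factor turns normalization by `√t`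
  -- into normalization by `√n`.
  have hratio : Tendsto (fun t : ℝ => ℓ * √((⌊t / ℓ⌋₊ : ℝ) / t) - √ℓ) atTop (𝓝 0) := by
    have h3 : Tendsto (fun t : ℝ => (⌊t / ℓ⌋₊ : ℝ) / t) atTop (𝓝 (1 / ℓ)) := by
      have := (tendsto_nat_floor_mul_div_atTop (R := ℝ) (a := 1 / ℓ) (by positivity))
      refine this.congr fun t => ?_
      rw [one_div_mul_eq_div]
    have h4 := (h3.sqrt.const_mul ℓ).sub_const √ℓ
    have h5 : ℓ * √(1 / ℓ) - √ℓ = 0 := by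
      have hs : 0 < √ℓ := Real.sqrt_pos.2 hℓ
      rw [Real.sqrt_div zero_le_one, Real.sqrt_one, mul_one_div, Real.div_sqrt, sub_self]
    rwa [h5] at h4
  rw [Metric.tendsto_nhds]
  intro κ hκ
  have hsmall : Tendsto (fun t : ℝ => 4 * M / ε ^ 2 * (ℓ * √((⌊t / ℓ⌋₊ : ℝ) / t) - √ℓ) ^ 2) atTop
      (𝓝 0) := by
    simpa using (hratio.pow 2).const_mul (4 * M / ε ^ 2)
  filter_upwards [hV.eventually_measureReal_continuousGas_sub_le hp0 hp hℓ h1 h2 hT (half_pos hε)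
    (half_pos hκ), hsmall.eventually_lt_const (half_pos hκ), eventually_gt_atTop 0,
    hfloor.eventually_ge_atTop 1] with t hA hB ht hn1
  set n := ⌊t / ℓ⌋₊ with hn
  set c := ℓ * √((n : ℝ) / t) - √ℓ with hc
  have hst : 0 < √t := Real.sqrt_pos.2 ht
  have hnpos : (0 : ℝ) < n := by exact_mod_cast hn1
  have hsn : 0 < √(n : ℝ) := Real.sqrt_pos.2 hnpos
  rw [Real.dist_eq, sub_zero, abs_of_nonneg measureReal_nonneg]
  have hcheb : P.real {x | ε / 2 ≤ |c * (pos V n x / √(n : ℝ))|} ≤ 4 * M / ε ^ 2 * c ^ 2 := by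
    -- Chebyshev's level divides by `|c|`, so a vanishing factor is treated apart.
    rcases eq_or_ne c 0 with h0 | h0
    · have : {x | ε / 2 ≤ |c * (pos V n x / √(n : ℝ))|} = ∅ := by
        ext x
        simp [h0, hε]
      rw [this, h0]
      simp
    have hc0 : 0 < |c| := abs_pos.2 h0
    have hset : {x | ε / 2 ≤ |c * (pos V n x / √(n : ℝ))|} ⊆
        {x | ε * √(n : ℝ) / (2 * |c|) ≤ |(pos V n x : ℝ)|} := by
      intro x hx
      simp only [Set.mem_ofPred_eq] at hx ⊢
      rw [abs_mul, abs_div, abs_of_pos hsn, mul_div_assoc', le_div_iff₀ hsn] at hx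
      rw [div_le_iff₀ (by positivity)]
      linarith
    refine (measureReal_mono hset).trans
      ((hV.measureReal_abs_pos_ge_le hM n (by positivity)).trans (le_of_eq ?_))
    rw [div_pow, mul_pow, mul_pow, Real.sq_sqrt hnpos.le, sq_abs]
    field_simp
    ring
  have hsubset : {x | ε ≤ ‖((fun (t : ℝ) (x : Ω) =>
      1 / √t * continuousGas ζ (fun i => V i x) t) -
      fun (t : ℝ) x => √ℓ * (1 / √(⌊t / ℓ⌋₊ : ℝ) * (pos V ⌊t / ℓ⌋₊ x : ℝ))) t x -
        (0 : Ω → ℝ) x‖} ⊆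
      {x | ε / 2 * √t ≤ |continuousGas ζ (fun i => V i x) t - ℓ * pos V n x|} ∪
      {x | ε / 2 ≤ |c * (pos V n x / √(n : ℝ))|} := by
    intro x hx
    simp only [Set.mem_ofPred_eq, Pi.sub_apply, Pi.zero_apply, sub_zero, Real.norm_eq_abs,
      Set.mem_union] at hx ⊢
    rw [← hn] at hx
    by_contra hnot
    rw [not_or, not_le, not_le] at hnot
    have e : 1 / √t * continuousGas ζ (fun i => V i x) t -
        √ℓ * (1 / √(n : ℝ) * (pos V n x : ℝ)) =
        (continuousGas ζ (fun i => V i x) t - ℓ * pos V n x) / √t +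
          c * (pos V n x / √(n : ℝ)) := by
      rw [hc, Real.sqrt_div hnpos.le]
      field_simp
      ring
    rw [e] at hx
    have h3 := hx.trans (abs_add_le _ _)
    rw [abs_div, abs_of_pos hst] at h3
    have h4 : |continuousGas ζ (fun i => V i x) t - ℓ * pos V n x| / √t < ε / 2 := by
      rw [div_lt_iff₀ hst]; exact hnot.1
    linarith [hnot.2]
  have := (measureReal_mono (μ := P) hsubset).trans (measureReal_union_le _ _)
  linarith

end IsStepReinforced

end Walk

lemma tendsto_atTop_of_tendsto_div {u : ℕ → ℝ} {ℓ : ℝ} (hℓ : 0 < ℓ)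
    (h : Tendsto (fun n : ℕ => u n / n) atTop (𝓝 ℓ)) : Tendsto u atTop atTop := by
  refine (h.pos_mul_atTop hℓ tendsto_natCast_atTop_atTop).congr' ?_
  filter_upwards [eventually_ge_atTop 1] with n hn
  have : (n : ℝ) ≠ 0 := by positivity
  field_simp

end LevyLorentz

end

theorem mainTheorem3 (μ : Measure (ℤ → ℝ)) [IsProbabilityMeasure μ]
    (hμ : LevyLorentz.IsEntangledMedium μ)
    {Ω : Type*} [MeasurableSpace Ω] (P : Measure Ω) [IsProbabilityMeasure P]
    (p : ℝ) (hp0 : 0 ≤ p) (hp : p < 3 / 4) (V : ℕ → Ω → ℤ)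
    (hV : LevyLorentz.IsStepReinforced p V P) :
    ∃ ℓ : ℝ, 0 < ℓ ∧
      (∀ᵐ ζ ∂μ, Tendsto (fun n : ℕ => LevyLorentz.scatterer ζ n / n) atTop (𝓝 ℓ)) ∧
      ∀ᵐ ζ ∂μ,
        TendstoInDistribution
          (fun (n : ℕ) (x : Ω) => 1 / √(n : ℝ) * LevyLorentz.gas ζ (fun i => V i x) n)
          atTop id (fun _ => P) (gaussianReal 0 (ℓ ^ 2 / (3 - 4 * p)).toNNReal) ∧
        (∀ᵐ x ∂P, Tendsto (LevyLorentz.collisionTime ζ (fun i => V i x)) atTop atTop) ∧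
        TendstoInDistribution
          (fun (t : ℝ) (x : Ω) => 1 / √t * LevyLorentz.continuousGas ζ (fun i => V i x) t)
          atTop id (fun _ => P) (gaussianReal 0 (ℓ / (3 - 4 * p)).toNNReal) := by
  refine ⟨∫ ξ, ξ 1 ∂μ, hμ.mean_pos, hμ.ae_tendsto_scatterer, ?_⟩
  -- Three almost sure properties of the medium suffice from here on: density `1/ℓ` on each
  -- half-line, and `T_n / n → ℓ`.
  filter_upwards [hμ.ae_tendsto_scatterer, hμ.ae_tendsto_scatterer_neg,
    LevyLorentz.ae_tendsto_collisionTime hμ hV hp0 hp] with ζ h1 h2 hT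
  refine ⟨hV.tendstoInDistribution_gas hp0 hp h1 h2, ?_,
    hV.tendstoInDistribution_continuousGas hp0 hp hμ.mean_pos h1 h2 hT⟩
  filter_upwards [hT] with x hx
  exact LevyLorentz.tendsto_atTop_of_tendsto_div hμ.mean_pos hx
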